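/- Let $\Omega\subset\mathbb R^N$ be open, $n\ge 1$, $1<p<N$, $p^*=\frac{Np}{N-p}$, $0<\varepsilon<\frac pN$ and $\kappa=\frac{N}{p-\varepsilon N}$. Consider $$J(u,S)=\int_S\sum_{\alpha=1}^n f_\alpha(x,u^\alpha,\nabla u^\alpha)+G(x,u,\nabla u)\,dx$$ under the following hypotheses (all pointwise conditions hold for a.e. $x\in\Omega$ and all values of the other variables). (H.1.1) For each $\alpha$, $f_\alpha:\Omega\times\mathbb R\times\mathbb R^N\to\mathbb R$ is a Carathéodory function with $$|\xi|^p-b_\alpha(x)|s|^{\gamma_\alpha}-a_\alpha(x)\le f_\alpha(x,s,\xi)\le L_\alpha\big(|\xi|^p+b_\alpha(x)|s|^{\gamma_\alpha}+a_\alpha(x)\big),$$ where $L_\alpha>1$, $p\le\gamma_\alpha<p^*$, $\gamma_\alpha+\varepsilon p^*<p^*$, and $a_\alpha,b_\alpha\ge0$ with $b_\alpha\in L^{\sigma_\alpha}_{loc}(\Omega)$, $\sigma_\alpha=\frac{p^*}{p^*-\gamma_\alpha-\varepsilon p^*}$, $a_\alpha\in L^\kappa_{loc}(\Omega)$. (H.1.2)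 $G:\Omega\times\mathbb R^n\times\mathbb R^{Nn}\to\mathbb R$ is a Carathéodory function with $|G(x,v,\xi)|\le C(|\xi|^q+|v|^q+a(x))$, where $C>1$, $1\le q<\frac{p^2}{N}$, $a\ge0$, $a\in L^\kappa_{loc}(\Omega)$. (H.1.3) $G(x,v,\cdot)$ is rank-one convex: $G(x,v,\lambda\xi^1+(1-\lambda)\xi^2)\le\lambda G(x,v,\xi^1)+(1-\lambda)G(x,v,\xi^2)$ for $\lambda\in[0,1]$ whenever $\operatorname{rank}(\xi^1-\xi^2)\le1$. (H.1.4) $|G(x,v,\xi)-G(x,w,\xi)|\le c(x)|\xi|^\delta|v-w|^\beta$, where $0<\delta<q$, $0<\beta<\min\{\frac{p^*(q-\delta)}{q},\,p-\delta,\,1\}$, $c\ge0$, and either $c\in L^\sigma_{loc}(\Omega)$ with $\frac{p^*q}{p^*(q-\delta)-\beta q}<\sigma<\infty$ and $\frac\delta p+\frac\beta{p^*}+\frac1\sigma<\frac pN$, or (H.1.4 bis) $c\in L^\infty_{loc}(\Omega)$ and $\frac\delta p+\frac\beta{p^*}<\frac pN$ (in this case put $\sigma=\infty$, $\frac1\sigma=0$).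 Let $u\in W^{1,p}_{loc}(\Omega,\mathbb R^n)$ be a local minimizer of $J$, that is, $J(u,K)\le J(u+\varphi,K)$ for every compact $K\subset\Omega$ and every $\varphi\in W^{1,p}(\Omega,\mathbb R^n)$ vanishing a.e. outside $K$. Put $$\varepsilon_*=\min\Big\{\varepsilon,\ \frac pN-\frac qp,\ \frac pN-\Big(\frac\delta p+\frac\beta{p^*}+\frac1\sigma\Big)\Big\}>0 ,$$ so that $\varepsilon_*=\varepsilon$ when $\varepsilon$ is small. Then for every compact $K\subset\Omega$ there are constants $C_{C,1},C_{C,2}>0$ and a radius $R_0>0$ such that for all $x_0\in K$ one has $\overline{B_{R_0}(x_0)}\subset\Omega$ and, for all $\alpha=1,\dots,n$, all $0<\varrho<R<R_0$ and all $k\in\mathbb R$, $$\int_{A^\alpha_{k,\varrho}}|\nabla u^\alpha|^p\,dx\le\frac{C_{C,1}}{(R-\varrho)^p}\int_{A^\alpha_{k,R}}(u^\alpha-k)^p\,dx+C_{C,2}\big(1+|k|^pR^{-\varepsilon_* N}\big)|A^\alpha_{k,R}|^{1-\frac pN+\varepsilon_*}$$ and $$\int_{B^\alpha_{k,\varrho}}|\nabla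 u^\alpha|^p\,dx\le\frac{C_{C,1}}{(R-\varrho)^p}\int_{B^\alpha_{k,R}}(k-u^\alpha)^p\,dx+C_{C,2}\big(1+|k|^pR^{-\varepsilon_* N}\big)|B^\alpha_{k,R}|^{1-\frac pN+\varepsilon_*},$$ where $A^\alpha_{k,s}=\{u^\alpha>k\}\cap B_s(x_0)$ and $B^\alpha_{k,s}=\{u^\alpha<k\}\cap B_s(x_0)$. -/

import Mathlib

open MeasureTheory Set
open scoped ENNReal ContDiff

noncomputable section

/-- Points of `ℝ^N`, with the Euclidean norm. -/
abbrev Pt (N : ℕ) := EuclideanSpace ℝ (Fin N)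

/-- Values in `ℝ^n`, with the Euclidean norm. -/
abbrev Val (n : ℕ) := EuclideanSpace ℝ (Fin n)

/-- Gradient matrices in `ℝ^{Nn}`: the row `ξ α` is the gradient of the `α`-th component.
The norm is the Euclidean (Frobenius) norm. -/
abbrev Grad (n N : ℕ) := PiLp 2 (fun _ : Fin n => EuclideanSpace ℝ (Fin N))

/-- `g ∈ L^r_loc(Ω)`. -/
def IsLpLoc {N : ℕ} {F : Type*} [NormedAddCommGroup F]
    (Ω : Set (Pt N)) (r : ℝ≥0∞) (g : Pt N → F) : Prop :=
  ∀ K : Set (Pt N), IsCompact K → K ⊆ Ω → MemLp g r (volume.restrict K)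

/-- `Dv` is the weak gradient of the scalar function `v` on `Ω`. (It is applied only to locally
integrable `v` and `Dv`.) -/
def HasWeakGradient {N : ℕ} (Ω : Set (Pt N)) (v : Pt N → ℝ) (Dv : Pt N → Pt N) : Prop :=
  ∀ ψ : Pt N → ℝ, ContDiff ℝ ∞ ψ → HasCompactSupport ψ → tsupport ψ ⊆ Ω →
    ∀ i : Fin N,
      ∫ x in Ω, v x * fderiv ℝ ψ x (EuclideanSpace.single i 1) = - ∫ x in Ω, Dv x i * ψ x

/-- `u ∈ W^{1,p}_loc(Ω; ℝ^n)` with weak gradient `Du`. -/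
structure IsSobolevLoc {n N : ℕ} (Ω : Set (Pt N)) (p : ℝ)
    (u : Pt N → Val n) (Du : Pt N → Grad n N) : Prop where
  memLp : IsLpLoc Ω (ENNReal.ofReal p) u
  memLp_grad : IsLpLoc Ω (ENNReal.ofReal p) Du
  weakGradient : ∀ α : Fin n, HasWeakGradient Ω (fun x => u x α) (fun x => Du x α)

/-- `φ ∈ W^{1,p}(Ω; ℝ^n)` with weak gradient `Dφ`. -/
structure IsSobolev {n N : ℕ} (Ω : Set (Pt N)) (p : ℝ)
    (φ : Pt N → Val n) (Dφ : Pt N → Grad n N) : Prop where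
  memLp : MemLp φ (ENNReal.ofReal p) (volume.restrict Ω)
  memLp_grad : MemLp Dφ (ENNReal.ofReal p) (volume.restrict Ω)
  weakGradient : ∀ α : Fin n, HasWeakGradient Ω (fun x => φ x α) (fun x => Dφ x α)

/-- Carathéodory functions on `Ω × Y`: measurable in `x ∈ Ω` for every `y`, continuous in `y`
for almost every `x ∈ Ω`. -/
structure IsCaratheodory {N : ℕ} {Y : Type*} [TopologicalSpace Y]
    (Ω : Set (Pt N)) (h : Pt N → Y → ℝ) : Prop where
  measurable : ∀ y : Y, AEMeasurable (fun x => h x y) (volume.restrict Ω)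
  continuous : ∀ᵐ x ∂(volume.restrict Ω), Continuous (h x)

/-- The Sobolev exponent `p^* = N p / (N - p)`. -/
def sobolevExp (N : ℕ) (p : ℝ) : ℝ := N * p / (N - p)

/-- The exponent `σ_α = p^* / (p^* - γ_α - ε p^*)`. -/
def sigmaExp (N : ℕ) (p ε γ : ℝ) : ℝ :=
  sobolevExp N p / (sobolevExp N p - γ - ε * sobolevExp N p)

/-- The exponent `κ = N / (p - ε N)`. -/
def kappaExp (N : ℕ) (p ε : ℝ) : ℝ := N / (p - ε * N)

/-- Hypothesis on `f_α`: Carathéodory function with `p`-growth from above and below. The condition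
`γ_add_lt` says that the exponent `σ_α` is meaningful, i.e. has a positive denominator. -/
structure GrowthF {N : ℕ} (Ω : Set (Pt N)) (p ε γ L : ℝ) (a b : Pt N → ℝ)
    (f : Pt N → ℝ → Pt N → ℝ) : Prop where
  caratheodory : IsCaratheodory Ω (fun x (y : ℝ × Pt N) => f x y.1 y.2)
  one_lt_L : 1 < L
  p_le_γ : p ≤ γ
  γ_lt : γ < sobolevExp N p
  γ_add_lt : γ + ε * sobolevExp N p < sobolevExp N p
  b_nonneg : ∀ᵐ x ∂(volume.restrict Ω), 0 ≤ b x
  a_nonneg : ∀ᵐ x ∂(volume.restrict Ω), 0 ≤ a x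
  b_memLp : IsLpLoc Ω (ENNReal.ofReal (sigmaExp N p ε γ)) b
  a_memLp : IsLpLoc Ω (ENNReal.ofReal (kappaExp N p ε)) a
  growth : ∀ᵐ x ∂(volume.restrict Ω), ∀ (s : ℝ) (ξ : Pt N),
    ‖ξ‖ ^ p - b x * |s| ^ γ - a x ≤ f x s ξ ∧
      f x s ξ ≤ L * (‖ξ‖ ^ p + b x * |s| ^ γ + a x)

/-- Hypothesis on the size of `G`: Carathéodory function with `q`-growth, `1 ≤ q < p² / N`. -/
structure GrowthG {n N : ℕ} (Ω : Set (Pt N)) (p ε q C : ℝ) (a : Pt N → ℝ)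
    (G : Pt N → Val n → Grad n N → ℝ) : Prop where
  caratheodory : IsCaratheodory Ω (fun x (y : Val n × Grad n N) => G x y.1 y.2)
  one_lt_C : 1 < C
  one_le_q : 1 ≤ q
  q_lt : q < p ^ 2 / N
  a_nonneg : ∀ᵐ x ∂(volume.restrict Ω), 0 ≤ a x
  a_memLp : IsLpLoc Ω (ENNReal.ofReal (kappaExp N p ε)) a
  growth : ∀ᵐ x ∂(volume.restrict Ω), ∀ (v : Val n) (ξ : Grad n N),
    |G x v ξ| ≤ C * (‖ξ‖ ^ q + ‖v‖ ^ q + a x)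

/-- `G(x, v, ·)` is rank one convex for a.e. `x ∈ Ω` and every `v`. -/
def RankOneConvexG {n N : ℕ} (Ω : Set (Pt N)) (G : Pt N → Val n → Grad n N → ℝ) : Prop :=
  ∀ᵐ x ∂(volume.restrict Ω), ∀ (v : Val n) (t : ℝ) (ξ₁ ξ₂ : Grad n N),
    0 ≤ t → t ≤ 1 →
    (Matrix.of fun (α : Fin n) (i : Fin N) => ξ₁ α i - ξ₂ α i).rank ≤ 1 →
    G x v (t • ξ₁ + (1 - t) • ξ₂) ≤ t * G x v ξ₁ + (1 - t) * G x v ξ₂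

/-- Hölder dependence of `G` on the value variable, with a coefficient `c ∈ L^σ_loc`. The exponent
`σ` is an extended number and `1 / ∞ = 0`: for `σ < ∞` the conditions are
`σ > p^* q / (p^* (q - δ) - β q)` and `δ / p + β / p^* + 1 / σ < p / N`; for `σ = ∞` they reduce
to `c ∈ L^∞_loc` and `δ / p + β / p^* < p / N`. -/
structure HolderG {n N : ℕ} (Ω : Set (Pt N)) (p q δ β : ℝ) (σ : ℝ≥0∞) (c : Pt N → ℝ)
    (G : Pt N → Val n → Grad n N → ℝ) : Prop where
  δ_pos : 0 < δ
  δ_lt : δ < q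
  β_pos : 0 < β
  β_lt : β < min (sobolevExp N p * (q - δ) / q) (min (p - δ) 1)
  σ_gt : ENNReal.ofReal
    (sobolevExp N p * q / (sobolevExp N p * (q - δ) - β * q)) < σ
  exponents : δ / p + β / sobolevExp N p + (σ⁻¹).toReal < p / N
  c_nonneg : ∀ᵐ x ∂(volume.restrict Ω), 0 ≤ c x
  c_memLp : IsLpLoc Ω σ c
  holder : ∀ᵐ x ∂(volume.restrict Ω), ∀ (v w : Val n) (ξ : Grad n N),
    |G x v ξ - G x w ξ| ≤ c x * ‖ξ‖ ^ δ * ‖v - w‖ ^ β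

/-- The functional `J(u, S) = ∫_S ∑_α f_α(x, u^α, ∇u^α) + G(x, u, ∇u) dx`. -/
def energy {n N : ℕ} (f : Fin n → Pt N → ℝ → Pt N → ℝ) (G : Pt N → Val n → Grad n N → ℝ)
    (u : Pt N → Val n) (Du : Pt N → Grad n N) (S : Set (Pt N)) : ℝ :=
  ∫ x in S, ((∑ α : Fin n, f α x (u x α) (Du x α)) + G x (u x) (Du x))

/-- `u` (with weak gradient `Du`) is a local minimizer of `J`: its energy does not decrease under
perturbations `φ ∈ W^{1,p}(Ω; ℝ^n)` that vanish outside a compact subset `K` of `Ω`. -/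
def IsLocalMinimizer {n N : ℕ} (Ω : Set (Pt N)) (p : ℝ)
    (f : Fin n → Pt N → ℝ → Pt N → ℝ) (G : Pt N → Val n → Grad n N → ℝ)
    (u : Pt N → Val n) (Du : Pt N → Grad n N) : Prop :=
  ∀ (φ : Pt N → Val n) (Dφ : Pt N → Grad n N) (K : Set (Pt N)),
    IsSobolev Ω p φ Dφ → IsCompact K → K ⊆ Ω →
    (∀ᵐ x ∂(volume.restrict Ω), x ∉ K → φ x = 0) →
    energy f G u Du K ≤ energy f G (fun x => u x + φ x) (fun x => Du x + Dφ x) K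

/-- The superlevel set `A_{k,s} = {v > k} ∩ B_s(x₀)`. -/
def superSet {N : ℕ} (v : Pt N → ℝ) (k : ℝ) (x₀ : Pt N) (s : ℝ) : Set (Pt N) :=
  {x | k < v x} ∩ Metric.ball x₀ s

/-- The sublevel set `B_{k,s} = {v < k} ∩ B_s(x₀)`. -/
def subSet {N : ℕ} (v : Pt N → ℝ) (k : ℝ) (x₀ : Pt N) (s : ℝ) : Set (Pt N) :=
  {x | v x < k} ∩ Metric.ball x₀ s

/-- The gain of integrability in the energy estimate: `ε`, lowered if necessary to
`p/N - q/p` and to `p/N - (δ/p + β/p^* + 1/σ)`. -/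
def gainExp (N : ℕ) (p q δ β : ℝ) (σ : ℝ≥0∞) (ε : ℝ) : ℝ :=
  min ε (min (p / N - q / p) (p / N - (δ / p + β / sobolevExp N p + (σ⁻¹).toReal)))

end

/-! The minimality of `u` is tested with `φ = -ζ (u^α - k)⁺ e_α`, where `ζ` is a cutoff between
concentric balls of radii `s < t`. On the superlevel set the new `α`-th gradient is `(1 - ζ)∇u^α - ζ
Z` with `Z = ζ⁻¹ (u^α - k) ∇ζ`. This is a convex combination, so the growth of `f_α` and the
convexity of `|·|^p` bound the new energy density by `L (1 - ζ)|∇u^α|^p + L ζ|Z|^p` plus lower order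
terms. A cutoff with `|∇ζ|^p ≤ C ζ^(p-1) / (t - s)^p` turns `ζ|Z|^p` into `C (u^α - k)^p / (t -
s)^p` (`exists_radial_cutoff`, `growth_sub_le`).

`G` need not be convex, but the new gradient matrix is `ζ ξ + (1 - ζ)∇u` where `ξ - ∇u` has a single
nonzero row, so rank-one convexity suffices (`rankOneConvex_sub_le`). It leaves `ζ (G(u+φ, ξ) - G(u,
∇u))`, controlled by the `q`-growth, and `(1 - ζ)(G(u+φ, ∇u) - G(u, ∇u))`, controlled by the Hölder
condition. Since `ζ = 1` on the small ball, filling the hole gives `(L+1) ∫_{A_s} |∇u^α|^p ≤ L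
∫_{A_t} |∇u^α|^p + errors` (`exists_energy_comparison`).

Hölder's inequality bounds the errors by a multiple of `(1 + |k|^p)|A|^(1 - p/N + ε_*)`, apart from
the cutoff term and `∫ b (u^α - k)^γ`. In the latter, the part of homogeneity `p` is turned into
gradient energy by the Sobolev inequality; the remaining factor `|A|^ε` is small for small radii, so
this energy is absorbed. A factor `(L + 1/2)/(L + 1) < 1` stays in front of `∫_{A_t} |∇u^α|^p`, and
`exists_iteration_const` removes it.

These bounds require `|k|^(p^*) |A_{k,R}|` to be bounded. When it is large, Chebyshev's inequality
forces `k < 0` and makes `A_{k,R}` fill at least half of the ball. Then `|k|^p R^(-ε_* N) |A|^(1 -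
p/N + ε_*)` is bounded below by a positive constant and the estimate is trivial, because the left
side is at most the energy of `∇u` on a fixed compact set. This is the role of the factor `R^(-ε_*
N)`.

Sublevel sets are superlevel sets of `-u`, which minimizes the reflected functional. The Sobolev
inequality and the weak gradient of `(u^α - k)⁺` are obtained by mollification. -/

noncomputable section

open Filter Topology
open scoped Gradient

/-! ### Mollification of functions and of weak gradients -/

section

open Convolution ContinuousLinearMap

/-- A sequence of bump functions on `ℝ^N` shrinking to the origin. -/
def shrinkingBump (N : ℕ) (j : ℕ) : ContDiffBump (0 : Pt N) where
  rIn := 1 / ((j : ℝ) + 1)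
  rOut := 2 / ((j : ℝ) + 1)
  rIn_pos := by positivity
  rIn_lt_rOut := by gcongr; norm_num

/-- The `j`-th mollification of a function on `ℝ^N`. -/
def mollify {N : ℕ} {E : Type*} [NormedAddCommGroup E] [NormedSpace ℝ E]
    (j : ℕ) (g : Pt N → E) : Pt N → E :=
  ((shrinkingBump N j).normed volume) ⋆[lsmul ℝ ℝ, volume] g

lemma tendsto_shrinkingBump_rOut (N : ℕ) :
    Tendsto (fun j => (shrinkingBump N j).rOut) atTop (𝓝 0) := by
  have := (tendsto_one_div_add_atTop_nhds_zero_nat (𝕜 := ℝ)).const_mul 2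
  rw [mul_zero] at this
  refine this.congr fun j => ?_
  simp [shrinkingBump, div_eq_mul_inv]

section mollify

variable {N : ℕ} {E : Type*} [NormedAddCommGroup E] [NormedSpace ℝ E]

lemma mollify_apply (j : ℕ) (g : Pt N → E) (x : Pt N) :
    mollify j g x = ∫ t, (shrinkingBump N j).normed volume t • g (x - t) := rfl

lemma ae_tendsto_mollify [FiniteDimensional ℝ E] {g : Pt N → E} (hg : LocallyIntegrable g) :
    ∀ᵐ x, Tendsto (fun j => mollify j g x) atTop (𝓝 (g x)) := by
  -- The ratio of outer to inner radius is 2 for every `j`; a bounded ratio gives convergence at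
  -- Lebesgue points.
  refine ContDiffBump.ae_convolution_tendsto_right_of_locallyIntegrable (K := 2)
    (tendsto_shrinkingBump_rOut N) (Eventually.of_forall fun j => ?_) hg
  simp [shrinkingBump]
  exact le_of_eq (by ring)

lemma lintegral_enorm_shrinkingBump (j : ℕ) :
    ∫⁻ t, ‖(shrinkingBump N j).normed volume t‖ₑ = 1 := by
  have h1 : ∫ t, (shrinkingBump N j).normed volume t = 1 := ContDiffBump.integral_normed _
  have h2 : ∫⁻ t, ‖(shrinkingBump N j).normed volume t‖ₑ
      = ENNReal.ofReal (∫ t, (shrinkingBump N j).normed volume t) := by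
    rw [ofReal_integral_eq_lintegral_ofReal (ContDiffBump.integrable_normed _)
      (Eventually.of_forall fun t => ContDiffBump.nonneg_normed _ _)]
    refine lintegral_congr fun t => ?_
    rw [Real.enorm_of_nonneg (ContDiffBump.nonneg_normed _ _)]
  rw [h2, h1, ENNReal.ofReal_one]

lemma measurable_enorm_shrinkingBump (j : ℕ) :
    Measurable fun t => ‖(shrinkingBump N j).normed volume t‖ₑ :=
  ((shrinkingBump N j).continuous_normed (μ := volume)).measurable.enorm

/-- Jensen's inequality for the averages which define mollifications. -/
lemma lintegral_bump_rpow_le (j : ℕ) {F : Pt N → ℝ≥0∞} (hF : AEMeasurable F) {p : ℝ}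
    (hp : 1 ≤ p) :
    (∫⁻ t, ‖(shrinkingBump N j).normed volume t‖ₑ * F t) ^ p
      ≤ ∫⁻ t, ‖(shrinkingBump N j).normed volume t‖ₑ * F t ^ p := by
  set φ := fun t => ‖(shrinkingBump N j).normed volume t‖ₑ with hφ
  have hφm : Measurable φ := measurable_enorm_shrinkingBump j
  rcases eq_or_lt_of_le hp with rfl | hp'
  · simp
  set q := Real.conjExponent p
  have hpq : p.HolderConjugate q := Real.HolderConjugate.conjExponent hp'
  -- Jensen from Hölder: the weight is split as `φ = φ^(1/q) φ^(1/p)`, and the first factor has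
  -- `L^q` norm 1.
  have key := ENNReal.lintegral_mul_le_Lp_mul_Lq volume hpq.symm
    (f := fun t => φ t ^ (1 / q)) (g := fun t => φ t ^ (1 / p) * F t)
    (hφm.pow_const _).aemeasurable ((hφm.pow_const _).aemeasurable.mul hF)
  have e1 : ∀ t, ((fun t => φ t ^ (1 / q)) * fun t => φ t ^ (1 / p) * F t) t = φ t * F t := by
    intro t
    simp only [Pi.mul_apply]
    rw [← mul_assoc, ← ENNReal.rpow_add_of_nonneg _ _ (by have := hpq.symm.pos; positivity) (by positivity)]
    have : 1 / q + 1 / p = 1 := by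
      have := hpq.symm.inv_add_inv_eq_one; simpa using this
    rw [this, ENNReal.rpow_one]
  rw [lintegral_congr e1] at key
  have hq0 : q ≠ 0 := hpq.symm.pos.ne'
  have hp0 : p ≠ 0 := by positivity
  have e2 : ∫⁻ t, (φ t ^ (1 / q)) ^ q = 1 := by
    rw [← lintegral_enorm_shrinkingBump (N := N) j]
    refine lintegral_congr fun t => ?_
    rw [← ENNReal.rpow_mul, one_div_mul_cancel hq0, ENNReal.rpow_one]
  have e3 : ∫⁻ t, (φ t ^ (1 / p) * F t) ^ p = ∫⁻ t, φ t * F t ^ p := by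
    refine lintegral_congr fun t => ?_
    rw [ENNReal.mul_rpow_of_nonneg _ _ (by positivity), ← ENNReal.rpow_mul,
      one_div_mul_cancel hp0, ENNReal.rpow_one]
  rw [e2, e3, ENNReal.one_rpow, one_mul] at key
  calc _ ≤ ((∫⁻ t, φ t * F t ^ p) ^ (1 / p)) ^ p := by gcongr
    _ = _ := by rw [← ENNReal.rpow_mul, one_div_mul_cancel hp0, ENNReal.rpow_one]

lemma aemeasurable_comp_sub_left {g : Pt N → ℝ≥0∞} (hg : AEMeasurable g) (x : Pt N) :
    AEMeasurable fun t => g (x - t) :=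
  hg.comp_quasiMeasurePreserving (quasiMeasurePreserving_sub_left _ x)

lemma enorm_mollify_le (j : ℕ) (g : Pt N → E) (x : Pt N) :
    ‖mollify j g x‖ₑ ≤ ∫⁻ t, ‖(shrinkingBump N j).normed volume t‖ₑ * ‖g (x - t)‖ₑ := by
  rw [mollify_apply]
  refine (enorm_integral_le_lintegral_enorm _).trans_eq ?_
  simp [enorm_smul]

/-- Mollification does not increase `L^p` norms. -/
lemma lintegral_enorm_mollify_rpow_le (j : ℕ) {g : Pt N → E} (hg : AEStronglyMeasurable g)
    {p : ℝ} (hp : 1 ≤ p) :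
    ∫⁻ x, ‖mollify j g x‖ₑ ^ p ≤ ∫⁻ x, ‖g x‖ₑ ^ p := by
  calc ∫⁻ x, ‖mollify j g x‖ₑ ^ p
      ≤ ∫⁻ x, ∫⁻ t, ‖(shrinkingBump N j).normed volume t‖ₑ * ‖g (x - t)‖ₑ ^ p := by
        refine lintegral_mono fun x => ?_
        refine (ENNReal.rpow_le_rpow (enorm_mollify_le j g x) (by positivity)).trans ?_
        exact lintegral_bump_rpow_le j (aemeasurable_comp_sub_left hg.enorm x) hp
    _ = ∫⁻ t, ∫⁻ x, ‖(shrinkingBump N j).normed volume t‖ₑ * ‖g (x - t)‖ₑ ^ p := by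
        refine lintegral_lintegral_swap ?_
        have h2 : AEMeasurable (fun z : Pt N × Pt N => ‖g (z.1 - z.2)‖ₑ)
            (volume.prod volume) :=
          hg.enorm.comp_quasiMeasurePreserving
            (quasiMeasurePreserving_sub volume volume)
        exact (((measurable_enorm_shrinkingBump j).comp measurable_snd).aemeasurable).mul
          (h2.pow_const p)
    _ = ∫⁻ t, ‖(shrinkingBump N j).normed volume t‖ₑ * ∫⁻ x, ‖g x‖ₑ ^ p := by
        refine lintegral_congr fun t => ?_
        rw [lintegral_const_mul' _ _ enorm_ne_top, lintegral_sub_right_eq_self (fun x => ‖g x‖ₑ ^ p)]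
    _ = ∫⁻ x, ‖g x‖ₑ ^ p := by
        rw [lintegral_mul_const _ (measurable_enorm_shrinkingBump j),
          lintegral_enorm_shrinkingBump, one_mul]

/-- Translations are continuous in `L¹`. -/
lemma exists_lintegral_enorm_translate_sub_le {F : Type*} [NormedAddCommGroup F] {g : Pt N → F}
    (hg : Integrable g)
    {ε : ℝ≥0∞} (hε : 0 < ε) :
    ∃ δ > 0, ∀ y : Pt N, ‖y‖ < δ → ∫⁻ x, ‖g (x - y) - g x‖ₑ ≤ ε := by
  have : Fact ((1 : ℝ≥0∞) ≠ ⊤) := ⟨ENNReal.one_ne_top⟩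
  have hm : MemLp g 1 volume := memLp_one_iff_integrable.2 hg
  set f : Lp F 1 (volume : Measure (Pt N)) := hm.toLp g
  have hc : Continuous fun y : Pt N => (DomAddAct.mk (-y)) +ᵥ f := by
    have : Continuous fun y : Pt N => DomAddAct.mk (-y) :=
      DomAddAct.continuous_mk.comp continuous_neg
    exact this.vadd continuous_const
  have h0 : Tendsto (fun y : Pt N => edist ((DomAddAct.mk (-y)) +ᵥ f) f) (𝓝 0) (𝓝 0) := by
    have := (hc.edist (continuous_const (y := f))).tendsto 0
    simpa using this
  obtain ⟨δ, hδ, h⟩ := Metric.eventually_nhds_iff.1 (h0.eventually_le_const hε)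
  refine ⟨δ, hδ, fun y hy => ?_⟩
  have := h (y := y) (by simpa using hy)
  rw [DomAddAct.mk_vadd_toLp, Lp.edist_toLp_toLp, eLpNorm_one_eq_lintegral_enorm] at this
  refine le_trans (le_of_eq ?_) this
  refine lintegral_congr fun x => ?_
  simp [sub_eq_neg_add]

/-- Mollifications converge in `L¹`. -/
lemma tendsto_lintegral_enorm_mollify_sub [CompleteSpace E] {g : Pt N → E} (hg : Integrable g) :
    Tendsto (fun j => ∫⁻ x, ‖mollify j g x - g x‖ₑ) atTop (𝓝 0) := by
  rw [ENNReal.tendsto_atTop_zero]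
  intro ε hε
  obtain ⟨δ, hδ, h⟩ := exists_lintegral_enorm_translate_sub_le hg hε
  have hev := (tendsto_shrinkingBump_rOut N).eventually_lt_const hδ
  obtain ⟨J, hJ⟩ := eventually_atTop.1 hev
  refine ⟨J, fun j hj => ?_⟩
  have hrepr : ∀ x, ‖mollify j g x - g x‖ₑ
      ≤ ∫⁻ t, ‖(shrinkingBump N j).normed volume t‖ₑ * ‖g (x - t) - g x‖ₑ := by
    intro x
    have e : mollify j g x - g x
        = ∫ t, (shrinkingBump N j).normed volume t • (g (x - t) - g x) := by
      have hi : Integrable fun t => (shrinkingBump N j).normed volume t • g (x - t) := by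
        have := ((shrinkingBump N j).hasCompactSupport_normed
          (μ := volume)).convolutionExists_left (lsmul ℝ ℝ)
          ((shrinkingBump N j).continuous_normed (μ := volume)) hg.locallyIntegrable x
        exact this.integrable
      have hi2 : Integrable fun t => (shrinkingBump N j).normed volume t • g x :=
        (ContDiffBump.integrable_normed _).smul_const _
      simp_rw [smul_sub]
      rw [integral_sub hi hi2, integral_smul_const, ContDiffBump.integral_normed, one_smul,
        mollify_apply]
    rw [e]
    refine (enorm_integral_le_lintegral_enorm _).trans_eq ?_
    simp [enorm_smul]
  calc ∫⁻ x, ‖mollify j g x - g x‖ₑ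
      ≤ ∫⁻ x, ∫⁻ t, ‖(shrinkingBump N j).normed volume t‖ₑ * ‖g (x - t) - g x‖ₑ :=
        lintegral_mono hrepr
    _ = ∫⁻ t, ∫⁻ x, ‖(shrinkingBump N j).normed volume t‖ₑ * ‖g (x - t) - g x‖ₑ := by
        refine lintegral_lintegral_swap ?_
        have h2 : AEStronglyMeasurable (fun z : Pt N × Pt N => g (z.1 - z.2))
            (volume.prod volume) :=
          hg.1.comp_quasiMeasurePreserving
            (quasiMeasurePreserving_sub volume volume)
        have h3 : AEStronglyMeasurable (fun z : Pt N × Pt N => g z.1)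
            (volume.prod volume) := hg.1.comp_fst
        exact (((measurable_enorm_shrinkingBump j).comp measurable_snd).aemeasurable).mul
          (h2.sub h3).enorm
    _ = ∫⁻ t, ‖(shrinkingBump N j).normed volume t‖ₑ * ∫⁻ x, ‖g (x - t) - g x‖ₑ := by
        refine lintegral_congr fun t => ?_
        rw [lintegral_const_mul' _ _ enorm_ne_top]
    _ ≤ ∫⁻ t, ‖(shrinkingBump N j).normed volume t‖ₑ * ε := by
        refine lintegral_mono fun t => ?_
        by_cases ht : t ∈ Metric.ball (0 : Pt N) (shrinkingBump N j).rOut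
        · exact mul_le_mul_right (h t (by
            have := hJ j hj
            rw [mem_ball_zero_iff] at ht
            linarith)) _
        · have : (shrinkingBump N j).normed volume t = 0 := by
            rw [← ContDiffBump.support_normed_eq (μ := volume)] at ht
            exact Function.notMem_support.1 ht
          simp [this]
    _ = ε := by
        rw [lintegral_mul_const _ (measurable_enorm_shrinkingBump j),
          lintegral_enorm_shrinkingBump, one_mul]

lemma contDiff_mollify [CompleteSpace E] (j : ℕ) {g : Pt N → E} (hg : LocallyIntegrable g) :
    ContDiff ℝ ∞ (mollify j g) :=
  HasCompactSupport.contDiff_convolution_left (lsmul ℝ ℝ)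
    ((shrinkingBump N j).hasCompactSupport_normed (μ := volume))
    ((shrinkingBump N j).contDiff_normed (μ := volume)) hg

lemma hasCompactSupport_mollify (j : ℕ) {g : Pt N → E} (hg : HasCompactSupport g) :
    HasCompactSupport (mollify j g) :=
  HasCompactSupport.convolution (lsmul ℝ ℝ)
    ((shrinkingBump N j).hasCompactSupport_normed (μ := volume)) hg

end mollify

variable {N : ℕ}

/-- The gradient of a mollification is the mollification of the weak gradient. -/
lemma fderiv_mollify_apply {w : Pt N → ℝ} {Dw : Pt N → Pt N} (hw : LocallyIntegrable w)
    (hDw : LocallyIntegrable Dw) (h : HasWeakGradient univ w Dw) (j : ℕ) (x : Pt N) (i : Fin N) :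
    fderiv ℝ (mollify j w) x (EuclideanSpace.single i 1) = mollify j Dw x i := by
  set φ := (shrinkingBump N j).normed (volume : Measure (Pt N)) with hφ
  have hφs : HasCompactSupport φ := (shrinkingBump N j).hasCompactSupport_normed
  have hφc : ContDiff ℝ ∞ φ := (shrinkingBump N j).contDiff_normed
  have hφc1 : ContDiff ℝ 1 φ := hφc.of_le (by exact_mod_cast le_top)
  have hd := hφs.hasFDerivAt_convolution_left (lsmul ℝ ℝ) hφc1 hw x
  have hint : Integrable (fun t => ((lsmul ℝ ℝ).precompL (Pt N) (fderiv ℝ φ t)) (w (x - t))) :=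
    ((hφs.fderiv ℝ).convolutionExists_left _ (hφc1.continuous_fderiv one_ne_zero) hw x).integrable
  have e1 : fderiv ℝ (mollify j w) x (EuclideanSpace.single i 1)
      = ∫ t, fderiv ℝ φ t (EuclideanSpace.single i 1) * w (x - t) := by
    rw [show fderiv ℝ (mollify j w) x = _ from hd.fderiv, convolution_def,
      ContinuousLinearMap.integral_apply hint]
    rfl
  -- The reflected kernel is the test function; the sign from the chain rule cancels the one in the
  -- definition of weak gradient.
  set ψ : Pt N → ℝ := fun y => φ (x - y) with hψ
  have hψc : ContDiff ℝ ∞ ψ := hφc.comp (contDiff_const.sub contDiff_id)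
  have hψs : HasCompactSupport ψ := hφs.comp_homeomorph (Homeomorph.subLeft x)
  have hψd : ∀ y, fderiv ℝ ψ y (EuclideanSpace.single i 1)
      = - fderiv ℝ φ (x - y) (EuclideanSpace.single i 1) := by
    intro y
    have h1 : HasFDerivAt (fun y : Pt N => x - y) (-(ContinuousLinearMap.id ℝ (Pt N))) y := by
      simpa using! (hasFDerivAt_const x y).sub (hasFDerivAt_id y)
    have h2 : HasFDerivAt φ (fderiv ℝ φ (x - y)) (x - y) :=
      (hφc1.differentiable one_ne_zero _).hasFDerivAt
    have h3 := h2.comp y h1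
    rw [show fderiv ℝ ψ y = _ from h3.fderiv]
    simp
  have key := h ψ hψc hψs (subset_univ _) i
  simp only [Measure.restrict_univ] at key
  have e2 : ∫ t, fderiv ℝ φ t (EuclideanSpace.single i 1) * w (x - t)
      = - ∫ y, w y * fderiv ℝ ψ y (EuclideanSpace.single i 1) := by
    rw [← integral_sub_left_eq_self _ volume x, ← integral_neg]
    refine integral_congr_ae (Eventually.of_forall fun y => ?_)
    simp only [hψd, sub_sub_cancel]
    ring
  have hint2 : Integrable fun t => φ t • Dw (x - t) :=
    (hφs.convolutionExists_left (lsmul ℝ ℝ) hφc.continuous hDw x).integrable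
  have e3 : mollify j Dw x i = ∫ t, φ t * Dw (x - t) i := by
    have := (EuclideanSpace.proj (𝕜 := ℝ) i : Pt N →L[ℝ] ℝ).integral_comp_comm hint2
    rw [mollify_apply]
    rw [show (∫ t, φ t • Dw (x - t)) i
      = (EuclideanSpace.proj (𝕜 := ℝ) i : Pt N →L[ℝ] ℝ) (∫ t, φ t • Dw (x - t)) from rfl, ← this]
    rfl
  rw [e1, e2, key, neg_neg, e3, ← integral_sub_left_eq_self _ volume x]
  refine integral_congr_ae (Eventually.of_forall fun y => ?_)
  simp only [hψ, sub_sub_cancel]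
  ring

lemma norm_fderiv_mollify {w : Pt N → ℝ} {Dw : Pt N → Pt N} (hw : LocallyIntegrable w)
    (hDw : LocallyIntegrable Dw) (h : HasWeakGradient univ w Dw) (j : ℕ) (x : Pt N) :
    ‖fderiv ℝ (mollify j w) x‖ = ‖mollify j Dw x‖ := by
  have : fderiv ℝ (mollify j w) x = innerSL ℝ (mollify j Dw x) := by
    refine ContinuousLinearMap.coe_injective
      ((EuclideanSpace.basisFun (Fin N) ℝ).toBasis.ext fun i => ?_)
    simp only [OrthonormalBasis.coe_toBasis, EuclideanSpace.basisFun_apply,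
      ContinuousLinearMap.coe_coe]
    rw [fderiv_mollify_apply hw hDw h]
    simp [EuclideanSpace.inner_single_right]
  rw [this, innerSL_apply_norm]

end

/-! ### Sobolev inequality for weak gradients -/

variable {N : ℕ}

/-- The Sobolev inequality for compactly supported functions with a weak gradient. -/
lemma exists_sobolev_const {N : ℕ} {p : ℝ} (hp : 1 < p) (hpN : p < N) :
    ∃ S : ℝ, 0 < S ∧ ∀ (w : Pt N → ℝ) (Dw : Pt N → Pt N), HasCompactSupport w →
      LocallyIntegrable w → LocallyIntegrable Dw → HasWeakGradient univ w Dw →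
      ∫⁻ x, ‖w x‖ₑ ^ sobolevExp N p
        ≤ ENNReal.ofReal S * (∫⁻ x, ‖Dw x‖ₑ ^ p) ^ (sobolevExp N p / p) := by
  have hN0 : (0 : ℝ) < N := by linarith
  have hP0 : 0 < sobolevExp N p := by
    unfold sobolevExp; have : 0 < N - p := by linarith
    positivity
  set P := sobolevExp N p with hP
  lift p to NNReal using by linarith
  obtain ⟨P', hP'⟩ : ∃ P' : NNReal, (P' : ℝ) = P := ⟨⟨P, hP0.le⟩, rfl⟩
  set C := SNormLESNormFDerivOfEqConst ℝ (volume : Measure (Pt N)) (p : ℝ) with hC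
  have hp0 : (0 : ℝ) < p := by linarith
  -- The summand 1 only keeps the constant positive.
  refine ⟨(C : ℝ) ^ P + 1, by positivity, fun w Dw hws hw hDw h => ?_⟩
  have hinv : (P' : ℝ)⁻¹ = (p : ℝ)⁻¹ - (Module.finrank ℝ (Pt N) : ℝ)⁻¹ := by
    rw [hP', hP, sobolevExp, finrank_euclideanSpace_fin]
    have : (N : ℝ) - p ≠ 0 := by linarith
    field_simp
  have hPn : P' ≠ 0 := fun h0 => by rw [h0] at hP'; simp at hP'; linarith
  have hpn : p ≠ 0 := fun h0 => by rw [h0] at hp0; simp at hp0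
  have hstep : ∀ j, ∫⁻ x, ‖mollify j w x‖ₑ ^ P
      ≤ ENNReal.ofReal ((C : ℝ) ^ P + 1) * (∫⁻ x, ‖Dw x‖ₑ ^ (p : ℝ)) ^ (P / p) := by
    intro j
    have h1 := eLpNorm_le_eLpNorm_fderiv_of_eq (F := ℝ) (volume : Measure (Pt N))
      (u := mollify j w) ((contDiff_mollify j hw).of_le (by exact_mod_cast le_top))
      (hasCompactSupport_mollify j hws) (p := p) (p' := P') (by exact_mod_cast hp.le)
      (by rw [finrank_euclideanSpace_fin]; exact_mod_cast hN0) hinv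
    rw [eLpNorm_nnreal_eq_lintegral hPn, eLpNorm_nnreal_eq_lintegral hpn, hP', ← hC] at h1
    have h2 : ∀ x, ‖fderiv ℝ (mollify j w) x‖ₑ = ‖mollify j Dw x‖ₑ := fun x => by
      rw [← ofReal_norm, ← ofReal_norm, norm_fderiv_mollify hw hDw h]
    simp_rw [h2] at h1
    have h3 := lintegral_enorm_mollify_rpow_le j hDw.aestronglyMeasurable hp.le
    have h4 := ENNReal.rpow_le_rpow h1 hP0.le
    rw [← ENNReal.rpow_mul, one_div_mul_cancel hP0.ne', ENNReal.rpow_one,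
      ENNReal.mul_rpow_of_nonneg _ _ hP0.le, ← ENNReal.rpow_mul] at h4
    refine h4.trans (mul_le_mul' ?_ ?_)
    · rw [← ENNReal.coe_rpow_of_nonneg _ hP0.le, ← ENNReal.ofReal_coe_nnreal, NNReal.coe_rpow]
      exact ENNReal.ofReal_le_ofReal (by linarith)
    · rw [one_div_mul_eq_div]
      exact ENNReal.rpow_le_rpow h3 (by positivity)
  -- The smooth inequality holds uniformly in `j`, so a.e. convergence and Fatou's lemma pass it to
  -- `w`.
  have hlim : ∀ᵐ x, ‖w x‖ₑ ^ P = liminf (fun j => ‖mollify j w x‖ₑ ^ P) atTop := by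
    filter_upwards [ae_tendsto_mollify hw] with x hx
    have : Tendsto (fun j => ‖mollify j w x‖ₑ ^ P) atTop (𝓝 (‖w x‖ₑ ^ P)) :=
      ((ENNReal.continuous_rpow_const (y := P)).tendsto _).comp hx.enorm
    exact this.liminf_eq.symm
  rw [lintegral_congr_ae hlim]
  refine (lintegral_liminf_le fun j => ?_).trans ?_
  · exact ((contDiff_mollify j hw).continuous.measurable.enorm.pow_const _)
  · exact (liminf_le_liminf (Eventually.of_forall hstep)).trans (by simp)

/-! ### Calculus of weak gradients: products, chain rule, positive parts -/

/-- A continuous factor supported in a compact set makes a locally integrable function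
integrable. -/
lemma integrable_mul_of_tsupport_subset {v g : Pt N → ℝ} {K : Set (Pt N)} (hK : IsCompact K)
    (hv : IntegrableOn v K) (hg : Continuous g) (hgK : tsupport g ⊆ K) :
    Integrable fun x => v x * g x := by
  have h1 : IntegrableOn (fun x => v x * g x) K := hv.mul_continuousOn hg.continuousOn hK
  refine (integrableOn_iff_integrable_of_support_subset ?_).1 h1
  intro x hx
  by_contra hxK
  exact hx (by simp [image_eq_zero_of_notMem_tsupport (fun h => hxK (hgK h))])

/-- The value 1 is taken near `K` and not only on `K`, so that the gradient of the cutoff vanishes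
on `K` as well. -/
lemma exists_smooth_cutoff {Ω K : Set (Pt N)} (hΩ : IsOpen Ω) (hK : IsCompact K) (hKΩ : K ⊆ Ω) :
    ∃ χ : Pt N → ℝ, ContDiff ℝ ∞ χ ∧ HasCompactSupport χ ∧ tsupport χ ⊆ Ω ∧
      (∀ᶠ x in 𝓝ˢ K, χ x = 1) ∧ ∀ x, χ x ∈ Icc (0 : ℝ) 1 := by
  obtain ⟨K', hK', h1, h2⟩ := exists_compact_between hK hΩ hKΩ
  obtain ⟨χ, hχ1, hχ0, hχ⟩ := exists_contMDiffMap_one_nhds_of_subset_interior (n := (⊤ : ℕ∞))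
    (modelWithCornersSelf ℝ (Pt N)) hK.isClosed h1
  have hsub : tsupport χ ⊆ K' := closure_minimal
    (fun x hx => by by_contra h; exact hx (hχ0 x h)) hK'.isClosed
  exact ⟨χ, contMDiff_iff_contDiff.1 χ.contMDiff, hK'.of_isClosed_subset (isClosed_tsupport _) hsub,
    hsub.trans h2, hχ1, hχ⟩

lemma gradient_apply_eq_fderiv (χ : Pt N → ℝ) (x : Pt N) (i : Fin N) :
    gradient χ x i = fderiv ℝ χ x (EuclideanSpace.single i 1) := by
  rw [← inner_gradient_left, EuclideanSpace.inner_single_right]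
  simp

lemma norm_gradient_eq (χ : Pt N → ℝ) (x : Pt N) : ‖gradient χ x‖ = ‖fderiv ℝ χ x‖ := by
  simp [gradient]

lemma continuous_gradient_of_contDiff {χ : Pt N → ℝ} (hχ : ContDiff ℝ ∞ χ) :
    Continuous (gradient χ) :=
  (LinearIsometryEquiv.continuous _).comp (hχ.continuous_fderiv (by simp))

lemma continuous_fderiv_apply {χ : Pt N → ℝ} (hχ : ContDiff ℝ ∞ χ) (y : Pt N) :
    Continuous fun x => fderiv ℝ χ x y :=
  (hχ.continuous_fderiv (by simp)).clm_apply continuous_const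

lemma MeasureTheory.IntegrableOn.eval_euclidean {f : Pt N → Pt N} {K : Set (Pt N)}
    (hf : IntegrableOn f K) (i : Fin N) : IntegrableOn (fun x => f x i) K :=
  (EuclideanSpace.proj (𝕜 := ℝ) i : Pt N →L[ℝ] ℝ).integrable_comp hf

/-- The product rule for a weakly differentiable function and a smooth cutoff function. -/
lemma HasWeakGradient.mul_cutoff {Ω : Set (Pt N)} {v : Pt N → ℝ} {Dv : Pt N → Pt N}
    (hv : ∀ K, IsCompact K → K ⊆ Ω → IntegrableOn v K)
    (hDv : ∀ K, IsCompact K → K ⊆ Ω → IntegrableOn Dv K) (h : HasWeakGradient Ω v Dv)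
    {χ : Pt N → ℝ} (hχ : ContDiff ℝ ∞ χ) (hχs : HasCompactSupport χ) (hχΩ : tsupport χ ⊆ Ω) :
    HasWeakGradient univ (fun x => χ x * v x) (fun x => χ x • Dv x + v x • gradient χ x) := by
  intro ψ hψ hψs _ i
  have hχψ : tsupport (fun x => χ x * ψ x) ⊆ tsupport χ := tsupport_mul_subset_left
  have key := h (fun x => χ x * ψ x) (hχ.mul hψ) hχs.mul_right (hχψ.trans hχΩ) i
  have hd : ∀ x, fderiv ℝ (fun x => χ x * ψ x) x (EuclideanSpace.single i 1)
      = χ x * fderiv ℝ ψ x (EuclideanSpace.single i 1)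
        + ψ x * fderiv ℝ χ x (EuclideanSpace.single i 1) := by
    intro x
    rw [fderiv_fun_mul (hχ.differentiable (by simp) x) (hψ.differentiable (by simp) x)]
    simp
  have hz : ∀ x, x ∉ Ω → χ x = 0 := fun x hx =>
    image_eq_zero_of_notMem_tsupport fun h => hx (hχΩ h)
  have hz' : ∀ x, x ∉ Ω → fderiv ℝ χ x (EuclideanSpace.single i 1) = 0 := fun x hx =>
    image_eq_zero_of_notMem_tsupport (f := fun x => fderiv ℝ χ x (EuclideanSpace.single i 1))
      fun h => hx (hχΩ (tsupport_fderiv_apply_subset ℝ _ h))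
  rw [setIntegral_eq_integral_of_forall_compl_eq_zero fun x hx => by
      rw [hd, hz x hx, hz' x hx]; simp,
    setIntegral_eq_integral_of_forall_compl_eq_zero fun x hx => by rw [hz x hx]; simp] at key
  have hK := hχs.isCompact
  have i1 : Integrable fun x => v x * (χ x * fderiv ℝ ψ x (EuclideanSpace.single i 1)) :=
    integrable_mul_of_tsupport_subset hK (hv _ hK hχΩ)
      (hχ.continuous.mul (continuous_fderiv_apply hψ _)) tsupport_mul_subset_left
  have i2 : Integrable fun x => v x * (ψ x * fderiv ℝ χ x (EuclideanSpace.single i 1)) :=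
    integrable_mul_of_tsupport_subset hK (hv _ hK hχΩ)
      (hψ.continuous.mul (continuous_fderiv_apply hχ _))
      (tsupport_mul_subset_right.trans (tsupport_fderiv_apply_subset ℝ _))
  have i3 : Integrable fun x => Dv x i * (χ x * ψ x) :=
    integrable_mul_of_tsupport_subset hK ((hDv _ hK hχΩ).eval_euclidean i)
      (hχ.continuous.mul hψ.continuous) tsupport_mul_subset_left
  simp only [Measure.restrict_univ]
  simp_rw [hd, mul_add] at key
  rw [integral_add i1 i2] at key
  have e1 : ∫ x, χ x * v x * fderiv ℝ ψ x (EuclideanSpace.single i 1)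
      = ∫ x, v x * (χ x * fderiv ℝ ψ x (EuclideanSpace.single i 1)) := by
    congr 1; ext x; ring
  have e2 : ∫ x, (χ x • Dv x + v x • gradient χ x) i * ψ x
      = ∫ x, (Dv x i * (χ x * ψ x) + v x * (ψ x * fderiv ℝ χ x (EuclideanSpace.single i 1))) := by
    congr 1; ext x
    simp only [PiLp.add_apply, PiLp.smul_apply, smul_eq_mul, gradient_apply_eq_fderiv]
    ring
  rw [e1, e2, integral_add i3 i2]
  linarith

lemma integral_fderiv_apply_eq_zero {ψ : Pt N → ℝ} (hψ : ContDiff ℝ ∞ ψ)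
    (hψs : HasCompactSupport ψ) (y : Pt N) : ∫ x, fderiv ℝ ψ x y = 0 := by
  have hc := continuous_fderiv_apply hψ y
  have hs : HasCompactSupport fun x => fderiv ℝ ψ x y := hψs.fderiv_apply (𝕜 := ℝ) y
  have := integral_mul_fderiv_eq_neg_fderiv_mul_of_integrable (μ := (volume : Measure (Pt N)))
    (f := fun _ => (1 : ℝ)) (g := ψ) (v := y) (by simp)
    (by simpa using hc.integrable_of_hasCompactSupport hs)
    (by simpa using hψ.continuous.integrable_of_hasCompactSupport hψs)
    (fun x _ => by fun_prop) (fun x _ => hψ.differentiable (by simp) x)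
  simpa using this

lemma HasWeakGradient.sub_const {Ω : Set (Pt N)} {v : Pt N → ℝ} {Dv : Pt N → Pt N}
    (hv : ∀ K, IsCompact K → K ⊆ Ω → IntegrableOn v K) (h : HasWeakGradient Ω v Dv) (k : ℝ) :
    HasWeakGradient Ω (fun x => v x - k) Dv := by
  intro ψ hψ hψs hψΩ i
  rw [← h ψ hψ hψs hψΩ i]
  have hz : ∀ x, x ∉ Ω → fderiv ℝ ψ x (EuclideanSpace.single i 1) = 0 := fun x hx =>
    image_eq_zero_of_notMem_tsupport (f := fun x => fderiv ℝ ψ x (EuclideanSpace.single i 1))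
      fun h => hx (hψΩ (tsupport_fderiv_apply_subset ℝ _ h))
  rw [setIntegral_eq_integral_of_forall_compl_eq_zero fun x hx => by rw [hz x hx]; simp,
    setIntegral_eq_integral_of_forall_compl_eq_zero fun x hx => by rw [hz x hx]; simp]
  simp_rw [sub_mul]
  have hc := continuous_fderiv_apply hψ (EuclideanSpace.single i 1)
  rw [integral_sub, integral_const_mul, integral_fderiv_apply_eq_zero hψ hψs, mul_zero, sub_zero]
  · exact integrable_mul_of_tsupport_subset hψs.isCompact (hv _ hψs.isCompact hψΩ) hc
      (tsupport_fderiv_apply_subset ℝ _)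
  · exact (hc.integrable_of_hasCompactSupport (hψs.fderiv_apply (𝕜 := ℝ) _)).const_mul k

lemma abs_le_abs_of_hasDerivAt {F H : ℝ → ℝ} (hF : ∀ t, HasDerivAt F (H t) t)
    (hH1 : ∀ t, |H t| ≤ 1) (s t : ℝ) : |F t - F s| ≤ |t - s| := by
  have := (convex_univ (𝕜 := ℝ) (E := ℝ)).norm_image_sub_le_of_norm_hasDerivWithin_le
    (C := 1) (fun x _ => (hF x).hasDerivWithinAt) (fun x _ => hH1 x) (mem_univ s) (mem_univ t)
  simpa using this

/-- The chain rule for weak gradients. -/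
lemma HasWeakGradient.comp_univ {w : Pt N → ℝ} {Dw : Pt N → Pt N} (hw : Integrable w)
    (hDw : Integrable Dw) (h : HasWeakGradient univ w Dw) {F H : ℝ → ℝ}
    (hF : ∀ t, HasDerivAt F (H t) t) (hH : Continuous H) (hH1 : ∀ t, |H t| ≤ 1) (hF0 : F 0 = 0) :
    HasWeakGradient univ (fun x => F (w x)) (fun x => H (w x) • Dw x) := by
  intro ψ hψ hψs _ i
  simp only [Measure.restrict_univ]
  set e : Pt N := EuclideanSpace.single i 1
  have hFc : Continuous F := continuous_iff_continuousAt.2 fun t => (hF t).continuousAt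
  have hFle : ∀ t, |F t| ≤ |t| := fun t => by simpa [hF0] using abs_le_abs_of_hasDerivAt hF hH1 0 t
  have hdc := continuous_fderiv_apply hψ e
  have hds : HasCompactSupport fun x => fderiv ℝ ψ x e := hψs.fderiv_apply (𝕜 := ℝ) e
  obtain ⟨C, hC⟩ := hdc.bounded_above_of_compact_support hds
  obtain ⟨C', hC'⟩ := hψ.continuous.bounded_above_of_compact_support hψs
  have hwc : ∀ j, ContDiff ℝ ∞ (mollify j w) := fun j => contDiff_mollify j hw.locallyIntegrable
  have hDwc : ∀ j, ContDiff ℝ ∞ (mollify j Dw) := fun j => contDiff_mollify j hDw.locallyIntegrable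
  have hcoord : ∀ i : Fin N, Continuous fun y : Pt N => y i := fun i =>
    (EuclideanSpace.proj (𝕜 := ℝ) i : Pt N →L[ℝ] ℝ).continuous
  have hnorm : ∀ y : Pt N, |y i| ≤ ‖y‖ := fun y => by simpa using PiLp.norm_apply_le y i
  have hder : ∀ j x, HasFDerivAt (fun x => F (mollify j w x))
      (H (mollify j w x) • fderiv ℝ (mollify j w) x) x := fun j x =>
    (hF _).comp_hasFDerivAt x ((hwc j).differentiable (by simp) x).hasFDerivAt
  have hderi : ∀ j x, fderiv ℝ (fun x => F (mollify j w x)) x e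
      = H (mollify j w x) * mollify j Dw x i := fun j x => by
    rw [(hder j x).fderiv]
    simp [e, fderiv_mollify_apply hw.locallyIntegrable hDw.locallyIntegrable h]
  have hDi : Integrable fun x => Dw x i :=
    (EuclideanSpace.proj (𝕜 := ℝ) i : Pt N →L[ℝ] ℝ).integrable_comp hDw
  have hparts : ∀ j, ∫ x, F (mollify j w x) * fderiv ℝ ψ x e
      = - ∫ x, H (mollify j w x) * mollify j Dw x i * ψ x := by
    intro j
    have := integral_mul_fderiv_eq_neg_fderiv_mul_of_integrable (μ := (volume : Measure (Pt N)))
      (f := fun x => F (mollify j w x)) (g := ψ) (v := e) ?_ ?_ ?_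
      (fun x _ => (hder j x).differentiableAt) (fun x _ => hψ.differentiable (by simp) x)
    · rw [this]; simp_rw [hderi]
    · simp_rw [hderi]
      exact (((hH.comp (hwc j).continuous).mul ((hcoord i).comp (hDwc j).continuous)).mul
        hψ.continuous).integrable_of_hasCompactSupport hψs.mul_left
    · exact ((hFc.comp (hwc j).continuous).mul hdc).integrable_of_hasCompactSupport hds.mul_left
    · exact ((hFc.comp (hwc j).continuous).mul
        hψ.continuous).integrable_of_hasCompactSupport hψs.mul_left
  have hL1w := tendsto_lintegral_enorm_mollify_sub hw
  have hL1D := tendsto_lintegral_enorm_mollify_sub hDw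
  have hlim1 : Tendsto (fun j => ∫ x, F (mollify j w x) * fderiv ℝ ψ x e) atTop
      (𝓝 (∫ x, F (w x) * fderiv ℝ ψ x e)) := by
    refine tendsto_integral_of_L1 _ ?_ (Eventually.of_forall fun j =>
      ((hFc.comp (hwc j).continuous).mul hdc).integrable_of_hasCompactSupport hds.mul_left) ?_
    · have hFw : Integrable fun x => F (w x) :=
        hw.mono (hFc.comp_aestronglyMeasurable hw.1) (Eventually.of_forall fun x => hFle _)
      exact (hFw.mul_bdd hdc.aestronglyMeasurable (c := C) (Eventually.of_forall hC)).1
    · have h0 : Tendsto (fun j => ENNReal.ofReal C * ∫⁻ x, ‖mollify j w x - w x‖ₑ) atTop (𝓝 0) := by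
        simpa using ENNReal.Tendsto.const_mul hL1w (Or.inr ENNReal.ofReal_ne_top)
      refine tendsto_of_tendsto_of_tendsto_of_le_of_le tendsto_const_nhds h0
        (fun _ => zero_le) fun j => ?_
      simp only
      rw [← lintegral_const_mul' _ _ ENNReal.ofReal_ne_top]
      refine lintegral_mono fun x => ?_
      rw [← sub_mul, enorm_mul, mul_comm]
      refine mul_le_mul' ?_ ?_
      · rw [← ofReal_norm]; exact ENNReal.ofReal_le_ofReal (hC x)
      · exact enorm_le_iff_norm_le.2 (abs_le_abs_of_hasDerivAt hF hH1 _ _)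
  -- The difference splits into `H(w_j)(Dw_j - Dw)`, which tends to 0 in `L¹` because `H` is
  -- bounded, and `(H(w_j) - H(w)) Dw`, handled by dominated convergence.
  have hlim2 : Tendsto (fun j => ∫ x, H (mollify j w x) * mollify j Dw x i * ψ x) atTop
      (𝓝 (∫ x, H (w x) * Dw x i * ψ x)) := by
    have hdiff : Tendsto (fun j => ∫ x, H (mollify j w x) * (mollify j Dw x i - Dw x i) * ψ x)
        atTop (𝓝 (∫ _ : Pt N, (0 : ℝ))) := by
      refine tendsto_integral_of_L1 _ aestronglyMeasurable_const (Eventually.of_forall fun j => ?_) ?_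
      · have i1 : Integrable fun x => H (mollify j w x) * mollify j Dw x i * ψ x :=
          (((hH.comp (hwc j).continuous).mul ((hcoord i).comp (hDwc j).continuous)).mul
            hψ.continuous).integrable_of_hasCompactSupport hψs.mul_left
        have i2 : Integrable fun x => Dw x i * (H (mollify j w x) * ψ x) :=
          integrable_mul_of_tsupport_subset hψs.isCompact hDi.integrableOn
            ((hH.comp (hwc j).continuous).mul hψ.continuous) tsupport_mul_subset_right
        exact (i1.sub i2).congr (Eventually.of_forall fun x => by simp only [Pi.sub_apply]; ring)
      · have h0 : Tendsto (fun j => ENNReal.ofReal C' * ∫⁻ x, ‖mollify j Dw x - Dw x‖ₑ)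
            atTop (𝓝 0) := by
          simpa using ENNReal.Tendsto.const_mul hL1D (Or.inr ENNReal.ofReal_ne_top)
        refine tendsto_of_tendsto_of_tendsto_of_le_of_le tendsto_const_nhds h0
          (fun _ => zero_le) fun j => ?_
        simp only
        rw [← lintegral_const_mul' _ _ ENNReal.ofReal_ne_top]
        refine lintegral_mono fun x => ?_
        rw [sub_zero, enorm_mul, mul_comm]
        refine mul_le_mul' ?_ ?_
        · rw [← ofReal_norm]; exact ENNReal.ofReal_le_ofReal (hC' x)
        · refine enorm_le_iff_norm_le.2 ?_
          rw [norm_mul]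
          calc _ ≤ 1 * ‖mollify j Dw x - Dw x‖ :=
                mul_le_mul (hH1 _) (hnorm (mollify j Dw x - Dw x)) (abs_nonneg _) zero_le_one
            _ = _ := one_mul _
    have hdom : Tendsto (fun j => ∫ x, H (mollify j w x) * Dw x i * ψ x) atTop
        (𝓝 (∫ x, H (w x) * Dw x i * ψ x)) := by
      refine tendsto_integral_of_dominated_convergence (fun x => |Dw x i| * C')
        (fun j => (((hH.comp (hwc j).continuous).aestronglyMeasurable).mul hDi.1).mul
          hψ.continuous.aestronglyMeasurable) (hDi.abs.mul_const _) ?_ ?_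
      · refine fun j => Eventually.of_forall fun x => ?_
        rw [norm_mul, norm_mul]
        refine mul_le_mul ?_ (hC' x) (norm_nonneg _) (abs_nonneg _)
        calc _ ≤ 1 * |Dw x i| := mul_le_mul (hH1 _) le_rfl (abs_nonneg _) zero_le_one
          _ = _ := one_mul _
      · filter_upwards [ae_tendsto_mollify hw.locallyIntegrable] with x hx
        exact (((hH.tendsto _).comp hx).mul_const _).mul_const _
    rw [integral_zero] at hdiff
    have := hdiff.add hdom
    rw [zero_add] at this
    refine this.congr fun j => ?_
    rw [← integral_add]
    · congr 1; ext x; ring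
    · have i1 : Integrable fun x => H (mollify j w x) * mollify j Dw x i * ψ x :=
        (((hH.comp (hwc j).continuous).mul ((hcoord i).comp (hDwc j).continuous)).mul
          hψ.continuous).integrable_of_hasCompactSupport hψs.mul_left
      have i2 : Integrable fun x => Dw x i * (H (mollify j w x) * ψ x) :=
        integrable_mul_of_tsupport_subset hψs.isCompact hDi.integrableOn
          ((hH.comp (hwc j).continuous).mul hψ.continuous) tsupport_mul_subset_right
      exact (i1.sub i2).congr (Eventually.of_forall fun x => by simp only [Pi.sub_apply]; ring)
    · have i2 : Integrable fun x => Dw x i * (H (mollify j w x) * ψ x) :=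
        integrable_mul_of_tsupport_subset hψs.isCompact hDi.integrableOn
          ((hH.comp (hwc j).continuous).mul hψ.continuous) tsupport_mul_subset_right
      exact i2.congr (Eventually.of_forall fun x => by ring)
  have hlim3 := hlim2.neg
  simp_rw [← hparts] at hlim3
  have := tendsto_nhds_unique hlim1 hlim3
  simpa [e] using this

/-- The weak gradient of the positive part. -/
lemma HasWeakGradient.posPart_univ {w : Pt N → ℝ} {Dw : Pt N → Pt N} (hw : Integrable w)
    (hDw : Integrable Dw) (h : HasWeakGradient univ w Dw) :
    HasWeakGradient univ (fun x => max (w x) 0) ({x | 0 < w x}.indicator Dw) := by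
  -- A continuous approximation of the indicator of `t > 0`, vanishing for `t ≤ 0`; its primitives
  -- `F m` tend to `t⁺`. The vanishing at 0 selects the strict superlevel set in the limit.
  set H : ℕ → ℝ → ℝ := fun m t => max 0 (min 1 ((m : ℝ) * t)) with hHdef
  have hHc : ∀ m, Continuous (H m) := fun m => by fun_prop
  have hH1 : ∀ m t, |H m t| ≤ 1 := fun m t => by
    rw [abs_of_nonneg (le_max_left _ _)]
    exact max_le zero_le_one (min_le_left _ _)
  set F : ℕ → ℝ → ℝ := fun m t => ∫ s in (0 : ℝ)..t, H m s with hFdef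
  have hF : ∀ m t, HasDerivAt (F m) (H m t) t := fun m t =>
    intervalIntegral.integral_hasDerivAt_right ((hHc m).intervalIntegrable _ _)
      ((hHc m).stronglyMeasurableAtFilter _ _) (hHc m).continuousAt
  have hF0 : ∀ m, F m 0 = 0 := fun m => by simp [hFdef]
  have hFle : ∀ m t, |F m t| ≤ |t| := fun m t => by
    simpa [hF0] using abs_le_abs_of_hasDerivAt (hF m) (hH1 m) 0 t
  have hHneg : ∀ m t, t ≤ 0 → H m t = 0 := fun m t ht => by
    have : (m : ℝ) * t ≤ 0 := mul_nonpos_of_nonneg_of_nonpos (Nat.cast_nonneg _) ht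
    simp only [hHdef]
    exact max_eq_left ((min_le_right _ _).trans this)
  have hHpos : ∀ t, 0 < t → Tendsto (fun m => H m t) atTop (𝓝 1) := fun t ht => by
    refine tendsto_const_nhds.congr' ?_
    filter_upwards [(tendsto_natCast_atTop_atTop (R := ℝ)).eventually_ge_atTop (1 / t)] with m hm
    have : 1 ≤ (m : ℝ) * t := by rwa [div_le_iff₀ ht] at hm
    simp [hHdef, min_eq_left this]
  have hFneg : ∀ m t, t ≤ 0 → F m t = 0 := fun m t ht => by
    simp only [hFdef]
    rw [intervalIntegral.integral_congr (g := fun _ => 0), intervalIntegral.integral_zero]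
    intro s hs
    rw [uIcc_of_ge ht] at hs
    exact hHneg m s hs.2
  have hFlim : ∀ t, Tendsto (fun m => F m t) atTop (𝓝 (max t 0)) := fun t => by
    rcases le_or_gt t 0 with ht | ht
    · rw [max_eq_right ht]
      simp_rw [hFneg _ t ht]
      exact tendsto_const_nhds
    · rw [max_eq_left ht.le]
      suffices Tendsto (fun m => F m t) atTop (𝓝 (∫ _ in (0 : ℝ)..t, (1 : ℝ))) by
        simpa using this
      refine intervalIntegral.tendsto_integral_filter_of_dominated_convergence (fun _ => 1)
        (Eventually.of_forall fun m => (hHc m).aestronglyMeasurable)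
        (Eventually.of_forall fun m => Eventually.of_forall fun s _ => hH1 m s)
        (by simp) (Eventually.of_forall fun s hs => ?_)
      rw [uIoc_of_le ht.le] at hs
      exact hHpos s hs.1
  intro ψ hψ hψs hψu i
  have key := fun m => HasWeakGradient.comp_univ hw hDw h (hF m) (hHc m) (hH1 m) (hF0 m)
    ψ hψ hψs hψu i
  simp only [Measure.restrict_univ] at key
  simp only [Measure.restrict_univ]
  set e : Pt N := EuclideanSpace.single i 1
  have hdc := continuous_fderiv_apply hψ e
  have hds : HasCompactSupport fun x => fderiv ℝ ψ x e := hψs.fderiv_apply (𝕜 := ℝ) e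
  obtain ⟨C, hC⟩ := hdc.bounded_above_of_compact_support hds
  obtain ⟨C', hC'⟩ := hψ.continuous.bounded_above_of_compact_support hψs
  have hFc : ∀ m, Continuous (F m) := fun m =>
    continuous_iff_continuousAt.2 fun t => (hF m t).continuousAt
  have hDi : Integrable fun x => Dw x i :=
    (EuclideanSpace.proj (𝕜 := ℝ) i : Pt N →L[ℝ] ℝ).integrable_comp hDw
  have hlim1 : Tendsto (fun m => ∫ x, F m (w x) * fderiv ℝ ψ x e) atTop
      (𝓝 (∫ x, max (w x) 0 * fderiv ℝ ψ x e)) := by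
    refine tendsto_integral_of_dominated_convergence (fun x => |w x| * C)
      (fun m => ((hFc m).comp_aestronglyMeasurable hw.1).mul hdc.aestronglyMeasurable)
      (hw.abs.mul_const _) (fun m => Eventually.of_forall fun x => ?_)
      (Eventually.of_forall fun x => (hFlim _).mul_const _)
    rw [norm_mul]
    exact mul_le_mul (hFle _ _) (hC x) (norm_nonneg _) (abs_nonneg _)
  have hlim2 : Tendsto (fun m => ∫ x, (H m (w x) • Dw x) i * ψ x) atTop
      (𝓝 (∫ x, ({x | 0 < w x}.indicator Dw x) i * ψ x)) := by
    refine tendsto_integral_of_dominated_convergence (fun x => |Dw x i| * C')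
      (fun m => ?_) (hDi.abs.mul_const _) (fun m => Eventually.of_forall fun x => ?_)
      (Eventually.of_forall fun x => ?_)
    · simp only [PiLp.smul_apply, smul_eq_mul]
      exact (((hHc m).comp_aestronglyMeasurable hw.1).mul hDi.1).mul
        hψ.continuous.aestronglyMeasurable
    · rw [norm_mul, PiLp.smul_apply, smul_eq_mul, norm_mul]
      refine mul_le_mul ?_ (hC' x) (norm_nonneg _) (abs_nonneg _)
      calc _ ≤ 1 * |Dw x i| := mul_le_mul (hH1 _ _) le_rfl (abs_nonneg _) zero_le_one
        _ = _ := one_mul _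
    · refine Tendsto.mul_const _ ?_
      by_cases hx : 0 < w x
      · rw [indicator_of_mem (by exact hx)]
        simpa using (hHpos _ hx).mul_const (Dw x i)
      · rw [indicator_of_notMem (by exact hx)]
        simp [hHneg _ _ (not_lt.1 hx)]
  have hlim3 := hlim2.neg
  simp_rw [← key] at hlim3
  exact tendsto_nhds_unique hlim1 hlim3

/-- The weak gradient of `(v - k)⁺`. -/
lemma HasWeakGradient.posPart_sub_const {Ω : Set (Pt N)} (hΩ : IsOpen Ω) {v : Pt N → ℝ}
    {Dv : Pt N → Pt N} (hv : ∀ K, IsCompact K → K ⊆ Ω → IntegrableOn v K)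
    (hDv : ∀ K, IsCompact K → K ⊆ Ω → IntegrableOn Dv K) (h : HasWeakGradient Ω v Dv) (k : ℝ) :
    HasWeakGradient Ω (fun x => max (v x - k) 0) ({x | k < v x}.indicator Dv) := by
  intro ψ hψ hψs hψΩ i
  -- The rule on the whole space needs integrable functions. As `χ = 1` near the support of `ψ`,
  -- replacing `v - k` by `χ (v - k)` changes neither integral.
  obtain ⟨χ, hχ, hχs, hχΩ, hχ1, hχI⟩ := exists_smooth_cutoff hΩ hψs.isCompact hψΩ
  have hvk : ∀ K, IsCompact K → K ⊆ Ω → IntegrableOn (fun x => v x - k) K := fun K hK hKΩ =>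
    (hv K hK hKΩ).sub (integrableOn_const hK.measure_lt_top.ne)
  have h1 := (h.sub_const hv k).mul_cutoff hvk hDv hχ hχs hχΩ
  have hK := hχs.isCompact
  have iw : Integrable fun x => χ x * (v x - k) := by
    have := integrable_mul_of_tsupport_subset hK (hvk _ hK hχΩ) hχ.continuous Subset.rfl
    simpa only [mul_comm] using this
  have iD1 : Integrable fun x => χ x • Dv x := by
    have h1 : IntegrableOn (fun x => χ x • Dv x) (tsupport χ) :=
      (hDv _ hK hχΩ).continuousOn_smul hχ.continuous.continuousOn hK
    refine (integrableOn_iff_integrable_of_support_subset fun x hx => ?_).1 h1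
    by_contra h0
    exact hx (by simp [image_eq_zero_of_notMem_tsupport h0])
  have iD2 : Integrable fun x => (v x - k) • gradient χ x := by
    have h1 : IntegrableOn (fun x => (v x - k) • gradient χ x) (tsupport χ) :=
      (hvk _ hK hχΩ).smul_continuousOn (continuous_gradient_of_contDiff hχ).continuousOn hK
    refine (integrableOn_iff_integrable_of_support_subset fun x hx => ?_).1 h1
    by_contra h0
    refine hx ?_
    have : fderiv ℝ χ x = 0 := by
      by_contra h2
      exact h0 (support_fderiv_subset ℝ h2)
    simp [gradient, this]
  have h2 := h1.posPart_univ iw (iD1.add iD2) ψ hψ hψs (subset_univ _) i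
  simp only [Measure.restrict_univ] at h2
  have hz : ∀ x, x ∉ Ω → fderiv ℝ ψ x (EuclideanSpace.single i 1) = 0 := fun x hx =>
    image_eq_zero_of_notMem_tsupport (f := fun x => fderiv ℝ ψ x (EuclideanSpace.single i 1))
      fun h => hx (hψΩ (tsupport_fderiv_apply_subset ℝ _ h))
  have hz' : ∀ x, x ∉ Ω → ψ x = 0 := fun x hx =>
    image_eq_zero_of_notMem_tsupport fun h => hx (hψΩ h)
  rw [setIntegral_eq_integral_of_forall_compl_eq_zero fun x hx => by rw [hz x hx]; simp,
    setIntegral_eq_integral_of_forall_compl_eq_zero fun x hx => by rw [hz' x hx]; simp]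
  have hon : ∀ x ∈ tsupport ψ, χ x = 1 ∧ gradient χ x = 0 := by
    intro x hx
    have hev : ∀ᶠ y in 𝓝 x, χ y = 1 := hχ1.filter_mono (nhds_le_nhdsSet hx)
    refine ⟨hev.self_of_nhds, ?_⟩
    have : fderiv ℝ χ x = 0 := by
      rw [Filter.EventuallyEq.fderiv_eq (f := fun _ => (1 : ℝ)) hev]; simp
    simp [gradient, this]
  calc _ = ∫ x, max (χ x * (v x - k)) 0 * fderiv ℝ ψ x (EuclideanSpace.single i 1) := by
        congr 1; ext x
        by_cases hx : x ∈ tsupport ψ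
        · simp [(hon x hx).1]
        · have : fderiv ℝ ψ x (EuclideanSpace.single i 1) = 0 :=
            image_eq_zero_of_notMem_tsupport
              (f := fun x => fderiv ℝ ψ x (EuclideanSpace.single i 1))
              fun h => hx (tsupport_fderiv_apply_subset ℝ _ h)
          simp [this]
    _ = _ := h2
    _ = _ := by
        congr 2; ext x
        by_cases hx : x ∈ tsupport ψ
        · obtain ⟨e1, e2⟩ := hon x hx
          by_cases hk : k < v x
          · rw [indicator_of_mem (by simpa [e1] using hk), indicator_of_mem (by exact hk)]
            simp [e1, e2]
          · rw [indicator_of_notMem (by simpa [e1] using hk), indicator_of_notMem (by exact hk)]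
        · simp [image_eq_zero_of_notMem_tsupport hx]

/-! ### Hölder's inequality with several factors -/

/-- Hölder's inequality for a factor in `L^σ` and powers of two integrable functions, on a finite
measure space. -/
lemma lintegral_enorm_mul_rpow_le {α : Type*} [MeasurableSpace α] {μ : Measure α}
    {σ : ℝ≥0∞} (hσ : σ ≠ 0) {c : α → ℝ} (hc : AEStronglyMeasurable c μ) {f₁ f₂ : α → ℝ≥0∞}
    (h₁ : AEMeasurable f₁ μ) (h₂ : AEMeasurable f₂ μ) {a b d : ℝ} (ha : 0 ≤ a) (hb : 0 ≤ b)
    (hd : 0 ≤ d) (hsum : (σ⁻¹).toReal + a + b + d = 1) :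
    ∫⁻ x, ‖c x‖ₑ * f₁ x ^ a * f₂ x ^ b ∂μ
      ≤ eLpNorm c σ μ * (∫⁻ x, f₁ x ∂μ) ^ a * (∫⁻ x, f₂ x ∂μ) ^ b * μ univ ^ d := by
  rcases eq_or_ne σ ⊤ with rfl | hσt
  -- For `σ = ∞` the coefficient is pulled out by its essential supremum. In both cases the constant
  -- function 1 is an additional factor, and produces the power of the measure.
  · have key := ENNReal.lintegral_prod_norm_pow_le (μ := μ) (Finset.univ : Finset (Fin 3))
      (f := ![f₁, f₂, fun _ => 1]) (p := ![a, b, d])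
      (by intro i _; fin_cases i <;> simp [h₁, h₂])
      (by simp at hsum; simpa [Fin.sum_univ_three] using hsum)
      (by intro i _; fin_cases i <;> simp [ha, hb, hd])
    simp only [Fin.prod_univ_three, Matrix.cons_val_zero, Matrix.cons_val_one, Matrix.cons_val,
      ENNReal.one_rpow, mul_one, lintegral_const, one_mul] at key
    have hle : ∀ᵐ x ∂μ, ‖c x‖ₑ * f₁ x ^ a * f₂ x ^ b
        ≤ eLpNorm c ⊤ μ * (f₁ x ^ a * f₂ x ^ b) := by
      filter_upwards [enorm_ae_le_eLpNormEssSup c μ] with x hx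
      rw [mul_assoc, eLpNorm_exponent_top]
      gcongr
    refine (lintegral_mono_ae hle).trans ?_
    have e := lintegral_const_mul'' (eLpNorm c ⊤ μ) ((h₁.pow_const a).mul (h₂.pow_const b))
    simp only [Pi.mul_apply] at e
    rw [e, mul_assoc, mul_assoc, ← mul_assoc (_ ^ a)]
    gcongr
  · have hs : 0 < σ.toReal := ENNReal.toReal_pos hσ hσt
    rw [ENNReal.toReal_inv] at hsum
    have key := ENNReal.lintegral_prod_norm_pow_le (μ := μ) (Finset.univ : Finset (Fin 4))
      (f := ![fun x => ‖c x‖ₑ ^ σ.toReal, f₁, f₂, fun _ => 1]) (p := ![σ.toReal⁻¹, a, b, d])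
      (by
        intro i _
        fin_cases i
        · exact hc.enorm.pow_const _
        · exact h₁
        · exact h₂
        · exact aemeasurable_const)
      (by simpa [Fin.sum_univ_four] using hsum)
      (by intro i _; fin_cases i <;> simp [ha, hb, hd])
    simp only [Fin.prod_univ_four, Matrix.cons_val_zero, Matrix.cons_val_one, Matrix.cons_val,
      ENNReal.one_rpow, mul_one, lintegral_const, one_mul, ← ENNReal.rpow_mul,
      mul_inv_cancel₀ hs.ne', ENNReal.rpow_one] at key
    rw [eLpNorm_eq_lintegral_rpow_enorm_toReal hσ hσt, one_div]
    exact key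

lemma integral_mul_rpow_le {α : Type*} [MeasurableSpace α] {μ : Measure α} [IsFiniteMeasure μ]
    {σ : ℝ≥0∞} (hσ : σ ≠ 0) {c F₁ F₂ : α → ℝ} (hc : MemLp c σ μ) (hc0 : ∀ᵐ x ∂μ, 0 ≤ c x)
    (h₁ : Integrable F₁ μ) (h₁' : ∀ x, 0 ≤ F₁ x) (h₂ : Integrable F₂ μ) (h₂' : ∀ x, 0 ≤ F₂ x)
    {a b d : ℝ} (ha : 0 ≤ a) (hb : 0 ≤ b)
    (hd : 0 ≤ d) (hsum : (σ⁻¹).toReal + a + b + d = 1) :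
    Integrable (fun x => c x * F₁ x ^ a * F₂ x ^ b) μ ∧
    ∫ x, c x * F₁ x ^ a * F₂ x ^ b ∂μ
      ≤ (eLpNorm c σ μ).toReal * (∫ x, F₁ x ∂μ) ^ a * (∫ x, F₂ x ∂μ) ^ b * μ.real univ ^ d := by
  have hm : AEStronglyMeasurable (fun x => c x * F₁ x ^ a * F₂ x ^ b) μ :=
    ((hc.1.aemeasurable.mul (h₁.1.aemeasurable.pow_const a)).mul
      (h₂.1.aemeasurable.pow_const b)).aestronglyMeasurable
  have key := lintegral_enorm_mul_rpow_le hσ hc.1 (f₁ := fun x => ENNReal.ofReal (F₁ x))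
    (f₂ := fun x => ENNReal.ofReal (F₂ x)) h₁.1.aemeasurable.ennreal_ofReal
    h₂.1.aemeasurable.ennreal_ofReal ha hb hd hsum
  rw [← ofReal_integral_eq_lintegral_ofReal h₁ (Eventually.of_forall h₁'),
    ← ofReal_integral_eq_lintegral_ofReal h₂ (Eventually.of_forall h₂')] at key
  have e : ∀ x, ‖c x * F₁ x ^ a * F₂ x ^ b‖ₑ
      = ‖c x‖ₑ * ENNReal.ofReal (F₁ x) ^ a * ENNReal.ofReal (F₂ x) ^ b := fun x => by
    rw [enorm_mul, enorm_mul, Real.enorm_of_nonneg (Real.rpow_nonneg (h₁' x) a),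
      Real.enorm_of_nonneg (Real.rpow_nonneg (h₂' x) b),
      ENNReal.ofReal_rpow_of_nonneg (h₁' x) ha, ENNReal.ofReal_rpow_of_nonneg (h₂' x) hb]
  have hI₁ : 0 ≤ ∫ x, F₁ x ∂μ := integral_nonneg h₁'
  have hI₂ : 0 ≤ ∫ x, F₂ x ∂μ := integral_nonneg h₂'
  have hfin : eLpNorm c σ μ * ENNReal.ofReal (∫ x, F₁ x ∂μ) ^ a
      * ENNReal.ofReal (∫ x, F₂ x ∂μ) ^ b * μ univ ^ d ≠ ⊤ := by
    refine ENNReal.mul_ne_top (ENNReal.mul_ne_top (ENNReal.mul_ne_top hc.2.ne ?_) ?_) ?_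
    · exact ENNReal.rpow_ne_top_of_nonneg ha ENNReal.ofReal_ne_top
    · exact ENNReal.rpow_ne_top_of_nonneg hb ENNReal.ofReal_ne_top
    · exact ENNReal.rpow_ne_top_of_nonneg hd (measure_ne_top _ _)
  refine ⟨⟨hm, ?_⟩, ?_⟩
  · rw [HasFiniteIntegral, lintegral_congr e]
    exact key.trans_lt hfin.lt_top
  · have hnn : ∀ᵐ x ∂μ, 0 ≤ c x * F₁ x ^ a * F₂ x ^ b := by
      filter_upwards [hc0] with x hx
      exact mul_nonneg (mul_nonneg hx (Real.rpow_nonneg (h₁' x) a)) (Real.rpow_nonneg (h₂' x) b)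
    have e' : ∫ x, c x * F₁ x ^ a * F₂ x ^ b ∂μ
        = (∫⁻ x, ‖c x‖ₑ * ENNReal.ofReal (F₁ x) ^ a * ENNReal.ofReal (F₂ x) ^ b ∂μ).toReal := by
      rw [integral_eq_lintegral_of_nonneg_ae hnn hm]
      congr 1
      refine lintegral_congr_ae ?_
      filter_upwards [hnn] with x hx
      rw [← e x, Real.enorm_of_nonneg hx]
    rw [e']
    refine (ENNReal.toReal_mono hfin key).trans_eq ?_
    simp only [ENNReal.toReal_mul, ← ENNReal.toReal_rpow, ENNReal.toReal_ofReal hI₁,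
      ENNReal.toReal_ofReal hI₂]
    rfl

/-- Hölder's inequality on a subset `A` of a set `K`, with the `L^σ` norm taken over `K`. -/
lemma setIntegral_mul_rpow_le {α : Type*} [MeasurableSpace α] {μ : Measure α} {A K : Set α}
    (hAK : A ⊆ K) (hK : μ K ≠ ⊤)
    {σ : ℝ≥0∞} (hσ : σ ≠ 0) {c F₁ F₂ : α → ℝ} (hc : MemLp c σ (μ.restrict K))
    (hc0 : ∀ᵐ x ∂(μ.restrict K), 0 ≤ c x)
    (h₁ : IntegrableOn F₁ A μ) (h₁' : ∀ x, 0 ≤ F₁ x) (h₂ : IntegrableOn F₂ A μ)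
    (h₂' : ∀ x, 0 ≤ F₂ x) {a b d : ℝ} (ha : 0 ≤ a) (hb : 0 ≤ b)
    (hd : 0 ≤ d) (hsum : (σ⁻¹).toReal + a + b + d = 1) :
    IntegrableOn (fun x => c x * F₁ x ^ a * F₂ x ^ b) A μ ∧
    ∫ x in A, c x * F₁ x ^ a * F₂ x ^ b ∂μ
      ≤ (eLpNorm c σ (μ.restrict K)).toReal * (∫ x in A, F₁ x ∂μ) ^ a * (∫ x in A, F₂ x ∂μ) ^ b
        * μ.real A ^ d := by
  have hAfin : μ A ≠ ⊤ := ((measure_mono hAK).trans_lt hK.lt_top).ne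
  have : IsFiniteMeasure (μ.restrict A) := ⟨by simpa using hAfin.lt_top⟩
  have hmono : μ.restrict A ≤ μ.restrict K := Measure.restrict_mono hAK le_rfl
  obtain ⟨h3, h4⟩ := integral_mul_rpow_le hσ (hc.mono_measure hmono)
    (ae_mono hmono hc0) h₁ h₁' h₂ h₂' ha hb hd hsum
  refine ⟨h3, h4.trans ?_⟩
  have e : (μ.restrict A).real univ = μ.real A := by simp [Measure.real]
  rw [e]
  have : 0 ≤ ∫ x in A, F₁ x ∂μ := integral_nonneg h₁'
  have : 0 ≤ ∫ x in A, F₂ x ∂μ := integral_nonneg h₂'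
  gcongr
  exact hc.2.ne

/-! ### Iteration lemma and radial cutoffs -/

/-- The iteration lemma: a bounded function with
`Φ s ≤ θ Φ t + A / (t - s) ^ p + B` and `θ < 1` satisfies the same bound without `Φ t`. -/
lemma exists_iteration_const {p θ : ℝ} (hp : 0 < p) (hθ0 : 0 ≤ θ) (hθ : θ < 1) :
    ∃ c : ℝ, 0 < c ∧ ∀ (Φ : ℝ → ℝ) (ρ R A B M : ℝ), ρ < R → 0 ≤ A → 0 ≤ B →
      (∀ s, ρ ≤ s → s < R → Φ s ≤ M) →
      (∀ s t, ρ ≤ s → s < t → t < R → Φ s ≤ θ * Φ t + A / (t - s) ^ p + B) →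
      Φ ρ ≤ c * (A / (R - ρ) ^ p + B) := by
  -- The radii approach `R` with gaps proportional to `l^i`. Each step costs `l^(-p)` and gains `θ`;
  -- the choice `l^p = (1 + θ)/2 > θ` makes `r = θ / l^p < 1`, so the errors form a convergent
  -- geometric series.
  set l : ℝ := ((1 + θ) / 2) ^ (1 / p) with hl
  have hl0 : 0 < l := by positivity
  have hl1 : l < 1 := Real.rpow_lt_one (by positivity) (by linarith) (by positivity)
  have hlp : l ^ p = (1 + θ) / 2 := by
    rw [hl, ← Real.rpow_mul (by positivity), one_div_mul_cancel hp.ne', Real.rpow_one]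
  set r := θ / l ^ p with hr
  have hr0 : 0 ≤ r := by positivity
  have hr1 : r < 1 := by rw [hr, hlp, div_lt_one (by positivity)]; linarith
  have hθr : θ ≤ r := by
    rw [hr, le_div_iff₀ (by positivity), hlp]; nlinarith
  have h1l : 0 < (1 - l) ^ p := Real.rpow_pos_of_pos (by linarith) p
  refine ⟨(1 + 1 / (1 - l) ^ p) / (1 - r), by have : 0 < 1 - r := by linarith
                                              positivity, ?_⟩
  intro Φ ρ R A B M hρR hA hB hM h
  set Q := A / ((1 - l) ^ p * (R - ρ) ^ p) + B with hQ
  have hd : 0 < (R - ρ) ^ p := Real.rpow_pos_of_pos (by linarith) p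
  have hQ0 : 0 ≤ Q := by positivity
  set τ : ℕ → ℝ := fun i => R - l ^ i * (R - ρ) with hτ
  have hτ0 : τ 0 = ρ := by simp [hτ]
  have hlpow : ∀ i : ℕ, l ^ i ≤ 1 := fun i => pow_le_one₀ hl0.le hl1.le
  have hτge : ∀ i, ρ ≤ τ i := fun i => by
    have := mul_le_mul_of_nonneg_right (hlpow i) (by linarith : 0 ≤ R - ρ)
    simp only [hτ]; linarith
  have hτlt : ∀ i, τ i < R := fun i => by
    have : 0 < l ^ i * (R - ρ) := mul_pos (pow_pos hl0 i) (by linarith)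
    simp only [hτ]; linarith
  have hstep : ∀ i, θ ^ i * Φ (τ i) ≤ θ ^ (i + 1) * Φ (τ (i + 1)) + r ^ i * Q := by
    intro i
    have hdiff : τ (i + 1) - τ i = l ^ i * ((1 - l) * (R - ρ)) := by simp only [hτ]; ring
    have hdpos : 0 < τ (i + 1) - τ i := by
      rw [hdiff]; exact mul_pos (pow_pos hl0 i) (mul_pos (by linarith) (by linarith))
    have h1 := h (τ i) (τ (i + 1)) (hτge i) (by linarith) (hτlt _)
    have e : (τ (i + 1) - τ i) ^ p = (l ^ p) ^ i * ((1 - l) ^ p * (R - ρ) ^ p) := by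
      rw [hdiff, Real.mul_rpow (by positivity)
        (mul_nonneg (by linarith) (by linarith)), Real.mul_rpow (by linarith) (by linarith),
        ← Real.rpow_natCast, ← Real.rpow_mul hl0.le, mul_comm (i : ℝ), Real.rpow_mul hl0.le,
        Real.rpow_natCast]
    have h2 := mul_le_mul_of_nonneg_left h1 (pow_nonneg hθ0 i)
    have h3 : θ ^ i * (A / (τ (i + 1) - τ i) ^ p)
        = r ^ i * (A / ((1 - l) ^ p * (R - ρ) ^ p)) := by
      rw [e, hr, div_pow]
      field_simp
    have h4 : θ ^ i * B ≤ r ^ i * B := by gcongr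
    rw [hQ, mul_add, ← h3]
    calc _ ≤ _ := h2
      _ = θ ^ (i + 1) * Φ (τ (i + 1)) + θ ^ i * (A / (τ (i + 1) - τ i) ^ p) + θ ^ i * B := by ring
      _ ≤ _ := by linarith
  have hsum : ∀ m, Φ ρ ≤ θ ^ m * Φ (τ m) + (∑ i ∈ Finset.range m, r ^ i) * Q := by
    intro m
    induction m with
    | zero => simp [hτ0]
    | succ m ih =>
      rw [Finset.sum_range_succ, add_mul]
      linarith [hstep m]
  have hgeom : ∀ m, ∑ i ∈ Finset.range m, r ^ i ≤ 1 / (1 - r) := fun m => by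
    rw [one_div, ← tsum_geometric_of_lt_one hr0 hr1]
    exact (summable_geometric_of_lt_one hr0 hr1).sum_le_tsum _ fun i _ => pow_nonneg hr0 i
  have hbd : ∀ m, Φ ρ ≤ θ ^ m * M + 1 / (1 - r) * Q := fun m => by
    refine (hsum m).trans (add_le_add ?_ ?_)
    · exact mul_le_mul_of_nonneg_left (hM _ (hτge m) (hτlt m)) (pow_nonneg hθ0 m)
    · exact mul_le_mul_of_nonneg_right (hgeom m) hQ0
  have hlim : Tendsto (fun m : ℕ => θ ^ m * M + 1 / (1 - r) * Q) atTop
      (𝓝 (0 * M + 1 / (1 - r) * Q)) :=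
    ((tendsto_pow_atTop_nhds_zero_of_lt_one hθ0 hθ).mul_const M).add_const _
  have hfin := ge_of_tendsto' hlim hbd
  have h1r : 0 < 1 - r := by linarith
  refine hfin.trans ?_
  rw [zero_mul, zero_add, div_mul_eq_mul_div, one_mul, div_mul_eq_mul_div]
  refine div_le_div_of_nonneg_right ?_ h1r.le
  rw [hQ, add_mul, one_mul]
  have h5 : A / ((1 - l) ^ p * (R - ρ) ^ p) = 1 / (1 - l) ^ p * (A / (R - ρ) ^ p) := by
    field_simp
  rw [h5, mul_add]
  have : 0 ≤ A / (R - ρ) ^ p := by positivity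
  have : 0 ≤ 1 / (1 - l) ^ p * B := by positivity
  linarith

/-- The derivative is continuous on `[0, 1]` and zero outside. -/
lemma exists_abs_deriv_smoothTransition_le : ∃ C : ℝ, 0 < C ∧
    ∀ y, |deriv Real.smoothTransition y| ≤ C := by
  have hc : Continuous (deriv Real.smoothTransition) :=
    (Real.smoothTransition.contDiff (n := 1)).continuous_deriv le_rfl
  obtain ⟨C, hC⟩ := (isCompact_Icc (a := (0 : ℝ)) (b := 1)).exists_bound_of_continuousOn
    hc.continuousOn
  refine ⟨|C| + 1, by positivity, fun y => ?_⟩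
  by_cases hy : y ∈ Icc (0 : ℝ) 1
  · exact (hC y hy).trans (by linarith [le_abs_self C])
  · have h0 : deriv Real.smoothTransition y = 0 := by
      rw [mem_Icc, not_and_or, not_le, not_le] at hy
      rcases hy with hy | hy
      · have : Real.smoothTransition =ᶠ[𝓝 y] fun _ => 0 := by
          filter_upwards [gt_mem_nhds hy] with z hz
          exact Real.smoothTransition.zero_of_nonpos hz.le
        rw [this.deriv_eq]; simp
      · have : Real.smoothTransition =ᶠ[𝓝 y] fun _ => 1 := by
          filter_upwards [lt_mem_nhds hy] with z hz
          exact Real.smoothTransition.one_of_one_le hz.le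
        rw [this.deriv_eq]; simp
    rw [h0, abs_zero]; positivity

/-- Cutoff functions between concentric balls whose gradient is controlled by a power of the
function itself. -/
lemma exists_radial_cutoff (N : ℕ) {p : ℝ} (hp : 1 < p) :
    ∃ C : ℝ, 0 < C ∧ ∀ (x₀ : Pt N) (s t : ℝ), 0 < s → s < t →
      ∃ ζ : Pt N → ℝ, ContDiff ℝ ∞ ζ ∧ (∀ x, 0 ≤ ζ x) ∧ (∀ x, ζ x ≤ 1) ∧
        (∀ x ∈ Metric.ball x₀ s, ζ x = 1) ∧ (∀ x, x ∉ Metric.ball x₀ t → ζ x = 0) ∧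
        ∀ x, ‖gradient ζ x‖ ^ p ≤ C / (t - s) ^ p * ζ x ^ (p - 1) := by
  obtain ⟨C, hC0, hC⟩ := exists_abs_deriv_smoothTransition_le
  -- The cutoff is `ζ = h^m`, so `|∇ζ|^p` carries `h^((m-1)p)`, and `(m-1)p ≥ m(p-1)` exactly when
  -- `m ≥ p`; this gives the factor `ζ^(p-1)`.
  set m : ℕ := ⌈p⌉₊ + 1 with hm
  have hmp : p ≤ m := by rw [hm]; push_cast; linarith [Nat.le_ceil p]
  refine ⟨(m * C * 2) ^ p, by positivity, fun x₀ s t hs hst => ?_⟩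
  set h := Real.smoothTransition with hh
  have hts : 0 < t ^ 2 - s ^ 2 := by nlinarith
  -- The squared distance is used because it is smooth at the centre too; the gradient is still at
  -- most `2t / (t² - s²) ≤ 2 / (t - s)`.
  set y : Pt N → ℝ := fun x => (t ^ 2 - ‖x - x₀‖ ^ 2) / (t ^ 2 - s ^ 2) with hy
  have hyc : ContDiff ℝ ∞ y :=
    (contDiff_const.sub ((contDiff_id.sub contDiff_const).norm_sq ℝ)).div_const _
  have hhc : ContDiff ℝ ∞ h := Real.smoothTransition.contDiff
  have hh0 : ∀ z, 0 ≤ h z := Real.smoothTransition.nonneg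
  have hh1 : ∀ z, h z ≤ 1 := Real.smoothTransition.le_one
  refine ⟨fun x => h (y x) ^ m, (hhc.comp hyc).pow m, fun x => pow_nonneg (hh0 _) m,
    fun x => pow_le_one₀ (hh0 _) (hh1 _), fun x hx => ?_, fun x hx => ?_, fun x => ?_⟩
  · have : 1 ≤ y x := by
      rw [mem_ball_iff_norm] at hx
      simp only [hy]
      rw [one_le_div hts]
      nlinarith [norm_nonneg (x - x₀)]
    simp [hh, Real.smoothTransition.one_of_one_le this]
  · have : y x ≤ 0 := by
      rw [mem_ball_iff_norm, not_lt] at hx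
      simp only [hy]
      refine div_nonpos_of_nonpos_of_nonneg ?_ hts.le
      nlinarith [norm_nonneg (x - x₀)]
    have hm0 : m ≠ 0 := by omega
    simp [hh, Real.smoothTransition.zero_of_nonpos this, hm0]
  · rw [norm_gradient_eq]
    have d1 : HasFDerivAt y ((t ^ 2 - s ^ 2)⁻¹ • -(2 • innerSL ℝ (x - x₀) : Pt N →L[ℝ] ℝ)) x := by
      have e1 : HasFDerivAt (fun x : Pt N => ‖x - x₀‖ ^ 2) (2 • innerSL ℝ (x - x₀) : Pt N →L[ℝ] ℝ) x := by
        simpa using! ((hasFDerivAt_id x).sub_const x₀).norm_sq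
      have e2 := (e1.const_sub (t ^ 2)).const_mul (t ^ 2 - s ^ 2)⁻¹
      refine e2.congr_of_eventuallyEq (Eventually.of_forall fun z => ?_)
      simp only [hy]; rw [div_eq_inv_mul]
    have d2 : HasDerivAt h (deriv h (y x)) (y x) :=
      (hhc.differentiable (by simp) _).hasDerivAt
    have d3 := (d2.comp_hasFDerivAt x d1).pow m
    rw [show fderiv ℝ (fun x => h (y x) ^ m) x = _ from d3.fderiv]
    by_cases hx : ‖x - x₀‖ ≤ t
    · have hn : ‖(t ^ 2 - s ^ 2)⁻¹ • -(2 • innerSL ℝ (x - x₀) : Pt N →L[ℝ] ℝ)‖ ≤ 2 / (t - s) := by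
        rw [norm_smul, norm_neg, Real.norm_of_nonneg (by positivity)]
        have : ‖(2 • innerSL ℝ (x - x₀) : Pt N →L[ℝ] ℝ)‖ ≤ 2 * t := by
          refine (norm_nsmul_le (n := 2)).trans ?_
          rw [innerSL_apply_norm]
          push_cast; linarith
        calc (t ^ 2 - s ^ 2)⁻¹ * _ ≤ (t ^ 2 - s ^ 2)⁻¹ * (2 * t) := by gcongr
          _ ≤ 2 / (t - s) := by
            rw [inv_mul_eq_div, div_le_div_iff₀ hts (by linarith)]
            nlinarith
      have hle : ‖(m • (h ∘ y) x ^ (m - 1)) • deriv h (y x) •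
            (t ^ 2 - s ^ 2)⁻¹ • -(2 • innerSL ℝ (x - x₀) : Pt N →L[ℝ] ℝ)‖
          ≤ (m * C * 2) / (t - s) * h (y x) ^ (m - 1) := by
        rw [nsmul_eq_mul, norm_smul, norm_smul, norm_mul, Function.comp_apply,
          Real.norm_of_nonneg (pow_nonneg (hh0 _) _), Real.norm_of_nonneg (Nat.cast_nonneg m)]
        have h1 := hC (y x)
        rw [← Real.norm_eq_abs] at h1
        have h2 := hh0 (y x)
        calc _ ≤ (m * h (y x) ^ (m - 1)) * (C * (2 / (t - s))) := by gcongr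
          _ = _ := by ring
      have hts' : 0 < t - s := by linarith
      refine (Real.rpow_le_rpow (norm_nonneg _) hle (by linarith)).trans ?_
      rw [Real.mul_rpow (by positivity) (pow_nonneg (hh0 _) _), Real.div_rpow (by positivity) hts'.le]
      refine mul_le_mul_of_nonneg_left ?_ (by positivity)
      beta_reduce
      rw [← Real.rpow_natCast, ← Real.rpow_natCast, ← Real.rpow_mul (hh0 _),
        ← Real.rpow_mul (hh0 _)]
      refine Real.rpow_le_rpow_of_exponent_ge' (hh0 _) (hh1 _) (by
        have : 0 < p - 1 := by linarith
        positivity) ?_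
      have : ((m - 1 : ℕ) : ℝ) = m - 1 := by
        rw [Nat.cast_sub (by omega)]; simp
      rw [this]; linarith
    · have h0 : h (y x) = 0 := by
        refine Real.smoothTransition.zero_of_nonpos ?_
        simp only [hy]
        refine div_nonpos_of_nonpos_of_nonneg ?_ hts.le
        rw [not_le] at hx
        nlinarith [norm_nonneg (x - x₀)]
      have hm1 : m - 1 ≠ 0 := by
        have : 0 < ⌈p⌉₊ := Nat.ceil_pos.2 (by linarith)
        omega
      have hts' : 0 < t - s := by linarith
      have : ‖(m • (h ∘ y) x ^ (m - 1)) • deriv h (y x) •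
          (t ^ 2 - s ^ 2)⁻¹ • -(2 • innerSL ℝ (x - x₀) : Pt N →L[ℝ] ℝ)‖ = 0 := by simp [h0, hm1]
      rw [this, Real.zero_rpow (by linarith)]
      have := pow_nonneg (hh0 (y x)) m
      positivity

/-! ### Measurability, elementary power inequalities and the Sobolev exponent -/

/-- Compositions of Carathéodory functions with measurable functions are measurable. -/
lemma IsCaratheodory.aemeasurable_comp {N : ℕ} {Y : Type*} [NormedAddCommGroup Y]
    {Ω S : Set (Pt N)} {h : Pt N → Y → ℝ} (hh : IsCaratheodory Ω h) (hS : S ⊆ Ω)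
    {y : Pt N → Y} (hy : AEStronglyMeasurable y (volume.restrict S)) :
    AEMeasurable (fun x => h x (y x)) (volume.restrict S) := by
  have hmono : volume.restrict S ≤ volume.restrict Ω := Measure.restrict_mono hS le_rfl
  set z := hy.mk y
  have hz : StronglyMeasurable z := hy.stronglyMeasurable_mk
  have hmain : AEMeasurable (fun x => h x (z x)) (volume.restrict S) := by
    -- For a simple function the composition is a finite sum of measurable pieces; continuity in the
    -- second variable passes to the limit.
    refine aemeasurable_of_tendsto_metrizable_ae atTop (f := fun n x => h x (hz.approx n x))
      (fun n => ?_) ?_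
    · have e : (fun x => h x (hz.approx n x)) = fun x => ∑ v ∈ (hz.approx n).range,
          ((hz.approx n) ⁻¹' {v}).indicator (fun x => h x v) x := by
        ext x
        rw [Finset.sum_eq_single (hz.approx n x)]
        · simp
        · intro v _ hv
          exact indicator_of_notMem (fun hx => hv (by simpa using hx.symm)) _
        · intro hx
          exact absurd (SimpleFunc.mem_range_self _ x) hx
      rw [e]
      refine Finset.aemeasurable_fun_sum _ fun v _ => ?_
      exact ((hh.measurable v).mono_measure hmono).indicator ((hz.approx n).measurableSet_fiber v)
    · filter_upwards [ae_mono hmono hh.continuous] with x hx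
      exact (hx.tendsto _).comp (hz.tendsto_approx x)
  refine hmain.congr ?_
  filter_upwards [hy.ae_eq_mk] with x hx
  rw [hx]

lemma Real.add_rpow_le_two_rpow_mul {a b r : ℝ} (ha : 0 ≤ a) (hb : 0 ≤ b) (hr : 0 ≤ r) :
    (a + b) ^ r ≤ 2 ^ r * (a ^ r + b ^ r) := by
  have h1 : a + b ≤ 2 * max a b := by linarith [le_max_left a b, le_max_right a b]
  refine (Real.rpow_le_rpow (by positivity) h1 hr).trans ?_
  rw [Real.mul_rpow (by norm_num) (le_max_of_le_left ha)]
  gcongr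
  rcases max_cases a b with ⟨h, _⟩ | ⟨h, _⟩ <;> rw [h]
  · linarith [Real.rpow_nonneg hb r]
  · linarith [Real.rpow_nonneg ha r]

lemma norm_convex_combination_rpow_le {E : Type*} [NormedAddCommGroup E] [NormedSpace ℝ E]
    {p t : ℝ} (hp : 1 ≤ p) (h0 : 0 ≤ t) (h1 : t ≤ 1) (x y : E) :
    ‖(1 - t) • x + t • y‖ ^ p ≤ (1 - t) * ‖x‖ ^ p + t * ‖y‖ ^ p := by
  have h2 : ‖(1 - t) • x + t • y‖ ≤ (1 - t) * ‖x‖ + t * ‖y‖ := by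
    refine (norm_add_le _ _).trans (le_of_eq ?_)
    rw [norm_smul, norm_smul, Real.norm_of_nonneg (by linarith), Real.norm_of_nonneg h0]
  refine (Real.rpow_le_rpow (norm_nonneg _) h2 (by linarith)).trans ?_
  exact (convexOn_rpow hp).2 (norm_nonneg x) (norm_nonneg y) (by linarith) h0 (by ring)

lemma sobolevExp_pos {N : ℕ} {p : ℝ} (hp : 1 < p) (hpN : p < N) : 0 < sobolevExp N p := by
  have h1 : 0 < (N : ℝ) - p := by linarith
  have h2 : (0 : ℝ) < N := by linarith
  unfold sobolevExp
  positivity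

/-- This identity turns `(|k|^(p^*) |A|)^(p/p^*)` into `|k|^p |A|^(1 - p/N)`, the origin of the
exponent in the final estimate. -/
lemma div_sobolevExp {N : ℕ} {p : ℝ} (hp : 1 < p) (hpN : p < N) :
    p / sobolevExp N p = 1 - p / N := by
  have h1 : (N : ℝ) - p ≠ 0 := by linarith
  have h2 : (N : ℝ) ≠ 0 := by linarith
  have h3 : p ≠ 0 := by linarith
  unfold sobolevExp
  field_simp

lemma toReal_inv_ofReal {r : ℝ} (hr : 0 < r) : ((ENNReal.ofReal r)⁻¹).toReal = r⁻¹ := by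
  rw [ENNReal.toReal_inv, ENNReal.toReal_ofReal hr.le]

/-- The Sobolev inequality in terms of Bochner integrals. -/
lemma exists_sobolev_integral_const {N : ℕ} {p : ℝ} (hp : 1 < p) (hpN : p < N) :
    ∃ S : ℝ, 0 < S ∧ ∀ (w : Pt N → ℝ) (Dw : Pt N → Pt N), HasCompactSupport w →
      MemLp w (ENNReal.ofReal p) volume → MemLp Dw (ENNReal.ofReal p) volume →
      HasWeakGradient univ w Dw →
      Integrable (fun x => |w x| ^ sobolevExp N p) ∧
      (∫ x, |w x| ^ sobolevExp N p) ^ (p / sobolevExp N p) ≤ S * ∫ x, ‖Dw x‖ ^ p := by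
  obtain ⟨S, hS, h⟩ := exists_sobolev_const hp hpN
  have hP := sobolevExp_pos hp hpN
  set P := sobolevExp N p
  refine ⟨S ^ (p / P), by positivity, fun w Dw hws hw hDw hwD => ?_⟩
  have h1p : (1 : ℝ≥0∞) ≤ ENNReal.ofReal p := by
    rw [← ENNReal.ofReal_one]; exact ENNReal.ofReal_le_ofReal hp.le
  have hp0 : 0 < p := by linarith
  have key := h w Dw hws (hw.locallyIntegrable h1p) (hDw.locallyIntegrable h1p) hwD
  have hDi : Integrable fun x => ‖Dw x‖ ^ p := by
    have := hDw.integrable_norm_rpow (by simpa using hp0) ENNReal.ofReal_ne_top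
    rwa [ENNReal.toReal_ofReal hp0.le] at this
  have eD : ∫⁻ x, ‖Dw x‖ₑ ^ p = ENNReal.ofReal (∫ x, ‖Dw x‖ ^ p) := by
    rw [ofReal_integral_eq_lintegral_ofReal hDi (Eventually.of_forall fun x => by positivity)]
    refine lintegral_congr fun x => ?_
    rw [← ofReal_norm, ENNReal.ofReal_rpow_of_nonneg (norm_nonneg _) hp0.le]
  have hI : 0 ≤ ∫ x, ‖Dw x‖ ^ p := integral_nonneg fun x => by positivity
  rw [eD, ENNReal.ofReal_rpow_of_nonneg hI (by positivity), ← ENNReal.ofReal_mul hS.le] at key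
  have ew : ∀ x, ‖w x‖ₑ ^ P = ‖|w x| ^ P‖ₑ := fun x => by
    rw [Real.enorm_of_nonneg (Real.rpow_nonneg (abs_nonneg _) _), ← ofReal_norm (w x),
      ENNReal.ofReal_rpow_of_nonneg (norm_nonneg _) hP.le, Real.norm_eq_abs]
  have hm : AEStronglyMeasurable fun x => |w x| ^ P :=
    (hw.1.norm.aemeasurable.pow_const P).aestronglyMeasurable
  have hint : Integrable fun x => |w x| ^ P := by
    refine ⟨hm, ?_⟩
    rw [HasFiniteIntegral, ← lintegral_congr ew]
    exact key.trans_lt ENNReal.ofReal_lt_top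
  refine ⟨hint, ?_⟩
  have ei : ∫ x, |w x| ^ P ≤ S * (∫ x, ‖Dw x‖ ^ p) ^ (P / p) := by
    rw [integral_eq_lintegral_of_nonneg_ae (Eventually.of_forall fun x => by positivity) hm]
    refine ENNReal.toReal_le_of_le_ofReal (by positivity) ?_
    refine le_trans (le_of_eq ?_) key
    refine lintegral_congr fun x => ?_
    rw [ew, Real.enorm_of_nonneg (by positivity)]
  have hI' : 0 ≤ ∫ x, |w x| ^ P := integral_nonneg fun x => by positivity
  refine (Real.rpow_le_rpow hI' ei (by positivity)).trans_eq ?_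
  rw [Real.mul_rpow hS.le (by positivity), ← Real.rpow_mul hI,
    show P / p * (p / P) = 1 by field_simp, Real.rpow_one]

/-! ### Integrability of cutoffs and local Sobolev embedding -/

lemma memLp_of_norm_le_mul_of_eq_zero {N : ℕ} {E F : Type*} [NormedAddCommGroup E]
    [NormedAddCommGroup F] {K : Set (Pt N)} (hK : MeasurableSet K) {r : ℝ≥0∞} {v : Pt N → E}
    {g : Pt N → F} (hv : MemLp v r (volume.restrict K))
    (hg : AEStronglyMeasurable g (volume.restrict K)) {C : ℝ} (h : ∀ x, ‖g x‖ ≤ C * ‖v x‖)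
    (h0 : ∀ x, x ∉ K → g x = 0) : MemLp g r volume := by
  have h1 : MemLp g r (volume.restrict K) := hv.of_le_mul hg (Eventually.of_forall h)
  have h2 : K.indicator g = g := by
    ext1 x
    by_cases hx : x ∈ K
    · rw [indicator_of_mem hx]
    · rw [indicator_of_notMem hx, h0 x hx]
  rw [← h2]
  exact (memLp_indicator_iff_restrict hK).2 h1

section cutoff_memLp

variable {N : ℕ} {p : ℝ} {χ v : Pt N → ℝ} {Dv : Pt N → Pt N} {K : Set (Pt N)}

lemma gradient_eq_zero_of_notMem_tsupport {x : Pt N} (hx : x ∉ tsupport χ) :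
    gradient χ x = 0 := by
  have : fderiv ℝ χ x = 0 := by
    by_contra h2
    exact hx (support_fderiv_subset ℝ h2)
  simp [gradient, this]

lemma memLp_cutoff_mul (hχ : ContDiff ℝ ∞ χ) (hK : IsCompact K) (hχK : tsupport χ ⊆ K)
    (hv : MemLp v (ENNReal.ofReal p) (volume.restrict K)) :
    MemLp (fun x => χ x * v x) (ENNReal.ofReal p) volume := by
  obtain ⟨C, hC⟩ := hχ.continuous.bounded_above_of_compact_support
    (hK.of_isClosed_subset (isClosed_tsupport _) hχK)
  refine memLp_of_norm_le_mul_of_eq_zero hK.measurableSet hv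
    (hχ.continuous.aestronglyMeasurable.mul hv.1) (C := C) (fun x => ?_) (fun x hx => ?_)
  · rw [norm_mul]; gcongr; exact hC x
  · rw [image_eq_zero_of_notMem_tsupport fun h => hx (hχK h), zero_mul]

lemma memLp_cutoff_gradient (hχ : ContDiff ℝ ∞ χ) (hK : IsCompact K) (hχK : tsupport χ ⊆ K)
    (hv : MemLp v (ENNReal.ofReal p) (volume.restrict K))
    (hDv : MemLp Dv (ENNReal.ofReal p) (volume.restrict K)) :
    MemLp (fun x => χ x • Dv x + v x • gradient χ x) (ENNReal.ofReal p) volume := by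
  have hχs : HasCompactSupport χ := hK.of_isClosed_subset (isClosed_tsupport _) hχK
  obtain ⟨C, hC⟩ := hχ.continuous.bounded_above_of_compact_support hχs
  have hgc := continuous_gradient_of_contDiff hχ
  obtain ⟨C', hC'⟩ := hgc.bounded_above_of_compact_support
    (hK.of_isClosed_subset (isClosed_tsupport _) ((closure_minimal (fun x hx => by
      by_contra h
      exact hx (gradient_eq_zero_of_notMem_tsupport h)) (isClosed_tsupport _)).trans hχK))
  refine (memLp_of_norm_le_mul_of_eq_zero hK.measurableSet hDv
    (hχ.continuous.aestronglyMeasurable.smul hDv.1) (C := C) (fun x => ?_) (fun x hx => ?_)).add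
    (memLp_of_norm_le_mul_of_eq_zero hK.measurableSet hv
    (hv.1.smul hgc.aestronglyMeasurable) (C := C') (fun x => ?_) (fun x hx => ?_))
  · simp only [Pi.smul_apply']
    rw [norm_smul]; gcongr; exact hC x
  · simp only [Pi.smul_apply']
    rw [image_eq_zero_of_notMem_tsupport fun h => hx (hχK h), zero_smul]
  · rw [norm_smul, mul_comm]; gcongr; exact hC' x
  · rw [gradient_eq_zero_of_notMem_tsupport fun h => hx (hχK h), smul_zero]

end cutoff_memLp

lemma IsLpLoc.integrableOn {N : ℕ} {F : Type*} [NormedAddCommGroup F] {Ω : Set (Pt N)}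
    {r : ℝ≥0∞} (hr : 1 ≤ r) {g : Pt N → F} (hg : IsLpLoc Ω r g) :
    ∀ K, IsCompact K → K ⊆ Ω → IntegrableOn g K := fun K hK hKΩ => by
  have : IsFiniteMeasure (volume.restrict K) := ⟨by simpa using hK.measure_lt_top⟩
  exact (hg K hK hKΩ).integrable hr

/-- Functions in `W^{1,p}_loc` belong to `L^{p^*}_loc`. -/
lemma IsLpLoc.sobolev {N : ℕ} {Ω : Set (Pt N)} (hΩ : IsOpen Ω) {p : ℝ} (hp : 1 < p)
    (hpN : p < N) {v : Pt N → ℝ} {Dv : Pt N → Pt N} (hv : IsLpLoc Ω (ENNReal.ofReal p) v)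
    (hDv : IsLpLoc Ω (ENNReal.ofReal p) Dv) (h : HasWeakGradient Ω v Dv) :
    ∀ K, IsCompact K → K ⊆ Ω → IntegrableOn (fun x => |v x| ^ sobolevExp N p) K := by
  intro K hK hKΩ
  obtain ⟨S, hS, hsob⟩ := exists_sobolev_integral_const hp hpN
  obtain ⟨χ, hχ, hχs, hχΩ, hχ1, hχI⟩ := exists_smooth_cutoff hΩ hK hKΩ
  have h1p : (1 : ℝ≥0∞) ≤ ENNReal.ofReal p := by
    rw [← ENNReal.ofReal_one]; exact ENNReal.ofReal_le_ofReal hp.le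
  have hw := h.mul_cutoff (hv.integrableOn h1p) (hDv.integrableOn h1p) hχ hχs hχΩ
  have hc := hχs.isCompact
  obtain ⟨h1, _⟩ := hsob _ _ hχs.mul_right
    (memLp_cutoff_mul hχ hc Subset.rfl (hv _ hc hχΩ))
    (memLp_cutoff_gradient hχ hc Subset.rfl (hv _ hc hχΩ) (hDv _ hc hχΩ)) hw
  refine (h1.integrableOn (s := K)).congr_fun (fun x hx => ?_) hK.measurableSet
  simp only [Pi.mul_apply, hχ1.self_of_nhdsSet x hx, one_mul]

/-! ### Hölder's inequality on subsets of a compact set -/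

section holder

variable {α : Type*} [MeasurableSpace α] {μ : Measure α} {A K : Set α}

lemma setIntegral_mul_rpow_le_of_add_le (hAK : A ⊆ K) (hK : μ K ≠ ⊤)
    {σ : ℝ≥0∞} (hσ : σ ≠ 0) {c F : α → ℝ} (hc : MemLp c σ (μ.restrict K))
    (hc0 : ∀ᵐ x ∂(μ.restrict K), 0 ≤ c x)
    (h₁ : IntegrableOn F A μ) (h₁' : ∀ x, 0 ≤ F x) {a d : ℝ} (ha : 0 ≤ a)
    (hd : 0 ≤ d) (hsum : (σ⁻¹).toReal + a + d = 1) :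
    IntegrableOn (fun x => c x * F x ^ a) A μ ∧
    ∫ x in A, c x * F x ^ a ∂μ
      ≤ (eLpNorm c σ (μ.restrict K)).toReal * (∫ x in A, F x ∂μ) ^ a * μ.real A ^ d := by
  simpa using setIntegral_mul_rpow_le (F₂ := fun _ => 0) (b := 0) hAK hK hσ hc hc0 h₁ h₁'
    integrableOn_zero (fun _ => le_rfl) ha le_rfl hd (by linarith)

lemma setIntegral_le_eLpNorm_mul (hAK : A ⊆ K) (hK : μ K ≠ ⊤)
    {σ : ℝ≥0∞} (hσ : σ ≠ 0) {c : α → ℝ} (hc : MemLp c σ (μ.restrict K))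
    (hc0 : ∀ᵐ x ∂(μ.restrict K), 0 ≤ c x) {d : ℝ}
    (hd : 0 ≤ d) (hsum : (σ⁻¹).toReal + d = 1) :
    IntegrableOn c A μ ∧
    ∫ x in A, c x ∂μ ≤ (eLpNorm c σ (μ.restrict K)).toReal * μ.real A ^ d := by
  simpa using setIntegral_mul_rpow_le_of_add_le (F := fun _ => 0) (a := 0) hAK hK hσ hc hc0
    integrableOn_zero (fun _ => le_rfl) le_rfl hd (by linarith)

lemma setIntegral_rpow_le (hA : μ A ≠ ⊤) {F : α → ℝ}
    (h₁ : IntegrableOn F A μ) (h₁' : ∀ x, 0 ≤ F x) {a : ℝ} (ha : 0 ≤ a) (ha1 : a ≤ 1) :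
    IntegrableOn (fun x => F x ^ a) A μ ∧
    ∫ x in A, F x ^ a ∂μ ≤ (∫ x in A, F x ∂μ) ^ a * μ.real A ^ (1 - a) := by
  have : IsFiniteMeasure (μ.restrict A) := ⟨by simpa using hA.lt_top⟩
  obtain ⟨h1, h2⟩ := setIntegral_mul_rpow_le_of_add_le (σ := ⊤) (c := fun _ => 1) (d := 1 - a)
    Subset.rfl hA ENNReal.top_ne_zero (memLp_const 1) (by simp) h₁ h₁' ha (by linarith) (by simp)
  simp only [one_mul] at h1 h2
  refine ⟨h1, h2.trans ?_⟩
  have hI : 0 ≤ ∫ x in A, F x ∂μ := integral_nonneg h₁'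
  have hle : (eLpNorm (fun _ : α => (1 : ℝ)) ⊤ (μ.restrict A)).toReal ≤ 1 := by
    refine ENNReal.toReal_le_of_le_ofReal zero_le_one ?_
    rw [eLpNorm_exponent_top, ENNReal.ofReal_one]
    exact eLpNormEssSup_le_of_ae_enorm_bound (by simp)
  calc _ ≤ 1 * (∫ x in A, F x ∂μ) ^ a * μ.real A ^ (1 - a) := by gcongr
    _ = _ := by rw [one_mul]

end holder

/-! ### Pointwise comparison of the integrands at `u` and at the competitor -/

section pointwise

variable {n N : ℕ}

lemma Real.rpow_le_one_add_rpow {x q p : ℝ} (hx : 0 ≤ x) (hq : 0 ≤ q) (hqp : q ≤ p) :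
    x ^ q ≤ 1 + x ^ p := by
  rcases le_total x 1 with h | h
  · linarith [Real.rpow_le_one hx h hq, Real.rpow_nonneg hx p]
  · linarith [Real.rpow_le_rpow_of_exponent_le h hqp]

/-- The new gradient is `(1 - z) X + z (-Z)`, so convexity of `|·|^p` applies inside the upper
growth bound. `Z` itself has no bound; only the product `z ‖Z‖^p` is controlled, by `Q`. The values
at both arguments are at most `(s - k) + |k|` in modulus. -/
lemma growth_sub_le {p γ L a b : ℝ} (hp : 1 ≤ p) (hγ : 0 ≤ γ) (hL : 0 ≤ L) (hb : 0 ≤ b)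
    {f : ℝ → Pt N → ℝ}
    (hf : ∀ (s : ℝ) (ξ : Pt N), ‖ξ‖ ^ p - b * |s| ^ γ - a ≤ f s ξ ∧
      f s ξ ≤ L * (‖ξ‖ ^ p + b * |s| ^ γ + a))
    {X Z : Pt N} {z s k Q : ℝ} (hz0 : 0 ≤ z) (hz1 : z ≤ 1) (hk : 0 ≤ s - k)
    (hQ : z * ‖Z‖ ^ p ≤ Q) :
    f (s + -(z * (s - k))) (X + -(z • X + z • Z)) - f s X
      ≤ L * (1 - z) * ‖X‖ ^ p - ‖X‖ ^ p + (L * Q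
        + (L + 1) * 2 ^ γ * (b * (s - k) ^ γ + b * |k| ^ γ) + (L + 1) * a) := by
  have h1 := (hf (s + -(z * (s - k))) (X + -(z • X + z • Z))).2
  have h2 := (hf s X).1
  have e : X + -(z • X + z • Z) = (1 - z) • X + z • (-Z) := by
    rw [sub_smul, one_smul, smul_neg]; abel
  have h3 := norm_convex_combination_rpow_le hp hz0 hz1 X (-Z)
  rw [← e, norm_neg] at h3
  have hw : |s| ≤ (s - k) + |k| := by
    calc |s| = |(s - k) + k| := by ring_nf
      _ ≤ |s - k| + |k| := abs_add_le _ _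
      _ = _ := by rw [abs_of_nonneg hk]
  have hw' : |s + -(z * (s - k))| ≤ (s - k) + |k| := by
    calc |s + -(z * (s - k))| = |(1 - z) * (s - k) + k| := by ring_nf
      _ ≤ |(1 - z) * (s - k)| + |k| := abs_add_le _ _
      _ ≤ _ := by
        rw [abs_of_nonneg (mul_nonneg (by linarith) hk)]
        nlinarith
  have h4 := Real.add_rpow_le_two_rpow_mul hk (abs_nonneg k) hγ
  have h5 : b * |s| ^ γ ≤ 2 ^ γ * (b * (s - k) ^ γ + b * |k| ^ γ) := by
    calc b * |s| ^ γ ≤ b * (2 ^ γ * ((s - k) ^ γ + |k| ^ γ)) := by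
          refine mul_le_mul_of_nonneg_left ((Real.rpow_le_rpow (abs_nonneg _) hw hγ).trans h4) hb
      _ = _ := by ring
  have h6 : b * |s + -(z * (s - k))| ^ γ ≤ 2 ^ γ * (b * (s - k) ^ γ + b * |k| ^ γ) := by
    calc b * |s + -(z * (s - k))| ^ γ ≤ b * (2 ^ γ * ((s - k) ^ γ + |k| ^ γ)) := by
          refine mul_le_mul_of_nonneg_left ((Real.rpow_le_rpow (abs_nonneg _) hw' hγ).trans h4) hb
      _ = _ := by ring
  have h7 : L * (‖X + -(z • X + z • Z)‖ ^ p + b * |s + -(z * (s - k))| ^ γ + a)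
      ≤ L * ((1 - z) * ‖X‖ ^ p + Q + 2 ^ γ * (b * (s - k) ^ γ + b * |k| ^ γ) + a) := by
    refine mul_le_mul_of_nonneg_left ?_ hL
    linarith
  linarith

lemma rank_single_row_le (D : Grad n N) (α : Fin n) (W : Pt N) :
    (Matrix.of fun (β : Fin n) (i : Fin N) =>
      (D + PiLp.single 2 α W : Grad n N) β i - D β i).rank ≤ 1 := by
  have : (Matrix.of fun (β : Fin n) (i : Fin N) =>
      (D + PiLp.single 2 α W : Grad n N) β i - D β i)
      = Matrix.vecMulVec (Pi.single α (1 : ℝ)) (fun i => W i) := by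
    ext β i
    simp only [Matrix.of_apply, Matrix.vecMulVec_apply, PiLp.add_apply, add_sub_cancel_left]
    by_cases h : β = α
    · subst h; simp
    · simp [h]
  rw [this]
  exact Matrix.rank_vecMulVec_le _ _

/-- The competitor's gradient is `z ξ + (1 - z) D`, where `ξ` differs from `D` in one row, so
rank-one convexity bounds the increment by `z (G u' ξ - G u D) + (1 - z)(G u' D - G u D)`. In the
second bracket only the value variable changes, which is the Hölder condition; the first bracket
involves only the `q`-growth. -/
lemma rankOneConvex_sub_le {p q δ β C a c : ℝ} (hq : 0 ≤ q) (hqp : q ≤ p) (hC : 0 ≤ C)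
    (hβ : 0 ≤ β) (ha : 0 ≤ a) (hc : 0 ≤ c) {G : Val n → Grad n N → ℝ}
    (hG : ∀ (v : Val n) (ξ : Grad n N), |G v ξ| ≤ C * (‖ξ‖ ^ q + ‖v‖ ^ q + a))
    (hconv : ∀ (v : Val n) (t : ℝ) (ξ₁ ξ₂ : Grad n N), 0 ≤ t → t ≤ 1 →
      (Matrix.of fun (α : Fin n) (i : Fin N) => ξ₁ α i - ξ₂ α i).rank ≤ 1 →
      G v (t • ξ₁ + (1 - t) • ξ₂) ≤ t * G v ξ₁ + (1 - t) * G v ξ₂)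
    (hhol : ∀ (v w : Val n) (ξ : Grad n N), |G v ξ - G w ξ| ≤ c * ‖ξ‖ ^ δ * ‖v - w‖ ^ β)
    {u : Val n} {D : Grad n N} {α : Fin n} {Z : Pt N} {z k Q : ℝ}
    (hz0 : 0 ≤ z) (hz1 : z ≤ 1) (hk : 0 ≤ u α - k) (hQ : z * ‖Z‖ ^ p ≤ Q) :
    G (u + PiLp.single 2 α (-(z * (u α - k))))
        (D + PiLp.single 2 α (-(z • D α + z • Z))) - G u D
      ≤ c * ‖D‖ ^ δ * (u α - k) ^ β + C * (2 ^ q * 2 ^ q * 2 + 2)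
          * (‖D‖ ^ q + ‖u‖ ^ q + Q + (1 + |k| ^ p) + a) := by
  set u' : Val n := u + PiLp.single 2 α (-(z * (u α - k))) with hu'
  set ξ : Grad n N := D + PiLp.single 2 α (-(D α + Z)) with hξ
  have e : D + PiLp.single 2 α (-(z • D α + z • Z)) = z • ξ + (1 - z) • D := by
    rw [hξ, ← smul_add, ← smul_neg, PiLp.single, Pi.single_smul, WithLp.toLp_smul, smul_add,
      sub_smul, one_smul, PiLp.single]
    abel
  have h1 := hconv u' z ξ D hz0 hz1 (rank_single_row_le D α _)
  rw [← e] at h1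
  have hφ : ‖u' - u‖ = z * (u α - k) := by
    rw [hu', add_sub_cancel_left, PiLp.norm_single, norm_neg,
      Real.norm_of_nonneg (mul_nonneg hz0 hk)]
  have hφle : z * (u α - k) ≤ u α - k := mul_le_of_le_one_left hk hz1
  have h2 : G u' D - G u D ≤ c * ‖D‖ ^ δ * (u α - k) ^ β := by
    refine (le_abs_self _).trans ((hhol u' u D).trans ?_)
    rw [hφ]
    have := mul_nonneg hz0 hk
    gcongr
  have h2' : (1 - z) * (G u' D - G u D) ≤ c * ‖D‖ ^ δ * (u α - k) ^ β := by
    have h0 : 0 ≤ c * ‖D‖ ^ δ * (u α - k) ^ β := by positivity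
    nlinarith
  have hu2 : ‖u'‖ ≤ 2 * ‖u‖ + |k| := by
    have h3 : ‖u'‖ ≤ ‖u‖ + ‖u' - u‖ := by
      simpa using norm_add_le u (u' - u)
    have h4 : |u α| ≤ ‖u‖ := by simpa using PiLp.norm_apply_le u α
    have := le_abs_self (u α)
    have := neg_abs_le k
    linarith
  have hξ2 : ‖ξ‖ ≤ 2 * ‖D‖ + ‖Z‖ := by
    have h3 : ‖ξ‖ ≤ ‖D‖ + ‖D α + Z‖ := by
      refine (norm_add_le _ _).trans ?_
      rw [PiLp.norm_single, norm_neg]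
    have h4 := norm_add_le (D α) Z
    have h5 := PiLp.norm_apply_le D α
    linarith
  have h2q : (1 : ℝ) ≤ 2 ^ q := Real.one_le_rpow (by norm_num) hq
  have hp : 0 ≤ p := hq.trans hqp
  have hu3 : ‖u'‖ ^ q ≤ 2 ^ q * (2 ^ q * ‖u‖ ^ q + (1 + |k| ^ p)) := by
    refine (Real.rpow_le_rpow (norm_nonneg _) hu2 hq).trans ?_
    refine (Real.add_rpow_le_two_rpow_mul (by positivity) (abs_nonneg k) hq).trans ?_
    rw [Real.mul_rpow (by norm_num) (norm_nonneg _)]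
    gcongr
    exact Real.rpow_le_one_add_rpow (abs_nonneg k) hq hqp
  have hξ3 : ‖ξ‖ ^ q ≤ 2 ^ q * (2 ^ q * ‖D‖ ^ q + (1 + ‖Z‖ ^ p)) := by
    refine (Real.rpow_le_rpow (norm_nonneg _) hξ2 hq).trans ?_
    refine (Real.add_rpow_le_two_rpow_mul (by positivity) (norm_nonneg Z) hq).trans ?_
    rw [Real.mul_rpow (by norm_num) (norm_nonneg _)]
    gcongr
    exact Real.rpow_le_one_add_rpow (norm_nonneg Z) hq hqp
  -- The factor `z` must be kept: `ξ` contains `Z`, which is controlled only through `z ‖Z‖^p ≤ Q`.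
  have h5 : z * ‖ξ‖ ^ q ≤ 2 ^ q * (2 ^ q * ‖D‖ ^ q + (1 + Q)) := by
    have e1 : 0 ≤ 2 ^ q * ‖D‖ ^ q + 1 := by positivity
    calc z * ‖ξ‖ ^ q ≤ z * (2 ^ q * (2 ^ q * ‖D‖ ^ q + (1 + ‖Z‖ ^ p))) := by gcongr
      _ = 2 ^ q * (z * (2 ^ q * ‖D‖ ^ q + 1) + z * ‖Z‖ ^ p) := by ring
      _ ≤ 2 ^ q * (1 * (2 ^ q * ‖D‖ ^ q + 1) + Q) := by gcongr
      _ = _ := by ring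
  have h6 : z * (G u' ξ - G u D) ≤ C * (2 ^ q * (2 ^ q * ‖D‖ ^ q + (1 + Q))
      + 2 ^ q * (2 ^ q * ‖u‖ ^ q + (1 + |k| ^ p)) + ‖D‖ ^ q + ‖u‖ ^ q + 2 * a) := by
    have g1 := (le_abs_self _).trans (hG u' ξ)
    have g2 := (neg_le_abs _).trans (hG u D)
    have e0 : 0 ≤ ‖D‖ ^ q + ‖u‖ ^ q + 2 * a + ‖u'‖ ^ q := by positivity
    calc z * (G u' ξ - G u D)
        ≤ z * (C * (‖ξ‖ ^ q + ‖u'‖ ^ q + a) + C * (‖D‖ ^ q + ‖u‖ ^ q + a)) := by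
          refine mul_le_mul_of_nonneg_left ?_ hz0
          linarith
      _ = C * (z * ‖ξ‖ ^ q + z * (‖D‖ ^ q + ‖u‖ ^ q + 2 * a + ‖u'‖ ^ q)) := by ring
      _ ≤ C * (2 ^ q * (2 ^ q * ‖D‖ ^ q + (1 + Q))
            + 1 * (‖D‖ ^ q + ‖u‖ ^ q + 2 * a + ‖u'‖ ^ q)) := by gcongr
      _ ≤ _ := by
        refine mul_le_mul_of_nonneg_left ?_ hC
        linarith
  have hQ0 : 0 ≤ Q := (by positivity : 0 ≤ z * ‖Z‖ ^ p).trans hQ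
  have h7 : 2 ^ q * (2 ^ q * ‖D‖ ^ q + (1 + Q))
      + 2 ^ q * (2 ^ q * ‖u‖ ^ q + (1 + |k| ^ p)) + ‖D‖ ^ q + ‖u‖ ^ q + 2 * a
      ≤ (2 ^ q * 2 ^ q * 2 + 2) * (‖D‖ ^ q + ‖u‖ ^ q + Q + (1 + |k| ^ p) + a) := by
    have d1 : 0 ≤ ‖D‖ ^ q := by positivity
    have d2 : 0 ≤ ‖u‖ ^ q := by positivity
    have d3 : 0 ≤ |k| ^ p := by positivity
    set A := (2 : ℝ) ^ q
    have a1 : A ≤ A * A := by nlinarith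
    have a2 : 0 ≤ A * A := by positivity
    nlinarith [mul_nonneg a2 d1, mul_nonneg a2 d2, mul_nonneg a2 d3, mul_nonneg a2 hQ0,
      mul_nonneg a2 ha, mul_nonneg (sub_nonneg.2 a1) hQ0, mul_nonneg (sub_nonneg.2 a1) d3]
  have h8 := mul_le_mul_of_nonneg_left h7 hC
  rw [← mul_assoc] at h8
  have : G u' (D + PiLp.single 2 α (-(z • D α + z • Z))) - G u D
      ≤ (1 - z) * (G u' D - G u D) + z * (G u' ξ - G u D) := by linarith
  linarith

end pointwise

/-! ### Exponents, lower order terms and integrability of the energy density -/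

section integrability

variable {n N : ℕ} {Ω K : Set (Pt N)} {p ε : ℝ}

lemma kappaExp_pos (hp : 1 < p) (hpN : p < N) (hεN : ε < p / N) : 0 < kappaExp N p ε := by
  have hN : (0 : ℝ) < N := by linarith
  have : 0 < p - ε * N := by rw [lt_div_iff₀ hN] at hεN; linarith
  unfold kappaExp; positivity

lemma inv_kappaExp (hp : 1 < p) (hpN : p < N) : (kappaExp N p ε)⁻¹ = p / N - ε := by
  have hN : (N : ℝ) ≠ 0 := by linarith
  unfold kappaExp
  rw [inv_div]; field_simp

lemma GrowthF.sigmaExp_pos {γ L : ℝ} {a b : Pt N → ℝ} {f : Pt N → ℝ → Pt N → ℝ}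
    (hp : 1 < p) (hpN : p < N) (h : GrowthF Ω p ε γ L a b f) : 0 < sigmaExp N p ε γ := by
  have h1 := h.γ_add_lt
  have h2 := sobolevExp_pos hp hpN
  have : 0 < sobolevExp N p - γ - ε * sobolevExp N p := by linarith
  unfold sigmaExp; positivity

lemma inv_sigmaExp {γ : ℝ} (hp : 1 < p) (hpN : p < N) :
    (sigmaExp N p ε γ)⁻¹ = 1 - γ / sobolevExp N p - ε := by
  have h2 := (sobolevExp_pos hp hpN).ne'
  unfold sigmaExp
  rw [inv_div]; field_simp

variable {A : Set (Pt N)}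

/-- Bounds for the coefficient `a ∈ L^κ`. -/
lemma setIntegral_le_of_memLp_kappa (hp : 1 < p) (hpN : p < N) (hε : 0 < ε) (hεN : ε < p / N)
    (hK : IsCompact K) (hAK : A ⊆ K) {a : Pt N → ℝ}
    (ha : MemLp a (ENNReal.ofReal (kappaExp N p ε)) (volume.restrict K))
    (ha0 : ∀ᵐ x ∂(volume.restrict K), 0 ≤ a x) :
    IntegrableOn a A ∧ ∫ x in A, a x
      ≤ (eLpNorm a (ENNReal.ofReal (kappaExp N p ε)) (volume.restrict K)).toReal
        * volume.real A ^ (1 - p / N + ε) := by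
  have hκ := kappaExp_pos hp hpN hεN
  have hN : (0 : ℝ) < N := by linarith
  have : p / N < 1 := by rwa [div_lt_one hN]
  refine setIntegral_le_eLpNorm_mul hAK hK.measure_lt_top.ne (by simpa using hκ) ha ha0
    (by linarith) ?_
  rw [toReal_inv_ofReal hκ, inv_kappaExp hp hpN]; ring

/-- Bounds for the coefficient `b ∈ L^σ`. -/
lemma GrowthF.setIntegral_b_le {γ L : ℝ} {a b : Pt N → ℝ} {f : Pt N → ℝ → Pt N → ℝ}
    (hp : 1 < p) (hpN : p < N) (hε : 0 < ε) (h : GrowthF Ω p ε γ L a b f)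
    (hK : IsCompact K) (hKΩ : K ⊆ Ω) (hAK : A ⊆ K) :
    IntegrableOn b A ∧ ∫ x in A, b x
      ≤ (eLpNorm b (ENNReal.ofReal (sigmaExp N p ε γ)) (volume.restrict K)).toReal
        * volume.real A ^ (γ / sobolevExp N p + ε) := by
  have hs := h.sigmaExp_pos hp hpN
  have hP := sobolevExp_pos hp hpN
  have hγ : 0 < γ := by linarith [h.p_le_γ]
  refine setIntegral_le_eLpNorm_mul hAK hK.measure_lt_top.ne (by simpa using hs)
    (h.b_memLp K hK hKΩ) (ae_mono (Measure.restrict_mono hKΩ le_rfl) h.b_nonneg)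
    (by positivity) ?_
  rw [toReal_inv_ofReal hs, inv_sigmaExp hp hpN]; ring

/-- Since `1/σ + γ/p^* = 1 - ε`, Hölder's inequality leaves the factor `|A|^ε`; its smallness on
small balls is what later allows the absorption of this term. -/
lemma GrowthF.setIntegral_b_mul_rpow_le {γ L : ℝ} {a b : Pt N → ℝ} {f : Pt N → ℝ → Pt N → ℝ}
    (hp : 1 < p) (hpN : p < N) (hε : 0 < ε) (h : GrowthF Ω p ε γ L a b f)
    (hK : IsCompact K) (hKΩ : K ⊆ Ω) (hAK : A ⊆ K) {v : Pt N → ℝ}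
    (hv : IntegrableOn (fun x => |v x| ^ sobolevExp N p) A) :
    IntegrableOn (fun x => b x * |v x| ^ γ) A ∧ ∫ x in A, b x * |v x| ^ γ
      ≤ (eLpNorm b (ENNReal.ofReal (sigmaExp N p ε γ)) (volume.restrict K)).toReal
        * (∫ x in A, |v x| ^ sobolevExp N p) ^ (γ / sobolevExp N p) * volume.real A ^ ε := by
  have hs := h.sigmaExp_pos hp hpN
  have hP := sobolevExp_pos hp hpN
  have hγ : 0 < γ := by linarith [h.p_le_γ]
  have key := setIntegral_mul_rpow_le_of_add_le (a := γ / sobolevExp N p) (d := ε) hAK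
    hK.measure_lt_top.ne (σ := ENNReal.ofReal (sigmaExp N p ε γ)) (by simpa using hs)
    (h.b_memLp K hK hKΩ) (ae_mono (Measure.restrict_mono hKΩ le_rfl) h.b_nonneg) hv
    (fun x => by positivity)
    (by positivity) hε.le (by rw [toReal_inv_ofReal hs, inv_sigmaExp hp hpN]; ring)
  have e : ∀ x, (|v x| ^ sobolevExp N p) ^ (γ / sobolevExp N p) = |v x| ^ γ := fun x => by
    rw [← Real.rpow_mul (abs_nonneg _), mul_div_cancel₀ _ hP.ne']
  simpa only [e] using key

/-- Powers below `p` of an `L^p` function. -/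
lemma setIntegral_norm_rpow_le {E : Type*} [NormedAddCommGroup E] {g : Pt N → E} {q : ℝ}
    (hp : 0 < p) (hq : 0 ≤ q) (hqp : q ≤ p) (hA : volume A ≠ ⊤)
    (hg : IntegrableOn (fun x => ‖g x‖ ^ p) A) :
    IntegrableOn (fun x => ‖g x‖ ^ q) A ∧ ∫ x in A, ‖g x‖ ^ q
      ≤ (∫ x in A, ‖g x‖ ^ p) ^ (q / p) * volume.real A ^ (1 - q / p) := by
  have key := setIntegral_rpow_le (a := q / p) hA hg (fun x => by positivity) (by positivity)
    (by rwa [div_le_one hp])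
  have e : ∀ x, (‖g x‖ ^ p) ^ (q / p) = ‖g x‖ ^ q := fun x => by
    rw [← Real.rpow_mul (norm_nonneg _), mul_div_cancel₀ _ hp.ne']
  simpa only [e] using key

lemma MeasureTheory.MemLp.integrable_norm_ofReal_rpow {α E : Type*} [MeasurableSpace α]
    [NormedAddCommGroup E] {μ : Measure α} {g : α → E} (hp : 0 < p)
    (hg : MemLp g (ENNReal.ofReal p) μ) : Integrable (fun x => ‖g x‖ ^ p) μ := by
  have := hg.integrable_norm_rpow (by simpa using hp) ENNReal.ofReal_ne_top
  rwa [ENNReal.toReal_ofReal hp.le] at this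

lemma MeasureTheory.MemLp.piLp_apply {α ι : Type*} [Fintype ι] [MeasurableSpace α]
    {E : ι → Type*} [∀ i, NormedAddCommGroup (E i)] {μ : Measure α} {r : ℝ≥0∞}
    {g : α → PiLp 2 E} (hg : MemLp g r μ) (i : ι) : MemLp (fun x => g x i) r μ :=
  hg.of_le ((PiLp.continuous_apply 2 E i).comp_aestronglyMeasurable hg.1)
    (Eventually.of_forall fun x => PiLp.norm_apply_le (g x) i)

/-- The energy density of a function with the natural integrability is integrable on compact
sets. -/
lemma integrableOn_energy_density {q C : ℝ} {γ L : Fin n → ℝ}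
    {f : Fin n → Pt N → ℝ → Pt N → ℝ} {G : Pt N → Val n → Grad n N → ℝ}
    {a b : Fin n → Pt N → ℝ} {a₀ : Pt N → ℝ}
    (hp : 1 < p) (hpN : p < N) (hε : 0 < ε) (hεN : ε < p / N) (hqp : q ≤ p)
    (h1 : ∀ α : Fin n, GrowthF Ω p ε (γ α) (L α) (a α) (b α) (f α))
    (h2 : GrowthG Ω p ε q C a₀ G) (hK : IsCompact K) (hKΩ : K ⊆ Ω)
    {y : Pt N → Val n} {Dy : Pt N → Grad n N}
    (hy : MemLp y (ENNReal.ofReal p) (volume.restrict K))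
    (hyP : ∀ β, IntegrableOn (fun x => |y x β| ^ sobolevExp N p) K)
    (hDy : MemLp Dy (ENNReal.ofReal p) (volume.restrict K)) :
    IntegrableOn (fun x => (∑ α : Fin n, f α x (y x α) (Dy x α)) + G x (y x) (Dy x)) K := by
  have hp0 : 0 < p := by linarith
  have hmono : volume.restrict K ≤ volume.restrict Ω := Measure.restrict_mono hKΩ le_rfl
  refine Integrable.add (integrable_finsetSum _ fun α _ => ?_) ?_
  · have hm : AEMeasurable (fun x => f α x (y x α) (Dy x α)) (volume.restrict K) :=
      (h1 α).caratheodory.aemeasurable_comp hKΩ (y := fun x => (y x α, Dy x α))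
        ((hy.piLp_apply α).1.prodMk (hDy.piLp_apply α).1)
    have i1 := (hDy.piLp_apply α).integrable_norm_ofReal_rpow hp0
    have i2 := ((h1 α).setIntegral_b_mul_rpow_le hp hpN hε hK hKΩ Subset.rfl (hyP α)).1
    have i3 := (setIntegral_le_of_memLp_kappa hp hpN hε hεN hK Subset.rfl
      ((h1 α).a_memLp K hK hKΩ) (ae_mono hmono (h1 α).a_nonneg)).1
    refine Integrable.mono' (((i1.add i2).add i3).const_mul (L α)) hm.aestronglyMeasurable ?_
    filter_upwards [ae_mono hmono (h1 α).growth, ae_mono hmono (h1 α).a_nonneg,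
      ae_mono hmono (h1 α).b_nonneg] with x hx ha hb
    obtain ⟨g1, g2⟩ := hx (y x α) (Dy x α)
    have hL := (h1 α).one_lt_L
    have e1 : 0 ≤ ‖Dy x α‖ ^ p := by positivity
    have e2 : 0 ≤ b α x * |y x α| ^ γ α := by positivity
    rw [Real.norm_eq_abs, abs_le]
    simp only [Pi.add_apply]
    refine ⟨?_, g2⟩
    nlinarith
  · have hm : AEMeasurable (fun x => G x (y x) (Dy x)) (volume.restrict K) :=
      h2.caratheodory.aemeasurable_comp hKΩ (y := fun x => (y x, Dy x)) (hy.1.prodMk hDy.1)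
    have hq0 : 0 ≤ q := by linarith [h2.one_le_q]
    have i1 := (setIntegral_norm_rpow_le hp0 hq0 hqp hK.measure_lt_top.ne
      (hDy.integrable_norm_ofReal_rpow hp0)).1
    have i2 := (setIntegral_norm_rpow_le hp0 hq0 hqp hK.measure_lt_top.ne
      (hy.integrable_norm_ofReal_rpow hp0)).1
    have i3 := (setIntegral_le_of_memLp_kappa hp hpN hε hεN hK Subset.rfl
      (h2.a_memLp K hK hKΩ) (ae_mono hmono h2.a_nonneg)).1
    refine Integrable.mono' (((i1.add i2).add i3).const_mul C) hm.aestronglyMeasurable ?_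
    filter_upwards [ae_mono hmono h2.growth] with x hx
    exact hx (y x) (Dy x)

end integrability

lemma integral_add_add {α : Type*} [MeasurableSpace α] {μ : Measure α} {f g h : α → ℝ}
    (hf : Integrable f μ) (hg : Integrable g μ) (hh : Integrable h μ) :
    Integrable (fun x => f x + g x + h x) μ ∧
      ∫ x, (f x + g x + h x) ∂μ = ∫ x, f x ∂μ + ∫ x, g x ∂μ + ∫ x, h x ∂μ := by
  have h1 : Integrable (fun x => f x + g x) μ := hf.add hg
  exact ⟨h1.add hh, by rw [integral_add h1 hh, integral_add hf hg]⟩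

/-! ### Locality of weak gradients, superlevel sets, one-component perturbations -/

section

variable {N : ℕ} {Ω : Set (Pt N)} {v : Pt N → ℝ} {Dv : Pt N → Pt N}

lemma HasWeakGradient.of_univ (h : HasWeakGradient univ v Dv) (Ω : Set (Pt N)) :
    HasWeakGradient Ω v Dv := by
  intro ψ hψ hψs hψΩ i
  have := h ψ hψ hψs (subset_univ _) i
  simp only [Measure.restrict_univ] at this
  rw [setIntegral_eq_integral_of_forall_compl_eq_zero, this,
    setIntegral_eq_integral_of_forall_compl_eq_zero]
  · intro x hx
    rw [image_eq_zero_of_notMem_tsupport fun h => hx (hψΩ h), mul_zero]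
  · intro x hx
    rw [image_eq_zero_of_notMem_tsupport (f := fun x => fderiv ℝ ψ x (EuclideanSpace.single i 1))
      fun h => hx (hψΩ (tsupport_fderiv_apply_subset ℝ _ h)), mul_zero]

lemma HasWeakGradient.neg (h : HasWeakGradient Ω v Dv) :
    HasWeakGradient Ω (fun x => -v x) (fun x => -Dv x) := by
  intro ψ hψ hψs hψΩ i
  have := h ψ hψ hψs hψΩ i
  simp only [PiLp.neg_apply, neg_mul, integral_neg]
  rw [this]

lemma HasWeakGradient.zero : HasWeakGradient Ω (fun _ => 0) (fun _ => 0) := by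
  intro ψ _ _ _ i
  simp

/-- A function that is only a.e. measurable has superlevel sets that agree with measurable ones up
to null sets; set integrals over them are therefore treated with null measurability. -/
lemma nullMeasurableSet_superSet {K : Set (Pt N)} (hK : MeasurableSet K)
    (hv : AEMeasurable v (volume.restrict K)) {k : ℝ} {x₀ : Pt N} {s : ℝ}
    (hs : Metric.ball x₀ s ⊆ K) : NullMeasurableSet (superSet v k x₀ s) volume := by
  have h1 : MeasurableSet ({x | k < hv.mk v x} ∩ Metric.ball x₀ s) :=
    (measurableSet_lt measurable_const hv.measurable_mk).inter measurableSet_ball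
  refine NullMeasurableSet.congr h1.nullMeasurableSet ?_
  have h2 := (ae_restrict_iff' hK).1 hv.ae_eq_mk
  filter_upwards [h2] with x hx
  refine propext ⟨fun h => ⟨?_, h.2⟩, fun h => ⟨?_, h.2⟩⟩
  · have h3 : k < hv.mk v x := h.1
    rw [← hx (hs h.2)] at h3
    exact h3
  · have h3 : k < v x := h.1
    rw [hx (hs h.2)] at h3
    exact h3

lemma superSet_mono {k : ℝ} {x₀ : Pt N} {s t : ℝ} (h : s ≤ t) :
    superSet v k x₀ s ⊆ superSet v k x₀ t :=
  inter_subset_inter_right _ (Metric.ball_subset_ball h)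

lemma superSet_subset_ball {k : ℝ} {x₀ : Pt N} {s : ℝ} :
    superSet v k x₀ s ⊆ Metric.ball x₀ s := inter_subset_right

end

lemma isSobolev_single {n N : ℕ} {Ω : Set (Pt N)} {p : ℝ} {w : Pt N → ℝ} {Dw : Pt N → Pt N}
    (hw : MemLp w (ENNReal.ofReal p) volume) (hDw : MemLp Dw (ENNReal.ofReal p) volume)
    (h : HasWeakGradient univ w Dw) (α : Fin n) :
    IsSobolev Ω p (fun x => (PiLp.single 2 α (-w x) : Val n))
      (fun x => (PiLp.single 2 α (-Dw x) : Grad n N)) where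
  memLp := by
    refine (hw.mono_measure Measure.restrict_le_self).of_le ?_
      (Eventually.of_forall fun x => by rw [PiLp.norm_single, norm_neg])
    have : Continuous fun r : ℝ => (PiLp.single 2 α (-r) : Val n) :=
      (PiLp.continuous_toLp 2 _).comp ((continuous_single α).comp continuous_neg)
    exact this.comp_aestronglyMeasurable (hw.1.mono_measure Measure.restrict_le_self)
  memLp_grad := by
    refine (hDw.mono_measure Measure.restrict_le_self).of_le ?_
      (Eventually.of_forall fun x => by rw [PiLp.norm_single, norm_neg])
    have : Continuous fun r : Pt N => (PiLp.single 2 α (-r) : Grad n N) :=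
      (PiLp.continuous_toLp 2 _).comp ((continuous_single α).comp continuous_neg)
    exact this.comp_aestronglyMeasurable (hDw.1.mono_measure Measure.restrict_le_self)
  weakGradient := fun β => by
    by_cases hβ : β = α
    · subst hβ
      simpa only [PiLp.single_eq_same] using (h.of_univ Ω).neg
    · have e1 : ∀ x, (PiLp.single 2 α (-w x) : Val n) β = 0 := fun x =>
        PiLp.single_eq_of_ne 2 hβ _
      have e2 : ∀ x, (PiLp.single 2 α (-Dw x) : Grad n N) β = 0 := fun x =>
        PiLp.single_eq_of_ne 2 hβ _
      simp only [e1, e2]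
      exact HasWeakGradient.zero

/-! ### Truncations `(v - k)⁺` and their cutoffs -/

section step

variable {n N : ℕ} {Ω K : Set (Pt N)} {p : ℝ} {v : Pt N → ℝ} {Dv : Pt N → Pt N}

lemma memLp_posPart_sub (hK : volume K ≠ ⊤) {r : ℝ≥0∞} (hv : MemLp v r (volume.restrict K))
    (k : ℝ) : MemLp (fun x => max (v x - k) 0) r (volume.restrict K) := by
  have : IsFiniteMeasure (volume.restrict K) := ⟨by simpa using hK.lt_top⟩
  have h1 : MemLp (fun x => v x - k) r (volume.restrict K) := hv.sub (memLp_const k)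
  refine h1.of_le ?_ (Eventually.of_forall fun x => ?_)
  · exact (continuous_id.max continuous_const).comp_aestronglyMeasurable h1.1
  · rw [Real.norm_eq_abs, Real.norm_eq_abs, abs_of_nonneg (le_max_right _ _)]
    exact max_le (le_abs_self _) (abs_nonneg _)

lemma memLp_indicator_superlevel {r : ℝ≥0∞} (hv : AEMeasurable v (volume.restrict K))
    (hDv : MemLp Dv r (volume.restrict K)) (k : ℝ) :
    MemLp ({x | k < v x}.indicator Dv) r (volume.restrict K) :=
  hDv.of_le (hDv.1.indicator₀ (nullMeasurableSet_lt aemeasurable_const hv))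
    (Eventually.of_forall fun _ => norm_indicator_le_norm_self _ _)

/-- A cutoff of `(v - k)⁺` belongs to `W^{1,p}(ℝ^N)`. -/
lemma cutoff_posPart_sobolev (hΩ : IsOpen Ω) (hp : 1 < p)
    (hv : IsLpLoc Ω (ENNReal.ofReal p) v) (hDv : IsLpLoc Ω (ENNReal.ofReal p) Dv)
    (h : HasWeakGradient Ω v Dv) (k : ℝ) {ζ : Pt N → ℝ} (hζ : ContDiff ℝ ∞ ζ)
    (hζs : HasCompactSupport ζ) (hζΩ : tsupport ζ ⊆ Ω) :
    MemLp (fun x => ζ x * max (v x - k) 0) (ENNReal.ofReal p) volume ∧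
    MemLp (fun x => ζ x • {x | k < v x}.indicator Dv x + max (v x - k) 0 • gradient ζ x)
      (ENNReal.ofReal p) volume ∧
    HasWeakGradient univ (fun x => ζ x * max (v x - k) 0)
      (fun x => ζ x • {x | k < v x}.indicator Dv x + max (v x - k) 0 • gradient ζ x) := by
  have h1p : (1 : ℝ≥0∞) ≤ ENNReal.ofReal p := by
    rw [← ENNReal.ofReal_one]; exact ENNReal.ofReal_le_ofReal hp.le
  have hw : IsLpLoc Ω (ENNReal.ofReal p) fun x => max (v x - k) 0 := fun K hK hKΩ =>
    memLp_posPart_sub hK.measure_lt_top.ne (hv K hK hKΩ) k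
  have hDw : IsLpLoc Ω (ENNReal.ofReal p) ({x | k < v x}.indicator Dv) := fun K hK hKΩ =>
    memLp_indicator_superlevel (hv K hK hKΩ).1.aemeasurable (hDv K hK hKΩ) k
  have hc := hζs.isCompact
  refine ⟨memLp_cutoff_mul hζ hc Subset.rfl (hw _ hc hζΩ),
    memLp_cutoff_gradient hζ hc Subset.rfl (hw _ hc hζΩ) (hDw _ hc hζΩ), ?_⟩
  exact (h.posPart_sub_const hΩ (hv.integrableOn h1p) (hDv.integrableOn h1p) k).mul_cutoff
    (hw.integrableOn h1p) (hDw.integrableOn h1p) hζ hζs hζΩ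

lemma integrableOn_abs_sub_rpow {A : Set (Pt N)} (hA : volume A ≠ ⊤) {r : ℝ} (hr : 0 ≤ r)
    (hvm : AEMeasurable v (volume.restrict A)) (hv : IntegrableOn (fun x => |v x| ^ r) A) (k : ℝ) :
    IntegrableOn (fun x => |v x - k| ^ r) A ∧
      ∫ x in A, |v x - k| ^ r ≤ 2 ^ r * ((∫ x in A, |v x| ^ r) + |k| ^ r * volume.real A) := by
  have : IsFiniteMeasure (volume.restrict A) := ⟨by simpa using hA.lt_top⟩
  have i1 : IntegrableOn (fun x => 2 ^ r * (|v x| ^ r + |k| ^ r)) A :=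
    (Integrable.add hv (integrable_const _)).const_mul _
  have hle : ∀ x, |v x - k| ^ r ≤ 2 ^ r * (|v x| ^ r + |k| ^ r) := fun x =>
    (Real.rpow_le_rpow (abs_nonneg _) (abs_sub _ _) hr).trans
      (Real.add_rpow_le_two_rpow_mul (abs_nonneg _) (abs_nonneg _) hr)
  have hm : AEStronglyMeasurable (fun x => |v x - k| ^ r) (volume.restrict A) :=
    ((hvm.sub_const k).abs.pow_const r).aestronglyMeasurable
  have i2 : IntegrableOn (fun x => |v x - k| ^ r) A := by
    refine Integrable.mono' i1 hm (Eventually.of_forall fun x => ?_)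
    rw [Real.norm_of_nonneg (by positivity)]
    exact hle x
  refine ⟨i2, (integral_mono i2 i1 hle).trans_eq ?_⟩
  rw [integral_const_mul, integral_add hv (integrable_const _)]
  simp [mul_comm, Measure.real]

end step

lemma GrowthG.q_lt_p {n N : ℕ} {Ω : Set (Pt N)} {p ε q C : ℝ} {a₀ : Pt N → ℝ}
    {G : Pt N → Val n → Grad n N → ℝ} (hp : 1 < p) (hpN : p < N) (h : GrowthG Ω p ε q C a₀ G) :
    q < p := by
  have hN : (0 : ℝ) < N := by linarith
  refine h.q_lt.trans_le ?_
  rw [div_le_iff₀ hN]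
  nlinarith

lemma HolderG.exponent_sum_lt {n N : ℕ} {Ω : Set (Pt N)} {p q δ β : ℝ} {σ : ℝ≥0∞}
    {c : Pt N → ℝ} {G : Pt N → Val n → Grad n N → ℝ} (hpN : p < N) (hp : 1 < p)
    (h : HolderG Ω p q δ β σ c G) :
    (σ⁻¹).toReal + δ / p + β / sobolevExp N p < 1 := by
  have hN : (0 : ℝ) < N := by linarith
  have : p / N < 1 := by rwa [div_lt_one hN]
  linarith [h.exponents]

/-! ### The term from the Hölder condition on `G` -/

section holderTerm

variable {n N : ℕ} {Ω K A : Set (Pt N)} {p q δ β : ℝ} {σ : ℝ≥0∞} {c : Pt N → ℝ}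
  {G : Pt N → Val n → Grad n N → ℝ} {Du : Pt N → Grad n N} {v : Pt N → ℝ}

/-- Three-factor Hölder with weights `1/σ`, `δ/p`, `β/p^*`. The power of `|A|` left over is at least
`1 - p/N + ε_*`, by the third entry of the minimum defining `ε_*`. -/
lemma HolderG.setIntegral_le (hp : 1 < p) (hpN : p < N) (h : HolderG Ω p q δ β σ c G)
    (hK : IsCompact K) (hKΩ : K ⊆ Ω) (hAK : A ⊆ K)
    (hD : IntegrableOn (fun x => ‖Du x‖ ^ p) A)
    (hv : IntegrableOn (fun x => |v x| ^ sobolevExp N p) A) :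
    IntegrableOn (fun x => c x * ‖Du x‖ ^ δ * |v x| ^ β) A ∧
    ∫ x in A, c x * ‖Du x‖ ^ δ * |v x| ^ β
      ≤ (eLpNorm c σ (volume.restrict K)).toReal * (∫ x in A, ‖Du x‖ ^ p) ^ (δ / p)
        * (∫ x in A, |v x| ^ sobolevExp N p) ^ (β / sobolevExp N p)
        * volume.real A ^ (1 - (δ / p + β / sobolevExp N p + (σ⁻¹).toReal)) := by
  have hP := sobolevExp_pos hp hpN
  have hp0 : 0 < p := by linarith
  have hσ : σ ≠ 0 := fun h0 => by
    have := h.σ_gt; rw [h0] at this; exact not_lt_zero this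
  have hsum := h.exponent_sum_lt hpN hp
  have hδ := h.δ_pos
  have hβ := h.β_pos
  have key := setIntegral_mul_rpow_le hAK hK.measure_lt_top.ne hσ (h.c_memLp K hK hKΩ)
    (ae_mono (Measure.restrict_mono hKΩ le_rfl) h.c_nonneg) hD (fun x => by positivity)
    hv (fun x => by positivity) (a := δ / p) (b := β / sobolevExp N p)
    (d := 1 - (δ / p + β / sobolevExp N p + (σ⁻¹).toReal)) (by positivity) (by positivity)
    (by linarith) (by ring)
  have e1 : ∀ x, (‖Du x‖ ^ p) ^ (δ / p) = ‖Du x‖ ^ δ := fun x => by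
    rw [← Real.rpow_mul (norm_nonneg _), mul_div_cancel₀ _ hp0.ne']
  have e2 : ∀ x, (|v x| ^ sobolevExp N p) ^ (β / sobolevExp N p) = |v x| ^ β := fun x => by
    rw [← Real.rpow_mul (abs_nonneg _), mul_div_cancel₀ _ hP.ne']
  simpa only [e1, e2] using key

end holderTerm

/-! ### Energy comparison -/

/-- Comparison of the energies of a local minimizer and of its competitor obtained by lowering
one component on a superlevel set. -/
lemma exists_energy_comparison {n N : ℕ} {Ω : Set (Pt N)} (hΩ : IsOpen Ω)
    {p ε q C δ β : ℝ} {σ : ℝ≥0∞} {γ L : Fin n → ℝ}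
    (hp : 1 < p) (hpN : p < N) (hε : 0 < ε) (hεN : ε < p / N)
    {f : Fin n → Pt N → ℝ → Pt N → ℝ} {G : Pt N → Val n → Grad n N → ℝ}
    {a b : Fin n → Pt N → ℝ} {a₀ c : Pt N → ℝ}
    (h1 : ∀ α : Fin n, GrowthF Ω p ε (γ α) (L α) (a α) (b α) (f α))
    (h2 : GrowthG Ω p ε q C a₀ G)
    (h3 : RankOneConvexG Ω G)
    (h4 : HolderG Ω p q δ β σ c G)
    {u : Pt N → Val n} {Du : Pt N → Grad n N}
    (hu : IsSobolevLoc Ω p u Du)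
    (hmin : IsLocalMinimizer Ω p f G u Du)
    {K : Set (Pt N)} (hK : IsCompact K) (hKΩ : K ⊆ Ω) (α : Fin n) :
    ∃ C₀ : ℝ, 0 < C₀ ∧ ∀ (x₀ : Pt N) (k s t : ℝ), 0 < s → s < t → Metric.closedBall x₀ t ⊆ K →
      ∀ As At, As = superSet (fun x => u x α) k x₀ s → At = superSet (fun x => u x α) k x₀ t →
      (L α + 1) * (∫ x in As, ‖Du x α‖ ^ p)
        ≤ L α * (∫ x in At, ‖Du x α‖ ^ p)
          + C₀ * (((∫ x in At, |u x α - k| ^ p) / (t - s) ^ p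
              + (∫ x in At, b α x * |u x α - k| ^ γ α) + |k| ^ γ α * (∫ x in At, b α x))
            + ((∫ x in At, a α x) + (∫ x in At, c x * ‖Du x‖ ^ δ * |u x α - k| ^ β)
              + (∫ x in At, ‖Du x‖ ^ q))
            + ((∫ x in At, ‖u x‖ ^ q) + (1 + |k| ^ p) * volume.real At + (∫ x in At, a₀ x))) := by
  obtain ⟨Cζ, hCζ, hcut⟩ := exists_radial_cutoff N hp
  have hp0 : 0 < p := by linarith
  have hP := sobolevExp_pos hp hpN
  have hqp := (h2.q_lt_p hp hpN).le
  have hq0 : 0 ≤ q := by linarith [h2.one_le_q]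
  have hL := (h1 α).one_lt_L
  have hγ0 : 0 ≤ γ α := by linarith [(h1 α).p_le_γ]
  have hC := h2.one_lt_C
  set CG := C * (2 ^ q * 2 ^ q * 2 + 2) with hCG
  have hCG0 : 0 ≤ CG := by positivity
  -- The sum of the coefficients of all error terms: cutoff term (from `f` and `G`), the two `b`
  -- terms, `a`, the Hölder term, and the growth of `G`.
  set C₀ := (L α + CG) * Cζ + (L α + 1) * 2 ^ γ α + (L α + 1) + 1 + CG with hC₀
  have hLC : 0 ≤ (L α + CG) * Cζ := by positivity
  have hL2 : 0 ≤ (L α + 1) * 2 ^ γ α := by positivity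
  have hC₀0 : 0 < C₀ := by positivity
  refine ⟨C₀, hC₀0, fun x₀ k s t hs hst htK As At hAs hAt => ?_⟩
  obtain ⟨ζ, hζ, hζ0, hζ1, hζone, hζzero, hζgrad⟩ := hcut x₀ s t hs hst
  set v : Pt N → ℝ := fun x => u x α with hv
  set X : Pt N → Pt N := fun x => Du x α with hX
  have hts : 0 < (t - s) ^ p := Real.rpow_pos_of_pos (by linarith) p
  have hvL : IsLpLoc Ω (ENNReal.ofReal p) v := fun K hK hKΩ => (hu.memLp K hK hKΩ).piLp_apply α
  have hXL : IsLpLoc Ω (ENNReal.ofReal p) X := fun K hK hKΩ =>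
    (hu.memLp_grad K hK hKΩ).piLp_apply α
  set B := Metric.closedBall x₀ t with hB
  have hBc : IsCompact B := isCompact_closedBall x₀ t
  have hBΩ : B ⊆ Ω := htK.trans hKΩ
  have hζts : tsupport ζ ⊆ B := closure_minimal (fun x hx => by
    by_contra h
    exact hx (hζzero x fun h' => h (Metric.ball_subset_closedBall h'))) Metric.isClosed_closedBall
  have hζs : HasCompactSupport ζ := hBc.of_isClosed_subset (isClosed_tsupport _) hζts
  obtain ⟨hφ, hDφ, hwg⟩ := cutoff_posPart_sobolev hΩ hp hvL hXL (hu.weakGradient α) k hζ hζs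
    (hζts.trans hBΩ)
  set w₁ : Pt N → ℝ := fun x => ζ x * max (v x - k) 0 with hw₁
  set Dw₁ : Pt N → Pt N := fun x => ζ x • {x | k < v x}.indicator X x
    + max (v x - k) 0 • gradient ζ x with hDw₁
  have hS : IsSobolev Ω p (fun x => (PiLp.single 2 α (-w₁ x) : Val n))
      (fun x => (PiLp.single 2 α (-Dw₁ x) : Grad n N)) := isSobolev_single hφ hDφ hwg α
  have hw₁0 : ∀ x, x ∉ At → w₁ x = 0 := fun x hx => by
    by_cases hk : k < v x
    · have : x ∉ Metric.ball x₀ t := fun h => hx (by rw [hAt]; exact ⟨hk, h⟩)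
      simp [hw₁, hζzero x this]
    · simp [hw₁, max_eq_right (sub_nonpos.2 (not_lt.1 hk))]
  -- As `p > 1`, the bound by `ζ^(p-1)` forces the gradient to vanish with `ζ`. This makes division
  -- by `ζ` harmless and the perturbation exactly zero outside `At`, gradient included.
  have hgz : ∀ x, ζ x = 0 → gradient ζ x = 0 := fun x hx => by
    have := hζgrad x
    rw [hx, Real.zero_rpow (by linarith), mul_zero] at this
    have h0 : ‖gradient ζ x‖ ^ p = 0 := le_antisymm this (by positivity)
    rw [Real.rpow_eq_zero (norm_nonneg _) hp0.ne'] at h0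
    exact norm_eq_zero.1 h0
  have hDw₁0 : ∀ x, x ∉ At → Dw₁ x = 0 := fun x hx => by
    by_cases hk : k < v x
    · have : x ∉ Metric.ball x₀ t := fun h => hx (by rw [hAt]; exact ⟨hk, h⟩)
      simp [hDw₁, hζzero x this, hgz x (hζzero x this)]
    · have hi : {x | k < v x}.indicator X x = 0 := indicator_of_notMem (by exact hk) _
      simp only [hDw₁, hi, max_eq_right (sub_nonpos.2 (not_lt.1 hk)), zero_smul, smul_zero, add_zero]
  have hAtB : At ⊆ B := by
    rw [hAt]; exact superSet_subset_ball.trans Metric.ball_subset_closedBall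
  have hAtK : At ⊆ K := hAtB.trans htK
  have hen := hmin _ _ B hS hBc hBΩ (Eventually.of_forall fun x hx => by
    rw [hw₁0 x fun h => hx (hAtB h)]; simp)
  have huB := hu.memLp B hBc hBΩ
  have hDB := hu.memLp_grad B hBc hBΩ
  have huP : ∀ β, IntegrableOn (fun x => |u x β| ^ sobolevExp N p) B := fun β =>
    IsLpLoc.sobolev hΩ hp hpN (fun K hK hKΩ => (hu.memLp K hK hKΩ).piLp_apply β)
      (fun K hK hKΩ => (hu.memLp_grad K hK hKΩ).piLp_apply β) (hu.weakGradient β) B hBc hBΩ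
  -- Integrability of both densities makes the two energies true integrals, not the default value 0,
  -- so that they may be subtracted.
  have hint0 := integrableOn_energy_density hp hpN hε hεN hqp h1 h2 hBc hBΩ huB huP hDB
  have hSB := hS.memLp.mono_measure (Measure.restrict_mono hBΩ le_rfl)
  have hSDB := hS.memLp_grad.mono_measure (Measure.restrict_mono hBΩ le_rfl)
  have huk := integrableOn_abs_sub_rpow hBc.measure_lt_top.ne hP.le
    (huB.piLp_apply α).1.aemeasurable (huP α) k
  -- The competitor stays in `L^(p^*)` because the perturbation is at most `|v - k|`.
  have huP' : ∀ β, IntegrableOn (fun x => |(u x + (PiLp.single 2 α (-w₁ x) : Val n)) β|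
      ^ sobolevExp N p) B := fun β => by
    have hm : AEMeasurable (fun x => (u x + (PiLp.single 2 α (-w₁ x) : Val n)) β)
        (volume.restrict B) := ((huB.add hSB).piLp_apply β).1.aemeasurable
    refine Integrable.mono' (((huP β).add huk.1).const_mul (2 ^ sobolevExp N p))
      (hm.abs.pow_const _).aestronglyMeasurable (Eventually.of_forall fun x => ?_)
    rw [Real.norm_of_nonneg (by positivity)]
    refine (Real.rpow_le_rpow (abs_nonneg _) ?_ hP.le).trans
      (Real.add_rpow_le_two_rpow_mul (abs_nonneg (u x β)) (abs_nonneg (v x - k)) hP.le)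
    refine (abs_add_le _ _).trans (add_le_add le_rfl ?_)
    have hle : ‖(PiLp.single 2 α (-w₁ x) : Val n) β‖ ≤ ‖w₁ x‖ := by
      refine (PiLp.norm_apply_le _ β).trans ?_
      rw [PiLp.norm_single, norm_neg]
    rw [← Real.norm_eq_abs]
    refine hle.trans ?_
    rw [hw₁, Real.norm_of_nonneg (mul_nonneg (hζ0 x) (le_max_right _ _))]
    calc ζ x * max (v x - k) 0 ≤ 1 * max (v x - k) 0 :=
          mul_le_mul_of_nonneg_right (hζ1 x) (le_max_right _ _)
      _ ≤ |v x - k| := by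
          rw [one_mul]; exact max_le (le_abs_self _) (abs_nonneg _)
  have hint1 := integrableOn_energy_density hp hpN hε hεN hqp h1 h2 hBc hBΩ (huB.add hSB) huP'
    (hDB.add hSDB)
  unfold energy at hen
  -- the integrable majorant of the difference of the energy densities
  have hAfin : volume At ≠ ⊤ := ((measure_mono hAtB).trans_lt hBc.measure_lt_top).ne
  have hvAt : AEMeasurable v (volume.restrict At) :=
    ((huB.piLp_apply α).1.mono_measure (Measure.restrict_mono hAtB le_rfl)).aemeasurable
  have i0 : IntegrableOn (fun x => ‖X x‖ ^ p) At :=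
    IntegrableOn.mono_set ((hDB.piLp_apply α).integrable_norm_ofReal_rpow hp0) hAtB
  have i0' : IntegrableOn ((Metric.ball x₀ s).indicator fun x => ‖X x‖ ^ p) At :=
    Integrable.indicator i0 measurableSet_ball
  have i1 : IntegrableOn (fun x => |v x - k| ^ p) At :=
    (integrableOn_abs_sub_rpow hAfin hp0.le hvAt (IntegrableOn.mono_set
      ((huB.piLp_apply α).integrable_norm_ofReal_rpow hp0) hAtB) k).1
  have iP : IntegrableOn (fun x => |v x - k| ^ sobolevExp N p) At := huk.1.mono_set hAtB
  have i2 := ((h1 α).setIntegral_b_mul_rpow_le hp hpN hε hK hKΩ hAtK iP).1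
  have i3 := ((h1 α).setIntegral_b_le hp hpN hε hK hKΩ hAtK).1
  have hmono : volume.restrict K ≤ volume.restrict Ω := Measure.restrict_mono hKΩ le_rfl
  have i4 := (setIntegral_le_of_memLp_kappa hp hpN hε hεN hK hAtK
      ((h1 α).a_memLp K hK hKΩ) (ae_mono hmono (h1 α).a_nonneg)).1
  have iD : IntegrableOn (fun x => ‖Du x‖ ^ p) At :=
    IntegrableOn.mono_set (hDB.integrable_norm_ofReal_rpow hp0) hAtB
  have i5 := (h4.setIntegral_le hp hpN hK hKΩ hAtK iD iP).1
  have i6 := (setIntegral_norm_rpow_le hp0 hq0 hqp hAfin iD).1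
  have i7 := (setIntegral_norm_rpow_le hp0 hq0 hqp hAfin (IntegrableOn.mono_set
      (huB.integrable_norm_ofReal_rpow hp0) hAtB)).1
  have i8 : IntegrableOn (fun _ : Pt N => 1 + |k| ^ p) At := integrableOn_const hAfin
  have i9 := (setIntegral_le_of_memLp_kappa hp hpN hε hεN hK hAtK
      (h2.a_memLp K hK hKΩ) (ae_mono hmono h2.a_nonneg)).1
  obtain ⟨j1, e1⟩ := integral_add_add (i1.div_const ((t - s) ^ p)) i2 (i3.const_mul (|k| ^ γ α))
  obtain ⟨j2, e2⟩ := integral_add_add i4 i5 i6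
  obtain ⟨j3, e3⟩ := integral_add_add i7 i8 i9
  obtain ⟨j4, e4⟩ := integral_add_add j1 j2 j3
  obtain ⟨j5, e5⟩ := integral_add_add (i0.const_mul (L α)) (i0'.const_mul (-(L α + 1)))
    (j4.const_mul C₀)
  set H : Pt N → ℝ := fun x => L α * ‖X x‖ ^ p
    + -(L α + 1) * (Metric.ball x₀ s).indicator (fun x => ‖X x‖ ^ p) x
    + C₀ * ((|v x - k| ^ p / (t - s) ^ p + b α x * |v x - k| ^ γ α + |k| ^ γ α * b α x)
      + (a α x + c x * ‖Du x‖ ^ δ * |v x - k| ^ β + ‖Du x‖ ^ q)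
      + (‖u x‖ ^ q + (1 + |k| ^ p) + a₀ x)) with hH
  have hpt : ∀ᵐ x ∂(volume.restrict B),
      ((∑ β : Fin n, f β x ((u x + (PiLp.single 2 α (-w₁ x) : Val n)) β)
          ((Du x + (PiLp.single 2 α (-Dw₁ x) : Grad n N)) β))
        + G x (u x + (PiLp.single 2 α (-w₁ x) : Val n))
          (Du x + (PiLp.single 2 α (-Dw₁ x) : Grad n N)))
      - ((∑ β : Fin n, f β x (u x β) (Du x β)) + G x (u x) (Du x)) ≤ At.indicator H x := by
    have hmB : volume.restrict B ≤ volume.restrict Ω := Measure.restrict_mono hBΩ le_rfl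
    filter_upwards [ae_mono hmB (h1 α).growth, ae_mono hmB (h1 α).a_nonneg,
      ae_mono hmB (h1 α).b_nonneg, ae_mono hmB h2.growth, ae_mono hmB h2.a_nonneg,
      ae_mono hmB h3, ae_mono hmB h4.holder, ae_mono hmB h4.c_nonneg]
      with x g1 ga gb g2 ga0 g3 g4 gc
    by_cases hx : x ∈ At
    · rw [indicator_of_mem hx]
      have hxk : k < v x := by rw [hAt] at hx; exact hx.1
      have hw : 0 ≤ u x α - k := by
        have : k < u x α := hxk
        linarith
      -- Where `ζ = 0` the convention `0⁻¹ = 0` gives `Z = 0`, and `ζ Z = (u^α - k)∇ζ` still holds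
      -- since `∇ζ = 0` there.
      set Z : Pt N := (ζ x)⁻¹ • ((u x α - k) • gradient ζ x) with hZ
      have eZ : ζ x • Z = (u x α - k) • gradient ζ x := by
        by_cases h0 : ζ x = 0
        · rw [h0, hgz x h0]; simp
        · rw [hZ, smul_smul, mul_inv_cancel₀ h0, one_smul]
      have ew : w₁ x = ζ x * (u x α - k) := by
        simp only [hw₁, hv]; rw [max_eq_left hw]
      have eDw : Dw₁ x = ζ x • Du x α + ζ x • Z := by
        rw [eZ]
        have hi : {x | k < v x}.indicator X x = Du x α := indicator_of_mem (by exact hxk) _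
        simp only [hDw₁, hi]
        congr 2
        exact max_eq_left hw
      have hQ : ζ x * ‖Z‖ ^ p ≤ Cζ * (|u x α - k| ^ p / (t - s) ^ p) := by
        rcases eq_or_lt_of_le (hζ0 x) with h0 | h0
        · rw [← h0, zero_mul]; positivity
        · have hz1 : ‖Z‖ ^ p = (ζ x ^ p)⁻¹ * (|u x α - k| ^ p * ‖gradient ζ x‖ ^ p) := by
            rw [hZ, norm_smul, norm_smul, norm_inv, Real.norm_of_nonneg h0.le, Real.norm_eq_abs,
              Real.mul_rpow (by positivity) (by positivity),
              Real.mul_rpow (by positivity) (by positivity), Real.inv_rpow h0.le]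
          have hz2 : ζ x * (ζ x ^ p)⁻¹ * ζ x ^ (p - 1) = 1 := by
            rw [Real.rpow_sub_one h0.ne']
            have : ζ x ^ p ≠ 0 := (Real.rpow_pos_of_pos h0 p).ne'
            field_simp
          calc ζ x * ‖Z‖ ^ p
              = ζ x * (ζ x ^ p)⁻¹ * |u x α - k| ^ p * ‖gradient ζ x‖ ^ p := by rw [hz1]; ring
            _ ≤ ζ x * (ζ x ^ p)⁻¹ * |u x α - k| ^ p * (Cζ / (t - s) ^ p * ζ x ^ (p - 1)) :=
                mul_le_mul_of_nonneg_left (hζgrad x) (by positivity)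
            _ = (ζ x * (ζ x ^ p)⁻¹ * ζ x ^ (p - 1)) * (Cζ * (|u x α - k| ^ p / (t - s) ^ p)) := by
                ring
            _ = _ := by rw [hz2, one_mul]
      have kf := growth_sub_le hp.le hγ0 (by linarith) gb g1 (X := Du x α) (hζ0 x) (hζ1 x) hw hQ
      have kG := rankOneConvex_sub_le hq0 hqp (by linarith) h4.β_pos.le ga0 gc g2 g3 g4
        (D := Du x) (hζ0 x) (hζ1 x) hw hQ
      rw [ew, eDw]
      have esum : (∑ β : Fin n, f β x ((u x + (PiLp.single 2 α (-(ζ x * (u x α - k))) : Val n)) β)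
          ((Du x + (PiLp.single 2 α (-(ζ x • Du x α + ζ x • Z)) : Grad n N)) β))
          - ∑ β : Fin n, f β x (u x β) (Du x β)
          = f α x (u x α + -(ζ x * (u x α - k))) (Du x α + -(ζ x • Du x α + ζ x • Z))
            - f α x (u x α) (Du x α) := by
        rw [← Finset.sum_sub_distrib, Finset.sum_eq_single α]
        · simp only [PiLp.add_apply, PiLp.single_eq_same]
        · intro β _ hβ
          simp only [PiLp.add_apply, PiLp.single_eq_of_ne 2 hβ, add_zero, sub_self]
        · simp
      -- Hole filling: on the small ball `ζ = 1` and the coefficient is `-1 = L - (L + 1)`;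
      -- elsewhere it is at most `L`.
      have hind : L α * (1 - ζ x) * ‖Du x α‖ ^ p - ‖Du x α‖ ^ p
          ≤ L α * ‖Du x α‖ ^ p
            + -(L α + 1) * (Metric.ball x₀ s).indicator (fun x => ‖X x‖ ^ p) x := by
        have n1 : 0 ≤ ‖Du x α‖ ^ p := by positivity
        by_cases hxs : x ∈ Metric.ball x₀ s
        · rw [indicator_of_mem hxs, hζone x hxs]
          simp only [hX]; linarith
        · rw [indicator_of_notMem hxs]
          have := mul_nonneg (mul_nonneg (by linarith : 0 ≤ L α) (hζ0 x)) n1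
          linarith
      have habs : |v x - k| = u x α - k := abs_of_nonneg hw
      have habs' : |u x α - k| = u x α - k := abs_of_nonneg hw
      simp only [hH, habs]
      rw [habs'] at kf kG
      have n1 : 0 ≤ (u x α - k) ^ p / (t - s) ^ p := by positivity
      have n2 : 0 ≤ b α x * (u x α - k) ^ γ α := by positivity
      have n3 : 0 ≤ |k| ^ γ α * b α x := by positivity
      have n4 : 0 ≤ c x * ‖Du x‖ ^ δ * (u x α - k) ^ β := by positivity
      have n5 : 0 ≤ ‖Du x‖ ^ q := by positivity
      have n6 : 0 ≤ ‖u x‖ ^ q := by positivity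
      have n7 : 0 ≤ 1 + |k| ^ p := by positivity
      have m1 : (L α + CG) * Cζ * ((u x α - k) ^ p / (t - s) ^ p)
          ≤ C₀ * ((u x α - k) ^ p / (t - s) ^ p) :=
        mul_le_mul_of_nonneg_right (by rw [hC₀]; linarith) n1
      have m2 : (L α + 1) * 2 ^ γ α * (b α x * (u x α - k) ^ γ α)
          ≤ C₀ * (b α x * (u x α - k) ^ γ α) :=
        mul_le_mul_of_nonneg_right (by rw [hC₀]; linarith) n2
      have m3 : (L α + 1) * 2 ^ γ α * (|k| ^ γ α * b α x) ≤ C₀ * (|k| ^ γ α * b α x) :=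
        mul_le_mul_of_nonneg_right (by rw [hC₀]; linarith) n3
      have m4 : 1 * (c x * ‖Du x‖ ^ δ * (u x α - k) ^ β)
          ≤ C₀ * (c x * ‖Du x‖ ^ δ * (u x α - k) ^ β) :=
        mul_le_mul_of_nonneg_right (by rw [hC₀]; linarith) n4
      have m5 : CG * ‖Du x‖ ^ q ≤ C₀ * ‖Du x‖ ^ q :=
        mul_le_mul_of_nonneg_right (by rw [hC₀]; linarith) n5
      have m6 : CG * ‖u x‖ ^ q ≤ C₀ * ‖u x‖ ^ q :=
        mul_le_mul_of_nonneg_right (by rw [hC₀]; linarith) n6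
      have m7 : CG * (1 + |k| ^ p) ≤ C₀ * (1 + |k| ^ p) :=
        mul_le_mul_of_nonneg_right (by rw [hC₀]; linarith) n7
      have m8 : CG * a₀ x ≤ C₀ * a₀ x :=
        mul_le_mul_of_nonneg_right (by rw [hC₀]; linarith) ga0
      have m9 : (L α + 1) * a α x ≤ C₀ * a α x :=
        mul_le_mul_of_nonneg_right (by rw [hC₀]; linarith) ga
      rw [← hCG] at kG
      linarith
    · rw [indicator_of_notMem hx, hw₁0 x hx, hDw₁0 x hx, neg_zero, neg_zero,
        (PiLp.single_eq_zero_iff 2 α).2 rfl, (PiLp.single_eq_zero_iff 2 α).2 rfl, add_zero,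
        add_zero, sub_self]
  have hAtm : NullMeasurableSet At volume := by
    rw [hAt]
    exact nullMeasurableSet_superSet hBc.measurableSet (huB.piLp_apply α).1.aemeasurable
      Metric.ball_subset_closedBall
  have hAtm' : NullMeasurableSet At (volume.restrict B) :=
    hAtm.mono_ac Measure.restrict_le_self.absolutelyContinuous
  have hres : (volume.restrict B).restrict At = volume.restrict At := by
    rw [Measure.restrict_restrict₀ hAtm', inter_eq_left.2 hAtB]
  have hHi : Integrable (At.indicator H) (volume.restrict B) := by
    refine IntegrableOn.integrable_indicator₀ ?_ hAtm'
    rw [IntegrableOn, hres]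
    exact j5
  have hfin : 0 ≤ ∫ x in At, H x := by
    have h5 : 0 ≤ ∫ x in B, At.indicator H x := by
      refine le_trans ?_ (integral_mono_ae (hint1.sub hint0) hHi hpt)
      simp only [Pi.sub_apply]
      rw [integral_sub hint1 hint0]
      exact sub_nonneg.2 hen
    rwa [integral_indicator₀ hAtm', hres] at h5
  have hAsAt : At ∩ Metric.ball x₀ s = As := by
    rw [hAt, hAs, superSet, superSet, inter_assoc,
      inter_eq_right.2 (Metric.ball_subset_ball hst.le)]
  have h6 : ∫ x in At, (Metric.ball x₀ s).indicator (fun x => ‖X x‖ ^ p) x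
      = ∫ x in As, ‖X x‖ ^ p := by
    rw [setIntegral_indicator measurableSet_ball, hAsAt]
  rw [show (∫ x in At, H x) = _ from e5, integral_const_mul, integral_const_mul,
    integral_const_mul, h6, e4, e1, e2, e3, integral_div, integral_const_mul,
    setIntegral_const, smul_eq_mul, mul_comm (volume.real At)] at hfin
  simp only [hX, hv] at hfin
  linarith

/-! ### Sobolev inequality on superlevel sets, the half-ball alternative, small radii -/

section

variable {N : ℕ} {Ω K : Set (Pt N)} {p : ℝ} {v : Pt N → ℝ} {X : Pt N → Pt N}

/-- The Sobolev inequality for `(v - k)⁺` on concentric balls. -/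
lemma exists_sobolev_superSet_const (hΩ : IsOpen Ω) (hp : 1 < p) (hpN : p < N)
    (hv : IsLpLoc Ω (ENNReal.ofReal p) v) (hX : IsLpLoc Ω (ENNReal.ofReal p) X)
    (h : HasWeakGradient Ω v X) :
    ∃ S : ℝ, 0 < S ∧ ∀ (x₀ : Pt N) (k s t : ℝ), 0 < s → s < t → Metric.closedBall x₀ t ⊆ Ω →
      (∫ x in superSet v k x₀ s, |v x - k| ^ sobolevExp N p) ^ (p / sobolevExp N p)
        ≤ S * ((∫ x in superSet v k x₀ t, ‖X x‖ ^ p)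
          + (∫ x in superSet v k x₀ t, |v x - k| ^ p) / (t - s) ^ p) := by
  obtain ⟨S, hS, hsob⟩ := exists_sobolev_integral_const hp hpN
  obtain ⟨Cζ, hCζ, hcut⟩ := exists_radial_cutoff N hp
  have hp0 : 0 < p := by linarith
  have hP := sobolevExp_pos hp hpN
  refine ⟨S * (2 ^ p * (1 + Cζ)), by positivity, fun x₀ k s t hs hst hB => ?_⟩
  obtain ⟨ζ, hζ, hζ0, hζ1, hζone, hζzero, hζgrad⟩ := hcut x₀ s t hs hst
  set B := Metric.closedBall x₀ t
  have hBc : IsCompact B := isCompact_closedBall x₀ t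
  have hζts : tsupport ζ ⊆ B := closure_minimal (fun x hx => by
    by_contra h
    exact hx (hζzero x fun h' => h (Metric.ball_subset_closedBall h'))) Metric.isClosed_closedBall
  have hζs : HasCompactSupport ζ := hBc.of_isClosed_subset (isClosed_tsupport _) hζts
  obtain ⟨h1, h2, h3⟩ := cutoff_posPart_sobolev hΩ hp hv hX h k hζ hζs (hζts.trans hB)
  obtain ⟨i1, h4⟩ := hsob _ _ hζs.mul_right h1 h2 h3
  set At := superSet v k x₀ t with hAt
  set As := superSet v k x₀ s with hAs
  have hts : 0 < (t - s) ^ p := Real.rpow_pos_of_pos (by linarith) p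
  have hAtB : At ⊆ B := superSet_subset_ball.trans Metric.ball_subset_closedBall
  have hAfin : volume At ≠ ⊤ := ((measure_mono hAtB).trans_lt hBc.measure_lt_top).ne
  have hvm := (hv B hBc hB).1.aemeasurable
  have hAtm : NullMeasurableSet At volume :=
    nullMeasurableSet_superSet hBc.measurableSet hvm Metric.ball_subset_closedBall
  have hAsm : NullMeasurableSet As volume :=
    nullMeasurableSet_superSet hBc.measurableSet hvm
      ((Metric.ball_subset_ball hst.le).trans Metric.ball_subset_closedBall)
  have hmAB : volume.restrict At ≤ volume.restrict B := Measure.restrict_mono hAtB le_rfl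
  have j1 : IntegrableOn (fun x => |v x - k| ^ p) At :=
    (integrableOn_abs_sub_rpow hAfin hp0.le (hvm.mono_measure hmAB) (IntegrableOn.mono_set
      ((hv B hBc hB).integrable_norm_ofReal_rpow hp0) hAtB) k).1
  have j2 : IntegrableOn (fun x => ‖X x‖ ^ p) At :=
    IntegrableOn.mono_set ((hX B hBc hB).integrable_norm_ofReal_rpow hp0) hAtB
  -- On `As` the cutoff is 1 and `v > k`, so the integrand is that of the cut-off positive part.
  have hleft : ∫ x in As, |v x - k| ^ sobolevExp N p
      ≤ ∫ x, |ζ x * max (v x - k) 0| ^ sobolevExp N p := by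
    refine le_trans (le_of_eq ?_) (setIntegral_le_integral i1 (s := As)
      (Eventually.of_forall fun x => by positivity))
    refine integral_congr_ae ?_
    filter_upwards [ae_restrict_mem₀ hAsm] with x hx
    have hk : k < v x := hx.1
    rw [hζone x hx.2, one_mul, max_eq_left (by linarith)]
  have hright : ∫ x, ‖ζ x • {x | k < v x}.indicator X x + max (v x - k) 0 • gradient ζ x‖ ^ p
      ≤ ∫ x, At.indicator (fun x => 2 ^ p * (‖X x‖ ^ p + Cζ / (t - s) ^ p * |v x - k| ^ p)) x := by
    refine integral_mono (h2.integrable_norm_ofReal_rpow hp0) ?_ fun x => ?_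
    · exact IntegrableOn.integrable_indicator₀
        ((Integrable.add j2 (j1.const_mul _)).const_mul _) hAtm
    · have hg0 : ζ x = 0 → gradient ζ x = 0 := fun hx => by
        have := hζgrad x
        rw [hx, Real.zero_rpow (by linarith), mul_zero] at this
        have h0 : ‖gradient ζ x‖ ^ p = 0 := le_antisymm this (by positivity)
        rw [Real.rpow_eq_zero (norm_nonneg _) hp0.ne'] at h0
        exact norm_eq_zero.1 h0
      by_cases hx : x ∈ At
      · rw [indicator_of_mem hx]
        have hk : k < v x := hx.1
        have e1 : {x | k < v x}.indicator X x = X x := indicator_of_mem (by exact hk) _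
        have e2 : max (v x - k) 0 = |v x - k| := by
          rw [max_eq_left (by linarith), abs_of_nonneg (by linarith)]
        simp only [e1, e2]
        have n1 : ‖ζ x • X x + |v x - k| • gradient ζ x‖
            ≤ ‖X x‖ + |v x - k| * ‖gradient ζ x‖ := by
          refine (norm_add_le _ _).trans (add_le_add ?_ ?_)
          · rw [norm_smul, Real.norm_of_nonneg (hζ0 x)]
            exact mul_le_of_le_one_left (norm_nonneg _) (hζ1 x)
          · rw [norm_smul, Real.norm_of_nonneg (abs_nonneg _)]
        refine (Real.rpow_le_rpow (norm_nonneg _) n1 hp0.le).trans ?_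
        refine (Real.add_rpow_le_two_rpow_mul (norm_nonneg _) (by positivity) hp0.le).trans ?_
        rw [Real.mul_rpow (abs_nonneg _) (norm_nonneg _)]
        have n2 : ‖gradient ζ x‖ ^ p ≤ Cζ / (t - s) ^ p := by
          refine (hζgrad x).trans (mul_le_of_le_one_right (by positivity) ?_)
          exact Real.rpow_le_one (hζ0 x) (hζ1 x) (by linarith)
        have : |v x - k| ^ p * ‖gradient ζ x‖ ^ p ≤ Cζ / (t - s) ^ p * |v x - k| ^ p := by
          rw [mul_comm]; gcongr
        gcongr
      · rw [indicator_of_notMem hx]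
        by_cases hk : k < v x
        · have hb : x ∉ Metric.ball x₀ t := fun h => hx ⟨hk, h⟩
          have z1 := hζzero x hb
          simp only [z1, hg0 z1, zero_smul, smul_zero, add_zero, norm_zero]
          rw [Real.zero_rpow hp0.ne']
        · have e1 : {x | k < v x}.indicator X x = 0 := indicator_of_notMem (by exact hk) _
          simp only [e1, max_eq_right (sub_nonpos.2 (not_lt.1 hk)), zero_smul, smul_zero,
            add_zero, norm_zero]
          rw [Real.zero_rpow hp0.ne']
  rw [integral_indicator₀ hAtm, integral_const_mul, integral_add j2 (j1.const_mul _),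
    integral_const_mul] at hright
  refine (Real.rpow_le_rpow (integral_nonneg fun x => by positivity) hleft
    (by positivity)).trans (h4.trans ?_)
  rw [mul_assoc]
  refine mul_le_mul_of_nonneg_left (hright.trans ?_) hS.le
  rw [mul_assoc]
  refine mul_le_mul_of_nonneg_left ?_ (by positivity)
  have n1 : 0 ≤ ∫ x in At, ‖X x‖ ^ p := integral_nonneg fun x => by positivity
  have n2 : 0 ≤ (∫ x in At, |v x - k| ^ p) / (t - s) ^ p :=
    div_nonneg (integral_nonneg fun x => by positivity) hts.le
  have e : Cζ / (t - s) ^ p * (∫ x in At, |v x - k| ^ p)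
      = Cζ * ((∫ x in At, |v x - k| ^ p) / (t - s) ^ p) := by ring
  rw [e]
  nlinarith [mul_nonneg hCζ.le n1]

/-- Chebyshev's inequality, with the integral over the larger set `K` so that the bound does not
depend on `A`. -/
lemma rpow_mul_measureReal_le {A : Set (Pt N)} {r k : ℝ} (hr : 0 ≤ r)
    (hA : NullMeasurableSet A volume)
    (hAK : A ⊆ K) (hK : volume K ≠ ⊤) (hv : IntegrableOn (fun x => |v x| ^ r) K)
    (h : ∀ x ∈ A, |k| ≤ |v x|) : |k| ^ r * volume.real A ≤ ∫ x in K, |v x| ^ r := by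
  have hAfin : volume A ≠ ⊤ := ((measure_mono hAK).trans_lt hK.lt_top).ne
  calc |k| ^ r * volume.real A = ∫ _ in A, |k| ^ r := by
        rw [setIntegral_const, smul_eq_mul, mul_comm]
    _ ≤ ∫ x in A, |v x| ^ r := by
        refine integral_mono_ae (integrableOn_const hAfin) (IntegrableOn.mono_set hv hAK) ?_
        filter_upwards [ae_restrict_mem₀ hA] with x hx
        exact Real.rpow_le_rpow (abs_nonneg _) (h x hx) hr
    _ ≤ _ := setIntegral_mono_set hv (Eventually.of_forall fun x => by positivity)
        hAK.eventuallyLE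

/-- If `|k|^r |A|` exceeds the integral of `|v|^r`, then the superlevel set `A` fills at least half
of the ball. -/
lemma measureReal_ball_le_two_mul {r k R : ℝ} {x₀ : Pt N} (hr : 0 < r) (hK : IsCompact K)
    (hB : Metric.ball x₀ R ⊆ K) (hvm : AEMeasurable v (volume.restrict K))
    (hv : IntegrableOn (fun x => |v x| ^ r) K)
    (h : ∫ x in K, |v x| ^ r < |k| ^ r * volume.real (superSet v k x₀ R)) :
    volume.real (Metric.ball x₀ R) ≤ 2 * volume.real (superSet v k x₀ R) := by
  set A := superSet v k x₀ R with hA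
  have hAm : NullMeasurableSet A volume := nullMeasurableSet_superSet hK.measurableSet hvm hB
  have hAB : A ⊆ Metric.ball x₀ R := superSet_subset_ball
  have hKfin : volume K ≠ ⊤ := hK.measure_lt_top.ne
  -- For `k ≥ 0` Chebyshev on `A` contradicts the assumption. For `k < 0` it applies to the
  -- complement of `A` in the ball, where `v ≤ k` gives `|v| ≥ |k|`; hence the complement is no
  -- larger than `A`.
  rcases le_or_gt 0 k with hk | hk
  · exact absurd (rpow_mul_measureReal_le hr.le hAm (hAB.trans hB) hKfin hv fun x hx => by
      have : k < v x := hx.1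
      rw [abs_of_nonneg hk]
      exact this.le.trans (le_abs_self _)) (not_le.2 h)
  · have h1 := rpow_mul_measureReal_le (k := k) hr.le
      (measurableSet_ball.nullMeasurableSet.diff hAm) (sdiff_subset.trans hB) hKfin hv
      (A := Metric.ball x₀ R \ A) fun x hx => by
        have : v x ≤ k := by
          by_contra h'
          exact hx.2 ⟨not_le.1 h', hx.1⟩
        rw [abs_of_neg hk, abs_of_nonpos (by linarith)]
        linarith
    have h2 : 0 < |k| ^ r := Real.rpow_pos_of_pos (abs_pos.2 hk.ne) r
    have h3 : volume.real (Metric.ball x₀ R \ A) ≤ volume.real A := by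
      have := h1.trans h.le
      exact le_of_mul_le_mul_left this h2
    have h4 : volume.real (Metric.ball x₀ R)
        ≤ volume.real (Metric.ball x₀ R \ A) + volume.real A := by
      refine le_trans (le_of_eq ?_) (measureReal_union_le _ _)
      rw [sdiff_union_of_subset hAB]
    linarith

lemma Real.rpow_le_rpow_of_le_one {x y d e : ℝ} (hx : 0 ≤ x) (hxy : x ≤ y) (hy : y ≤ 1)
    (he : 0 ≤ e) (hed : e ≤ d) : x ^ d ≤ y ^ e :=
  (Real.rpow_le_rpow hx hxy (he.trans hed)).trans
    (Real.rpow_le_rpow_of_exponent_ge' (hx.trans hxy) hy he hed)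

lemma measureReal_ball_eq (x : Pt N) {R : ℝ} (hR : 0 < R) :
    volume.real (Metric.ball x R) = R ^ (N : ℝ) * volume.real (Metric.ball (0 : Pt N) 1) := by
  rw [Measure.real, Measure.addHaar_ball_of_pos volume x hR, finrank_euclideanSpace_fin,
    ENNReal.toReal_mul, ENNReal.toReal_ofReal (by positivity), Real.rpow_natCast, Measure.real]

lemma measureReal_unit_ball_pos : 0 < volume.real (Metric.ball (0 : Pt N) 1) :=
  ENNReal.toReal_pos (Metric.measure_ball_pos volume 0 one_pos).ne' measure_ball_lt_top.ne

/-- Balls of small radius have small volume and lie in a compact neighbourhood of `K`. -/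
lemma exists_radius (hN : 0 < N) (hΩ : IsOpen Ω) (hK : IsCompact K) (hKΩ : K ⊆ Ω) :
    ∃ K₀ : Set (Pt N), IsCompact K₀ ∧ K₀ ⊆ Ω ∧ ∀ V : ℝ, 0 < V → ∃ R₀ : ℝ, 0 < R₀ ∧ R₀ ≤ 1 ∧
      ∀ x₀ ∈ K, Metric.closedBall x₀ R₀ ⊆ K₀ ∧
        ∀ R, 0 < R → R < R₀ → volume.real (Metric.ball x₀ R) ≤ V := by
  obtain ⟨r, hr, hrΩ⟩ := hK.exists_cthickening_subset_open hΩ hKΩ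
  -- The compact set is fixed before `V`, since the smallness required of `V` will depend on norms
  -- over this set.
  refine ⟨Metric.cthickening r K, hK.cthickening, hrΩ, fun V hV => ?_⟩
  set m := volume.real (Metric.ball (0 : Pt N) 1)
  have hm : 0 < m := measureReal_unit_ball_pos
  refine ⟨min r (min 1 (V / m)), by positivity, (min_le_right _ _).trans (min_le_left _ _),
    fun x₀ hx₀ => ⟨?_, fun R hR hRR => ?_⟩⟩
  · exact (Metric.closedBall_subset_closedBall (min_le_left _ _)).trans
      (Metric.closedBall_subset_cthickening hx₀ r)
  · have h1 : R ≤ 1 := hRR.le.trans ((min_le_right _ _).trans (min_le_left _ _))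
    have h2 : R ≤ V / m := hRR.le.trans ((min_le_right _ _).trans (min_le_right _ _))
    rw [measureReal_ball_eq x₀ hR]
    rw [le_div_iff₀ hm] at h2
    refine le_trans (mul_le_mul_of_nonneg_right ?_ hm.le) h2
    have : R ^ (N : ℝ) ≤ R ^ (1 : ℝ) :=
      Real.rpow_le_rpow_of_exponent_ge hR h1 (by exact_mod_cast hN)
    simpa using this

end

/-! ### The gain exponent and the Caccioppoli inequality on superlevel sets -/

section gain

variable {n N : ℕ} {Ω : Set (Pt N)} {p ε q C δ β : ℝ} {σ : ℝ≥0∞}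

/-- The condition `q < p²/N` is `q/p < p/N`, and the exponent condition on `c` gives the third
entry. -/
lemma gainExp_pos {a₀ c : Pt N → ℝ} {G : Pt N → Val n → Grad n N → ℝ} (hp : 1 < p)
    (hε : 0 < ε) (h2 : GrowthG Ω p ε q C a₀ G) (h4 : HolderG Ω p q δ β σ c G) :
    0 < gainExp N p q δ β σ ε := by
  have h : q / p < p / N := by
    rw [div_lt_iff₀ (by linarith)]
    calc q < p ^ 2 / N := h2.q_lt
      _ = _ := by ring
  exact lt_min hε (lt_min (by linarith) (by linarith [h4.exponents]))

lemma gainExp_le_left : gainExp N p q δ β σ ε ≤ ε := min_le_left _ _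

lemma gainExp_le_sub_div : gainExp N p q δ β σ ε ≤ p / N - q / p :=
  (min_le_right _ _).trans (min_le_left _ _)

lemma gainExp_le_holder : gainExp N p q δ β σ ε
    ≤ p / N - (δ / p + β / sobolevExp N p + (σ⁻¹).toReal) :=
  (min_le_right _ _).trans (min_le_right _ _)

end gain

lemma setIntegral_le_of_subset_of_nonneg {α : Type*} [MeasurableSpace α] {μ : Measure α}
    {A K : Set α} {g : α → ℝ} (hg : IntegrableOn g K μ) (h0 : ∀ x, 0 ≤ g x) (hAK : A ⊆ K) :
    ∫ x in A, g x ∂μ ≤ ∫ x in K, g x ∂μ :=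
  setIntegral_mono_set hg (Eventually.of_forall h0) hAK.eventuallyLE

set_option maxHeartbeats 2000000 in
/-- The Caccioppoli inequality on superlevel sets of one component. -/
lemma exists_caccioppoli_superSet {n N : ℕ} {Ω : Set (Pt N)} (hΩ : IsOpen Ω)
    {p ε q C δ β : ℝ} {σ : ℝ≥0∞} {γ L : Fin n → ℝ}
    (hp : 1 < p) (hpN : p < N) (hε : 0 < ε) (hεN : ε < p / N)
    {f : Fin n → Pt N → ℝ → Pt N → ℝ} {G : Pt N → Val n → Grad n N → ℝ}
    {a b : Fin n → Pt N → ℝ} {a₀ c : Pt N → ℝ}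
    (h1 : ∀ α : Fin n, GrowthF Ω p ε (γ α) (L α) (a α) (b α) (f α))
    (h2 : GrowthG Ω p ε q C a₀ G)
    (h3 : RankOneConvexG Ω G)
    (h4 : HolderG Ω p q δ β σ c G)
    {u : Pt N → Val n} {Du : Pt N → Grad n N}
    (hu : IsSobolevLoc Ω p u Du)
    (hmin : IsLocalMinimizer Ω p f G u Du)
    {K : Set (Pt N)} (hK : IsCompact K) (hKΩ : K ⊆ Ω) (α : Fin n) :
    ∃ C₁ C₂ R₀ : ℝ, 0 < C₁ ∧ 0 < C₂ ∧ 0 < R₀ ∧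
      ∀ x₀ ∈ K, Metric.closedBall x₀ R₀ ⊆ Ω ∧
        ∀ (ρ R k : ℝ), 0 < ρ → ρ < R → R < R₀ →
          (∫ x in superSet (fun x => u x α) k x₀ ρ, ‖Du x α‖ ^ p)
            ≤ C₁ / (R - ρ) ^ p * (∫ x in superSet (fun x => u x α) k x₀ R, (u x α - k) ^ p)
              + C₂ * (1 + |k| ^ p * R ^ (-(gainExp N p q δ β σ ε * N)))
                * volume.real (superSet (fun x => u x α) k x₀ R)
                    ^ (1 - p / N + gainExp N p q δ β σ ε) := by
  have hN : (0 : ℝ) < N := by linarith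
  have hp0 : 0 < p := by linarith
  have hP := sobolevExp_pos hp hpN
  have hpP := div_sobolevExp hp hpN
  have hpN1 : p / N < 1 := by rwa [div_lt_one hN]
  have hqp := (h2.q_lt_p hp hpN).le
  have hq0 : 0 ≤ q := by linarith [h2.one_le_q]
  have hL := (h1 α).one_lt_L
  have hγp := (h1 α).p_le_γ
  have he0 := gainExp_pos (N := N) hp hε h2 h4
  have hg1 := gainExp_le_left (N := N) (p := p) (q := q) (δ := δ) (β := β) (σ := σ) (ε := ε)
  have hg2 := gainExp_le_sub_div (N := N) (p := p) (q := q) (δ := δ) (β := β) (σ := σ) (ε := ε)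
  have hg3 := gainExp_le_holder (N := N) (p := p) (q := q) (δ := δ) (β := β) (σ := σ) (ε := ε)
  set P := sobolevExp N p with hPdef
  set e0 := gainExp N p q δ β σ ε with he0def
  set e := 1 - p / N + e0 with he
  have hepos : 0 < e := by linarith
  have hδ := h4.δ_pos
  have hβ := h4.β_pos
  set v : Pt N → ℝ := fun x => u x α with hv
  set X : Pt N → Pt N := fun x => Du x α with hX
  obtain ⟨K₀, hK₀, hK₀Ω, hrad⟩ := exists_radius (by exact_mod_cast hN) hΩ hK hKΩ
  obtain ⟨C₀, hC₀, hcomp⟩ := exists_energy_comparison hΩ hp hpN hε hεN h1 h2 h3 h4 hu hmin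
    hK₀ hK₀Ω α
  have hvL : IsLpLoc Ω (ENNReal.ofReal p) v := fun K hK hKΩ => (hu.memLp K hK hKΩ).piLp_apply α
  have hXL : IsLpLoc Ω (ENNReal.ofReal p) X := fun K hK hKΩ =>
    (hu.memLp_grad K hK hKΩ).piLp_apply α
  obtain ⟨S, hS, hsob⟩ := exists_sobolev_superSet_const hΩ hp hpN hvL hXL (hu.weakGradient α)
  have ivP := IsLpLoc.sobolev hΩ hp hpN hvL hXL (hu.weakGradient α) K₀ hK₀ hK₀Ω
  have ivp : IntegrableOn (fun x => |v x| ^ p) K₀ :=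
    (hvL K₀ hK₀ hK₀Ω).integrable_norm_ofReal_rpow hp0
  have iup : IntegrableOn (fun x => ‖u x‖ ^ p) K₀ :=
    (hu.memLp K₀ hK₀ hK₀Ω).integrable_norm_ofReal_rpow hp0
  have iDp : IntegrableOn (fun x => ‖Du x‖ ^ p) K₀ :=
    (hu.memLp_grad K₀ hK₀ hK₀Ω).integrable_norm_ofReal_rpow hp0
  have iXp : IntegrableOn (fun x => ‖X x‖ ^ p) K₀ :=
    (hXL K₀ hK₀ hK₀Ω).integrable_norm_ofReal_rpow hp0
  have hvm : AEMeasurable v (volume.restrict K₀) := (hvL K₀ hK₀ hK₀Ω).1.aemeasurable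
  have hK₀fin : volume K₀ ≠ ⊤ := hK₀.measure_lt_top.ne
  have hmono : volume.restrict K₀ ≤ volume.restrict Ω := Measure.restrict_mono hK₀Ω le_rfl
  set Mu := ∫ x in K₀, |v x| ^ P with hMu
  have hMu0 : 0 ≤ Mu := integral_nonneg fun x => by positivity
  -- The threshold for `|k|^P |A|`. Below it, `W` bounds `∫ |v - k|^P`; above it, the superlevel set
  -- fills half of the ball.
  set m := 1 + Mu with hm
  have hm1 : 1 ≤ m := by linarith
  set W := 2 ^ P * (2 * m) with hW
  set D := ∫ x in K₀, ‖Du x‖ ^ p with hD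
  have hD0 : 0 ≤ D := integral_nonneg fun x => by positivity
  set U := ∫ x in K₀, ‖u x‖ ^ p with hU
  have hU0 : 0 ≤ U := integral_nonneg fun x => by positivity
  set Nb := (eLpNorm (b α) (ENNReal.ofReal (sigmaExp N p ε (γ α))) (volume.restrict K₀)).toReal
  have hNb : 0 ≤ Nb := ENNReal.toReal_nonneg
  set Na := (eLpNorm (a α) (ENNReal.ofReal (kappaExp N p ε)) (volume.restrict K₀)).toReal
  have hNa : 0 ≤ Na := ENNReal.toReal_nonneg
  set N0 := (eLpNorm a₀ (ENNReal.ofReal (kappaExp N p ε)) (volume.restrict K₀)).toReal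
  have hN0 : 0 ≤ N0 := ENNReal.toReal_nonneg
  set Nc := (eLpNorm c σ (volume.restrict K₀)).toReal
  have hNc : 0 ≤ Nc := ENNReal.toReal_nonneg
  have hγp' : 0 ≤ (γ α - p) / P := div_nonneg (by linarith) hP.le
  have hXD : ∀ A : Set (Pt N), A ⊆ K₀ → ∫ x in A, ‖X x‖ ^ p ≤ D := fun A hA =>
    (setIntegral_le_of_subset_of_nonneg iXp (fun x => by positivity) hA).trans
      (integral_mono iXp iDp fun x =>
        Real.rpow_le_rpow (norm_nonneg _) (PiLp.norm_apply_le (Du x) α) hp0.le)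
  -- The coefficient, up to `|A|^ε`, of the gradient energy produced by Sobolev from `∫ b (v -
  -- k)^γ`. The volume bound `V` is chosen so that `coef * V^ε ≤ 1/2`.
  set coef := C₀ * (Nb * (W ^ ((γ α - p) / P) * S)) with hcoef
  have hcoef0 : 0 ≤ coef := by positivity
  set V : ℝ := min 1 ((1 / (2 * (coef + 1))) ^ (1 / ε)) with hV
  have hV0 : 0 < V := by positivity
  have hVε : coef * V ^ ε ≤ 1 / 2 := by
    have h5 : V ^ ε ≤ 1 / (2 * (coef + 1)) := by
      refine (Real.rpow_le_rpow hV0.le (min_le_right _ _) hε.le).trans_eq ?_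
      rw [← Real.rpow_mul (by positivity), one_div_mul_cancel hε.ne', Real.rpow_one]
    calc coef * V ^ ε ≤ coef * (1 / (2 * (coef + 1))) := by gcongr
      _ ≤ 1 / 2 := by
        rw [mul_one_div, div_le_div_iff₀ (by positivity) (by norm_num)]
        linarith
  obtain ⟨R₀, hR₀, hR₀1, hball⟩ := hrad V hV0
  have hθ0 : 0 ≤ (L α + 1 / 2) / (L α + 1) := by positivity
  have hθ1 : (L α + 1 / 2) / (L α + 1) < 1 := by
    rw [div_lt_one (by linarith)]; linarith
  obtain ⟨ci, hci, hiter⟩ := exists_iteration_const hp0 hθ0 hθ1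
  set CE := Nb * m ^ ((γ α - p) / P) + (Na + Nc * D ^ (δ / p) * W ^ (β / P) + D ^ (q / p))
    + (U ^ (q / p) + 1 + N0) with hCE
  have hCE0 : 0 ≤ CE := by positivity
  set ub := volume.real (Metric.ball (0 : Pt N) 1) with hub
  have hub0 : 0 < ub := measureReal_unit_ball_pos
  -- In the first constant, `2^p` comes from halving the gap between radii and `1/2` from the
  -- Sobolev term. In the second, `CE` collects the error terms, the quotient serves the degenerate
  -- case, and 1 ensures positivity.
  refine ⟨ci * ((C₀ + 1 / 2) * 2 ^ p), ci * (C₀ * CE) + D / (ub / 2) ^ e0 + 1, R₀,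
    by positivity, by positivity, hR₀, fun x₀ hx₀ => ⟨(hball x₀ hx₀).1.trans hK₀Ω, ?_⟩⟩
  intro ρ R k hρ hρR hRR₀
  obtain ⟨hBK, hvol⟩ := hball x₀ hx₀
  have hR : 0 < R := hρ.trans hρR
  have hR1 : R ≤ 1 := hRR₀.le.trans hR₀1
  set A : ℝ → Set (Pt N) := fun r => superSet v k x₀ r with hA
  have hAK : ∀ r, r ≤ R → A r ⊆ K₀ := fun r hr => superSet_subset_ball.trans
    ((Metric.ball_subset_ball (hr.trans hRR₀.le)).trans
      (Metric.ball_subset_closedBall.trans hBK))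
  have hAm : ∀ r, r ≤ R → NullMeasurableSet (A r) volume := fun r hr =>
    nullMeasurableSet_superSet hK₀.measurableSet hvm
      ((Metric.ball_subset_ball (hr.trans hRR₀.le)).trans (Metric.ball_subset_closedBall.trans hBK))
  have hAfin : ∀ r, r ≤ R → volume (A r) ≠ ⊤ := fun r hr =>
    ((measure_mono (hAK r hr)).trans_lt hK₀.measure_lt_top).ne
  set x := volume.real (A R) with hx
  have hx0 : 0 ≤ x := measureReal_nonneg
  have hxV : x ≤ V := (measureReal_mono superSet_subset_ball measure_ball_lt_top.ne).trans
    (hvol R hR hRR₀)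
  have hx1 : x ≤ 1 := hxV.trans (min_le_left _ _)
  have hRpow : 1 ≤ R ^ (-(e0 * N)) :=
    Real.one_le_rpow_of_pos_of_le_one_of_nonpos hR hR1 (by
      have : 0 < e0 * N := by positivity
      linarith)
  have hk0 : 0 ≤ |k| ^ p := by positivity
  have hwint : ∫ y in A R, |v y - k| ^ p = ∫ y in A R, (v y - k) ^ p := by
    refine integral_congr_ae ?_
    filter_upwards [ae_restrict_mem₀ (hAm R le_rfl)] with y hy
    have : k < v y := hy.1
    rw [abs_of_nonneg (by linarith)]
  set w := ∫ y in A R, |v y - k| ^ p with hw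
  have hw0 : 0 ≤ w := integral_nonneg fun y => by positivity
  have hRρ : 0 < (R - ρ) ^ p := Real.rpow_pos_of_pos (by linarith) p
  change ∫ y in A ρ, ‖X y‖ ^ p ≤ ci * ((C₀ + 1 / 2) * 2 ^ p) / (R - ρ) ^ p
    * (∫ y in A R, (v y - k) ^ p) + (ci * (C₀ * CE) + D / (ub / 2) ^ e0 + 1)
    * (1 + |k| ^ p * R ^ (-(e0 * N))) * x ^ e
  rw [← hwint]
  have hub2 : 0 < (ub / 2) ^ e0 := by positivity
  -- The bounds for the error terms are uniform in `k` only while `|k|^P |A|` stays bounded; the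
  -- other case is settled without minimality.
  by_cases hnd : |k| ^ P * x ≤ m
  · -- the nondegenerate case
    set E := (1 + |k| ^ p) * x ^ e with hE
    have hE0 : 0 ≤ E := by positivity
    have hxE : x ^ e ≤ E := by
      rw [hE]; exact le_mul_of_one_le_left (by positivity) (by linarith)
    have hstep : ∀ s t, ρ ≤ s → s < t → t < R →
        ∫ y in A s, ‖X y‖ ^ p ≤ (L α + 1 / 2) / (L α + 1) * (∫ y in A t, ‖X y‖ ^ p)
          + ((C₀ + 1 / 2) * 2 ^ p * w) / (t - s) ^ p + C₀ * CE * E := by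
      intro s t hρs hst htR
      have hs0 : 0 < s := hρ.trans_le hρs
      set r := (s + t) / 2 with hr
      have hsr : s < r := by rw [hr]; linarith
      have hrt : r < t := by rw [hr]; linarith
      have hrR : r ≤ R := by linarith
      have hts : 0 < (t - s) ^ p := Real.rpow_pos_of_pos (by linarith) p
      have key := hcomp x₀ k s r hs0 hsr ((Metric.closedBall_subset_closedBall
        (by linarith)).trans hBK) (A s) (A r) rfl rfl
      have hAr := hAK r hrR
      have hArR : A r ⊆ A R := superSet_mono hrR
      set y := volume.real (A r) with hy
      have hy0 : 0 ≤ y := measureReal_nonneg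
      have hyx : y ≤ x := measureReal_mono hArR (hAfin R le_rfl)
      have hvmr : AEMeasurable v (volume.restrict (A r)) :=
        hvm.mono_measure (Measure.restrict_mono hAr le_rfl)
      have hArfin := hAfin r hrR
      have hvmR : AEMeasurable v (volume.restrict (A R)) :=
        hvm.mono_measure (Measure.restrict_mono (hAK R le_rfl) le_rfl)
      have iwR : IntegrableOn (fun y => |v y - k| ^ p) (A R) :=
        (integrableOn_abs_sub_rpow (hAfin R le_rfl) hp0.le hvmR
          (ivp.mono_set (hAK R le_rfl)) k).1
      have hwt : ∀ r', r' ≤ R → ∫ y in A r', |v y - k| ^ p ≤ w := fun r' hr' =>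
        setIntegral_le_of_subset_of_nonneg iwR (fun y => by positivity) (superSet_mono hr')
      have ediv : ∀ I, I / ((t - s) / 2) ^ p = 2 ^ p * (I / (t - s) ^ p) := fun I => by
        rw [Real.div_rpow (by linarith) (by norm_num)]
        have : (2 : ℝ) ^ p ≠ 0 := by positivity
        field_simp
      set w' := w / (t - s) ^ p with hw'
      have hw'0 : 0 ≤ w' := by positivity
      have t1 : (∫ y in A r, |v y - k| ^ p) / (r - s) ^ p ≤ 2 ^ p * w' := by
        rw [show r - s = (t - s) / 2 by rw [hr]; ring, ediv]
        exact mul_le_mul_of_nonneg_left (div_le_div_of_nonneg_right (hwt r hrR) hts.le)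
          (by positivity)
      obtain ⟨iP, hP2⟩ := integrableOn_abs_sub_rpow hArfin hP.le hvmr (ivP.mono_set hAr) k
      have hWle : ∫ y in A r, |v y - k| ^ P ≤ W := by
        refine hP2.trans (mul_le_mul_of_nonneg_left ?_ (by positivity))
        have u1 : ∫ y in A r, |v y| ^ P ≤ Mu :=
          setIntegral_le_of_subset_of_nonneg ivP (fun y => by positivity) hAr
        have u2 : |k| ^ P * y ≤ |k| ^ P * x := by gcongr
        linarith
      have hW0 : 0 ≤ ∫ y in A r, |v y - k| ^ P := integral_nonneg fun y => by positivity
      have hΦt0 : 0 ≤ ∫ y in A t, ‖X y‖ ^ p := integral_nonneg fun y => by positivity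
      -- With `γ/P = (γ - p)/P + p/P`, the first power is bounded by `W` and the second is estimated
      -- by Sobolev; the volume factor then brings the coefficient down to `1/2`.
      have t2 : C₀ * (∫ y in A r, b α y * |v y - k| ^ γ α)
          ≤ 1 / 2 * ((∫ y in A t, ‖X y‖ ^ p) + 2 ^ p * w') := by
        have u1 := ((h1 α).setIntegral_b_mul_rpow_le hp hpN hε hK₀ hK₀Ω hAr iP).2
        have u2 := hsob x₀ k r t (hs0.trans hsr) hrt ((Metric.closedBall_subset_closedBall
          (by linarith)).trans (hBK.trans hK₀Ω))
        rw [show t - r = (t - s) / 2 by rw [hr]; ring, ediv] at u2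
        have u3 : (∫ y in A r, |v y - k| ^ P) ^ (γ α / P)
            ≤ W ^ ((γ α - p) / P) * (S * ((∫ y in A t, ‖X y‖ ^ p) + 2 ^ p * w')) := by
          rw [show γ α / P = (γ α - p) / P + p / P by ring,
            Real.rpow_add_of_nonneg hW0 hγp' (by positivity)]
          refine mul_le_mul (Real.rpow_le_rpow hW0 hWle hγp') (u2.trans ?_) (by positivity)
            (by positivity)
          exact mul_le_mul_of_nonneg_left (add_le_add le_rfl (mul_le_mul_of_nonneg_left
            (div_le_div_of_nonneg_right (hwt t htR.le) hts.le) (by positivity))) hS.le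
        have u4 : y ^ ε ≤ V ^ ε := Real.rpow_le_rpow hy0 (hyx.trans hxV) hε.le
        calc C₀ * (∫ y in A r, b α y * |v y - k| ^ γ α)
            ≤ C₀ * (Nb * (W ^ ((γ α - p) / P) * (S * ((∫ y in A t, ‖X y‖ ^ p) + 2 ^ p * w')))
                * V ^ ε) := by
              refine mul_le_mul_of_nonneg_left (u1.trans ?_) hC₀.le
              gcongr
          _ = (coef * V ^ ε) * ((∫ y in A t, ‖X y‖ ^ p) + 2 ^ p * w') := by rw [hcoef]; ring
          _ ≤ _ := mul_le_mul_of_nonneg_right hVε (by positivity)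
      -- Measures are at most 1, so every exponent produced by Hölder may be lowered to `e`.
      have hpow : ∀ d, e ≤ d → y ^ d ≤ E := fun d hd =>
        (Real.rpow_le_rpow_of_le_one hy0 hyx hx1 hepos.le hd).trans hxE
      have t3 : |k| ^ γ α * (∫ y in A r, b α y) ≤ Nb * m ^ ((γ α - p) / P) * E := by
        have u1 := ((h1 α).setIntegral_b_le hp hpN hε hK₀ hK₀Ω hAr).2
        have u2 : y ^ (γ α / P + ε) ≤ x ^ (γ α / P) * x ^ ε := by
          rw [← Real.rpow_add_of_nonneg hx0 (div_nonneg (by linarith) hP.le) hε.le]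
          exact Real.rpow_le_rpow hy0 hyx (add_nonneg (div_nonneg (by linarith) hP.le) hε.le)
        have u3 : |k| ^ γ α * x ^ (γ α / P) ≤ m ^ ((γ α - p) / P) * (|k| ^ p * x ^ (p / P)) := by
          have r1 : ∀ g : ℝ, |k| ^ g * x ^ (g / P) = (|k| ^ P * x) ^ (g / P) := fun g => by
            rw [Real.mul_rpow (by positivity) hx0, ← Real.rpow_mul (abs_nonneg k),
              mul_div_cancel₀ _ hP.ne']
          rw [r1, r1, show γ α / P = (γ α - p) / P + p / P by ring,
            Real.rpow_add_of_nonneg (by positivity) hγp' (by positivity)]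
          gcongr
        have u4 : |k| ^ p * x ^ (p / P) * x ^ ε ≤ E := by
          rw [mul_assoc, ← Real.rpow_add_of_nonneg hx0 (by positivity) hε.le, hE]
          refine mul_le_mul (by linarith) ?_ (by positivity) (by positivity)
          exact Real.rpow_le_rpow_of_exponent_ge' hx0 hx1 hepos.le (by rw [hpP, he]; linarith)
        calc |k| ^ γ α * (∫ y in A r, b α y)
            ≤ |k| ^ γ α * (Nb * (x ^ (γ α / P) * x ^ ε)) := by
              refine mul_le_mul_of_nonneg_left (u1.trans ?_) (by positivity)
              gcongr
          _ = Nb * ((|k| ^ γ α * x ^ (γ α / P)) * x ^ ε) := by ring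
          _ ≤ Nb * ((m ^ ((γ α - p) / P) * (|k| ^ p * x ^ (p / P))) * x ^ ε) := by gcongr
          _ = Nb * m ^ ((γ α - p) / P) * (|k| ^ p * x ^ (p / P) * x ^ ε) := by ring
          _ ≤ _ := by gcongr
      have t4 : ∫ y in A r, a α y ≤ Na * E :=
        (setIntegral_le_of_memLp_kappa hp hpN hε hεN hK₀ hAr ((h1 α).a_memLp K₀ hK₀ hK₀Ω)
          (ae_mono hmono (h1 α).a_nonneg)).2.trans
          (mul_le_mul_of_nonneg_left (hpow _ (by rw [he]; linarith)) hNa)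
      have iDr := iDp.mono_set hAr
      have hDr : ∫ y in A r, ‖Du y‖ ^ p ≤ D :=
        setIntegral_le_of_subset_of_nonneg iDp (fun y => by positivity) hAr
      have hDr0 : 0 ≤ ∫ y in A r, ‖Du y‖ ^ p := integral_nonneg fun y => by positivity
      have hUr : ∫ y in A r, ‖u y‖ ^ p ≤ U :=
        setIntegral_le_of_subset_of_nonneg iup (fun y => by positivity) hAr
      have hUr0 : 0 ≤ ∫ y in A r, ‖u y‖ ^ p := integral_nonneg fun y => by positivity
      have t5 : ∫ y in A r, c y * ‖Du y‖ ^ δ * |v y - k| ^ β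
          ≤ Nc * D ^ (δ / p) * W ^ (β / P) * E := by
        refine (h4.setIntegral_le hp hpN hK₀ hK₀Ω hAr iDr iP).2.trans ?_
        have := hpow (1 - (δ / p + β / P + (σ⁻¹).toReal)) (by rw [he]; linarith)
        gcongr
      have t6 : ∫ y in A r, ‖Du y‖ ^ q ≤ D ^ (q / p) * E := by
        refine (setIntegral_norm_rpow_le hp0 hq0 hqp hArfin iDr).2.trans ?_
        have := hpow (1 - q / p) (by rw [he]; linarith)
        gcongr
      have t7 : ∫ y in A r, ‖u y‖ ^ q ≤ U ^ (q / p) * E := by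
        refine (setIntegral_norm_rpow_le hp0 hq0 hqp hArfin (iup.mono_set hAr)).2.trans ?_
        have := hpow (1 - q / p) (by rw [he]; linarith)
        gcongr
      have t8 : (1 + |k| ^ p) * y ≤ 1 * E := by
        rw [one_mul, hE]
        refine mul_le_mul_of_nonneg_left ?_ (by positivity)
        have := Real.rpow_le_rpow_of_le_one hy0 hyx hx1 hepos.le
          (show e ≤ 1 by rw [he]; linarith)
        rwa [Real.rpow_one] at this
      have t9 : ∫ y in A r, a₀ y ≤ N0 * E :=
        (setIntegral_le_of_memLp_kappa hp hpN hε hεN hK₀ hAr (h2.a_memLp K₀ hK₀ hK₀Ω)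
          (ae_mono hmono h2.a_nonneg)).2.trans
          (mul_le_mul_of_nonneg_left (hpow _ (by rw [he]; linarith)) hN0)
      have hΦr : ∫ y in A r, ‖X y‖ ^ p ≤ ∫ y in A t, ‖X y‖ ^ p :=
        setIntegral_le_of_subset_of_nonneg (iXp.mono_set (hAK t htR.le))
          (fun y => by positivity) (superSet_mono hrt.le)
      change (L α + 1) * (∫ y in A s, ‖X y‖ ^ p) ≤ L α * (∫ y in A r, ‖X y‖ ^ p)
        + C₀ * (((∫ y in A r, |v y - k| ^ p) / (r - s) ^ p
            + (∫ y in A r, b α y * |v y - k| ^ γ α) + |k| ^ γ α * (∫ y in A r, b α y))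
          + ((∫ y in A r, a α y) + (∫ y in A r, c y * ‖Du y‖ ^ δ * |v y - k| ^ β)
            + (∫ y in A r, ‖Du y‖ ^ q))
          + ((∫ y in A r, ‖u y‖ ^ q) + (1 + |k| ^ p) * y + (∫ y in A r, a₀ y))) at key
      have hrest : C₀ * ((∫ y in A r, |v y - k| ^ p) / (r - s) ^ p)
          + C₀ * (|k| ^ γ α * (∫ y in A r, b α y)
          + ((∫ y in A r, a α y) + (∫ y in A r, c y * ‖Du y‖ ^ δ * |v y - k| ^ β)
            + (∫ y in A r, ‖Du y‖ ^ q))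
          + ((∫ y in A r, ‖u y‖ ^ q) + (1 + |k| ^ p) * y + (∫ y in A r, a₀ y)))
          ≤ C₀ * (2 ^ p * w') + C₀ * (CE * E) := by
        refine add_le_add (mul_le_mul_of_nonneg_left t1 hC₀.le)
          (mul_le_mul_of_nonneg_left ?_ hC₀.le)
        rw [hCE]
        linarith
      have hLΦ : L α * (∫ y in A r, ‖X y‖ ^ p) ≤ L α * (∫ y in A t, ‖X y‖ ^ p) :=
        mul_le_mul_of_nonneg_left hΦr (by linarith)
      have hall : (L α + 1) * (∫ y in A s, ‖X y‖ ^ p)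
          ≤ (L α + 1 / 2) * (∫ y in A t, ‖X y‖ ^ p) + ((C₀ + 1 / 2) * 2 ^ p * w' + C₀ * CE * E) := by
        linarith
      have hL1 : 0 < L α + 1 := by linarith
      have hrhs : 0 ≤ (C₀ + 1 / 2) * 2 ^ p * w' + C₀ * CE * E := by positivity
      have hfin : ∫ y in A s, ‖X y‖ ^ p ≤ ((L α + 1 / 2) * (∫ y in A t, ‖X y‖ ^ p)
          + ((C₀ + 1 / 2) * 2 ^ p * w' + C₀ * CE * E)) / (L α + 1) := by
        rw [le_div_iff₀ hL1]; linarith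
      refine hfin.trans ?_
      rw [add_div, mul_div_right_comm, add_assoc]
      refine add_le_add le_rfl ((div_le_self hrhs (by linarith)).trans (le_of_eq ?_))
      rw [hw']; ring
    have hit := hiter (fun s => ∫ y in A s, ‖X y‖ ^ p) ρ R ((C₀ + 1 / 2) * 2 ^ p * w)
      (C₀ * CE * E) D hρR (by positivity) (by positivity)
      (fun s _ hsR => hXD _ (hAK s hsR.le)) hstep
    refine hit.trans ?_
    rw [mul_add]
    refine add_le_add (le_of_eq (by ring)) ?_
    -- Here the negative power of `R` is not needed; it is at least 1 because `R ≤ 1`.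
    have hEle : E ≤ (1 + |k| ^ p * R ^ (-(e0 * N))) * x ^ e := by
      rw [hE]
      have := le_mul_of_one_le_right hk0 hRpow
      gcongr
    calc ci * (C₀ * CE * E) ≤ ci * (C₀ * CE) * ((1 + |k| ^ p * R ^ (-(e0 * N))) * x ^ e) := by
          rw [mul_assoc ci]; gcongr
      _ ≤ (ci * (C₀ * CE) + D / (ub / 2) ^ e0 + 1)
          * ((1 + |k| ^ p * R ^ (-(e0 * N))) * x ^ e) := by
          refine mul_le_mul_of_nonneg_right ?_ (by positivity)
          have : 0 ≤ D / (ub / 2) ^ e0 := by positivity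
          linarith
      _ = _ := by ring
  · -- the degenerate case
    rw [not_le] at hnd
    have hhalf := measureReal_ball_le_two_mul hP hK₀ ((Metric.ball_subset_ball hRR₀.le).trans
      (Metric.ball_subset_closedBall.trans hBK)) hvm ivP (k := k) (R := R) (x₀ := x₀)
      ((by linarith : Mu < m).trans hnd)
    rw [measureReal_ball_eq x₀ hR] at hhalf
    have hRN : 0 < R ^ (N : ℝ) := by positivity
    have u1 : ub / 2 ≤ R ^ (-(N : ℝ)) * x := by
      rw [Real.rpow_neg hR.le, inv_mul_eq_div, le_div_iff₀ hRN]
      change R ^ (N : ℝ) * ub ≤ 2 * x at hhalf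
      linarith
    have u2 : (ub / 2) ^ e0 ≤ R ^ (-(e0 * N)) * x ^ e0 := by
      refine (Real.rpow_le_rpow (by positivity) u1 he0.le).trans_eq ?_
      rw [Real.mul_rpow (by positivity) hx0, ← Real.rpow_mul hR.le]
      congr 2; ring
    have u3 : 1 ≤ |k| ^ p * x ^ (p / P) := by
      have r1 : |k| ^ p * x ^ (p / P) = (|k| ^ P * x) ^ (p / P) := by
        rw [Real.mul_rpow (by positivity) hx0, ← Real.rpow_mul (abs_nonneg k),
          mul_div_cancel₀ _ hP.ne']
      rw [r1]
      exact Real.one_le_rpow (by linarith) (by positivity)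
    -- Since `e = p/P + e0`, the power `x^(p/P)` is used with `|k|^p` to give at least 1, and `x^e0`
    -- with `R^(-e0 N)` through the half-ball bound.
    have u4 : (ub / 2) ^ e0 ≤ |k| ^ p * R ^ (-(e0 * N)) * x ^ e := by
      rw [he, ← hpP, Real.rpow_add_of_nonneg hx0 (by positivity) he0.le]
      calc (ub / 2) ^ e0 ≤ 1 * (R ^ (-(e0 * N)) * x ^ e0) := by rw [one_mul]; exact u2
        _ ≤ (|k| ^ p * x ^ (p / P)) * (R ^ (-(e0 * N)) * x ^ e0) := by gcongr
        _ = _ := by ring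
    have u5 : D ≤ D / (ub / 2) ^ e0 * (|k| ^ p * R ^ (-(e0 * N)) * x ^ e) := by
      calc D = D / (ub / 2) ^ e0 * (ub / 2) ^ e0 := by field_simp
        _ ≤ _ := by gcongr
    refine (hXD _ (hAK ρ hρR.le)).trans (u5.trans ?_)
    have u6 : 0 ≤ ci * ((C₀ + 1 / 2) * 2 ^ p) / (R - ρ) ^ p * w := by positivity
    have u7 : |k| ^ p * R ^ (-(e0 * N)) * x ^ e ≤ (1 + |k| ^ p * R ^ (-(e0 * N))) * x ^ e := by
      gcongr; linarith
    have u8 : D / (ub / 2) ^ e0 ≤ ci * (C₀ * CE) + D / (ub / 2) ^ e0 + 1 := by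
      have : 0 ≤ ci * (C₀ * CE) := by positivity
      linarith
    calc _ ≤ (ci * (C₀ * CE) + D / (ub / 2) ^ e0 + 1)
          * ((1 + |k| ^ p * R ^ (-(e0 * N))) * x ^ e) := by gcongr
      _ ≤ _ := by rw [← mul_assoc]; linarith

/-! ### Reflection `u ↦ -u`, exchanging superlevel and sublevel sets -/

section reflection

variable {n N : ℕ} {Ω : Set (Pt N)}

lemma GrowthF.reflect {p ε γ L : ℝ} {a b : Pt N → ℝ} {f : Pt N → ℝ → Pt N → ℝ}
    (h : GrowthF Ω p ε γ L a b f) : GrowthF Ω p ε γ L a b (fun x s ξ => f x (-s) (-ξ)) where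
  caratheodory :=
    { measurable := fun y => h.caratheodory.measurable (-y)
      continuous := h.caratheodory.continuous.mono fun _ hx => hx.comp continuous_neg }
  one_lt_L := h.one_lt_L
  p_le_γ := h.p_le_γ
  γ_lt := h.γ_lt
  γ_add_lt := h.γ_add_lt
  b_nonneg := h.b_nonneg
  a_nonneg := h.a_nonneg
  b_memLp := h.b_memLp
  a_memLp := h.a_memLp
  growth := h.growth.mono fun _ hx s ξ => by simpa only [norm_neg, abs_neg] using hx (-s) (-ξ)

variable {G : Pt N → Val n → Grad n N → ℝ}

lemma GrowthG.reflect {p ε q C : ℝ} {a : Pt N → ℝ} (h : GrowthG Ω p ε q C a G) :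
    GrowthG Ω p ε q C a (fun x v ξ => G x (-v) (-ξ)) where
  caratheodory :=
    { measurable := fun y => h.caratheodory.measurable (-y)
      continuous := h.caratheodory.continuous.mono fun _ hx => hx.comp continuous_neg }
  one_lt_C := h.one_lt_C
  one_le_q := h.one_le_q
  q_lt := h.q_lt
  a_nonneg := h.a_nonneg
  a_memLp := h.a_memLp
  growth := h.growth.mono fun _ hx v ξ => by simpa only [norm_neg] using hx (-v) (-ξ)

lemma RankOneConvexG.reflect (h : RankOneConvexG Ω G) :
    RankOneConvexG Ω (fun x v ξ => G x (-v) (-ξ)) := by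
  refine h.mono fun x hx v t ξ₁ ξ₂ ht0 ht1 hrank => ?_
  -- The two matrices are exchanged so that the difference `-ξ₂ - (-ξ₁)` is again `ξ₁ - ξ₂`, and the
  -- rank condition transfers as it stands.
  have key := hx (-v) (1 - t) (-ξ₂) (-ξ₁) (by linarith) (by linarith) (by
    convert hrank using 3
    ext α i
    simp only [PiLp.neg_apply]
    ring)
  have e : (1 - t) • -ξ₂ + (1 - (1 - t)) • -ξ₁ = -(t • ξ₁ + (1 - t) • ξ₂) := by
    rw [sub_sub_cancel, smul_neg, smul_neg]; abel
  rw [e, sub_sub_cancel] at key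
  linarith

lemma HolderG.reflect {p q δ β : ℝ} {σ : ℝ≥0∞} {c : Pt N → ℝ} (h : HolderG Ω p q δ β σ c G) :
    HolderG Ω p q δ β σ c (fun x v ξ => G x (-v) (-ξ)) where
  δ_pos := h.δ_pos
  δ_lt := h.δ_lt
  β_pos := h.β_pos
  β_lt := h.β_lt
  σ_gt := h.σ_gt
  exponents := h.exponents
  c_nonneg := h.c_nonneg
  c_memLp := h.c_memLp
  holder := h.holder.mono fun x hx v w ξ => by
    have := hx (-v) (-w) (-ξ)
    rwa [norm_neg, neg_sub_neg, norm_sub_rev] at this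

lemma IsSobolevLoc.neg {p : ℝ} {u : Pt N → Val n} {Du : Pt N → Grad n N}
    (h : IsSobolevLoc Ω p u Du) : IsSobolevLoc Ω p (fun x => -u x) (fun x => -Du x) where
  memLp := fun K hK hKΩ => (h.memLp K hK hKΩ).neg
  memLp_grad := fun K hK hKΩ => (h.memLp_grad K hK hKΩ).neg
  weakGradient := fun α => (h.weakGradient α).neg

lemma IsSobolev.neg {p : ℝ} {u : Pt N → Val n} {Du : Pt N → Grad n N}
    (h : IsSobolev Ω p u Du) : IsSobolev Ω p (fun x => -u x) (fun x => -Du x) where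
  memLp := h.memLp.neg
  memLp_grad := h.memLp_grad.neg
  weakGradient := fun α => (h.weakGradient α).neg

lemma IsLocalMinimizer.neg {p : ℝ} {f : Fin n → Pt N → ℝ → Pt N → ℝ} {u : Pt N → Val n}
    {Du : Pt N → Grad n N} (h : IsLocalMinimizer Ω p f G u Du) :
    IsLocalMinimizer Ω p (fun α x s ξ => f α x (-s) (-ξ)) (fun x v ξ => G x (-v) (-ξ))
      (fun x => -u x) (fun x => -Du x) := by
  intro φ Dφ K hφ hK hKΩ h0
  have key := h (fun x => -φ x) (fun x => -Dφ x) K hφ.neg hK hKΩ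
    (h0.mono fun x hx hxK => by rw [hx hxK, neg_zero])
  simpa only [energy, PiLp.neg_apply, PiLp.add_apply, neg_neg, neg_add] using key

lemma superSet_neg (v : Pt N → ℝ) (k : ℝ) (x₀ : Pt N) (s : ℝ) :
    superSet (fun x => -v x) (-k) x₀ s = subSet v k x₀ s := by
  simp only [superSet, subSet, neg_lt_neg_iff]

end reflection

/-! ### Common constants for all components and conclusion -/

lemma setIntegral_superSet_nonneg {N : ℕ} {v : Pt N → ℝ} {k p R : ℝ} {x₀ : Pt N}
    (hv : AEMeasurable v (volume.restrict (Metric.closedBall x₀ R))) :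
    0 ≤ ∫ x in superSet v k x₀ R, (v x - k) ^ p := by
  refine integral_nonneg_of_ae ?_
  filter_upwards [ae_restrict_mem₀ (nullMeasurableSet_superSet measurableSet_closedBall hv
    Metric.ball_subset_closedBall)] with x hx
  exact Real.rpow_nonneg (sub_nonneg.2 (le_of_lt hx.1)) p

/-- Finitely many inequalities that hold for positive constants and small radii hold with common
constants and a common radius. -/
lemma exists_common_constants {ι : Type*} [Fintype ι] {r : ℝ} (hr : 0 < r)
    {C₁ C₂ R₀ : ι → ℝ} (h1 : ∀ i, 0 < C₁ i) (h2 : ∀ i, 0 < C₂ i) (h0 : ∀ i, 0 < R₀ i) :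
    ∃ c₁ c₂ r₀ : ℝ, 0 < c₁ ∧ 0 < c₂ ∧ 0 < r₀ ∧ r₀ ≤ r ∧
      ∀ i, C₁ i ≤ c₁ ∧ C₂ i ≤ c₂ ∧ r₀ ≤ R₀ i := by
  have s0 : 0 ≤ ∑ i, (R₀ i)⁻¹ := Finset.sum_nonneg fun i _ => (inv_pos.2 (h0 i)).le
  have s1 : 0 ≤ ∑ i, C₁ i := Finset.sum_nonneg fun i _ => (h1 i).le
  have s2 : 0 ≤ ∑ i, C₂ i := Finset.sum_nonneg fun i _ => (h2 i).le
  have hr' : 0 < r⁻¹ := inv_pos.2 hr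
  -- Sums replace maxima, and the inverse of a sum of inverses replaces a minimum; both remain
  -- meaningful for an empty index set.
  refine ⟨1 + ∑ i, C₁ i, 1 + ∑ i, C₂ i, (r⁻¹ + ∑ i, (R₀ i)⁻¹)⁻¹, by positivity, by positivity,
    by positivity, ?_, fun i => ⟨?_, ?_, ?_⟩⟩
  · exact inv_le_of_inv_le₀ hr (by linarith)
  · have := Finset.single_le_sum (fun j _ => (h1 j).le) (Finset.mem_univ i)
    linarith
  · have := Finset.single_le_sum (fun j _ => (h2 j).le) (Finset.mem_univ i)
    linarith
  · have := Finset.single_le_sum (fun j _ => (inv_pos.2 (h0 j)).le) (Finset.mem_univ i)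
    exact inv_le_of_inv_le₀ (h0 i) (by linarith)

end

theorem theorem2 {n N : ℕ} (Ω : Set (Pt N)) (hΩ : IsOpen Ω)
    (p ε q C δ β : ℝ) (σ : ℝ≥0∞) (γ L : Fin n → ℝ)
    (hp : 1 < p) (hpN : p < N) (hε : 0 < ε) (hεN : ε < p / N)
    (f : Fin n → Pt N → ℝ → Pt N → ℝ) (G : Pt N → Val n → Grad n N → ℝ)
    (a b : Fin n → Pt N → ℝ) (a₀ c : Pt N → ℝ)
    (h1 : ∀ α : Fin n, GrowthF Ω p ε (γ α) (L α) (a α) (b α) (f α))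
    (h2 : GrowthG Ω p ε q C a₀ G)
    (h3 : RankOneConvexG Ω G)
    (h4 : HolderG Ω p q δ β σ c G)
    (u : Pt N → Val n) (Du : Pt N → Grad n N)
    (hu : IsSobolevLoc Ω p u Du)
    (hmin : IsLocalMinimizer Ω p f G u Du)
    (K : Set (Pt N)) (hK : IsCompact K) (hKΩ : K ⊆ Ω) :
    ∃ C₁ C₂ R₀ : ℝ, 0 < C₁ ∧ 0 < C₂ ∧ 0 < R₀ ∧
      ∀ x₀ ∈ K, Metric.closedBall x₀ R₀ ⊆ Ω ∧
        ∀ (α : Fin n) (ρ R k : ℝ), 0 < ρ → ρ < R → R < R₀ →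
          ((∫ x in superSet (fun x => u x α) k x₀ ρ, ‖Du x α‖ ^ p)
            ≤ C₁ / (R - ρ) ^ p * (∫ x in superSet (fun x => u x α) k x₀ R, (u x α - k) ^ p)
              + C₂ * (1 + |k| ^ p * R ^ (-(gainExp N p q δ β σ ε * N)))
                * volume.real (superSet (fun x => u x α) k x₀ R)
                    ^ (1 - p / N + gainExp N p q δ β σ ε)) ∧
          ((∫ x in subSet (fun x => u x α) k x₀ ρ, ‖Du x α‖ ^ p)
            ≤ C₁ / (R - ρ) ^ p * (∫ x in subSet (fun x => u x α) k x₀ R, (k - u x α) ^ p)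
              + C₂ * (1 + |k| ^ p * R ^ (-(gainExp N p q δ β σ ε * N)))
                * volume.real (subSet (fun x => u x α) k x₀ R)
                    ^ (1 - p / N + gainExp N p q δ β σ ε)) := by
  have hN : (0 : ℝ) < N := by linarith
  have hsup := fun α => exists_caccioppoli_superSet hΩ hp hpN hε hεN h1 h2 h3 h4 hu hmin hK hKΩ α
  have hsub := fun α => exists_caccioppoli_superSet hΩ hp hpN hε hεN (fun α => (h1 α).reflect)
    h2.reflect h3.reflect h4.reflect hu.neg hmin.neg hK hKΩ α
  choose A₁ A₂ S hA₁ hA₂ hS hA using hsup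
  choose B₁ B₂ T hB₁ hB₂ hT hB using hsub
  obtain ⟨K₀, -, hK₀Ω, hrad⟩ := exists_radius (by exact_mod_cast hN) hΩ hK hKΩ
  obtain ⟨r, hr, -, hball⟩ := hrad 1 one_pos
  obtain ⟨C₁, C₂, R₀, hC₁, hC₂, hR₀, hR₀r, hle⟩ := exists_common_constants hr
    (C₁ := Sum.elim A₁ B₁) (C₂ := Sum.elim A₂ B₂) (R₀ := Sum.elim S T)
    (by rintro (α | α) <;> simp [hA₁, hB₁]) (by rintro (α | α) <;> simp [hA₂, hB₂])
    (by rintro (α | α) <;> simp [hS, hT])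
  have hsubset : ∀ x₀ ∈ K, Metric.closedBall x₀ R₀ ⊆ Ω := fun x₀ hx₀ =>
    (Metric.closedBall_subset_closedBall hR₀r).trans ((hball x₀ hx₀).1.trans hK₀Ω)
  refine ⟨C₁, C₂, R₀, hC₁, hC₂, hR₀, fun x₀ hx₀ => ⟨hsubset x₀ hx₀, ?_⟩⟩
  intro α ρ R k hρ hρR hRR₀
  have hR : 0 < R := hρ.trans hρR
  have hRρ : 0 < (R - ρ) ^ p := Real.rpow_pos_of_pos (sub_pos.2 hρR) p
  have hm : AEMeasurable (fun x => u x α) (volume.restrict (Metric.closedBall x₀ R)) :=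
    ((hu.memLp _ (isCompact_closedBall x₀ R) ((Metric.closedBall_subset_closedBall
      hRR₀.le).trans (hsubset x₀ hx₀))).piLp_apply α).1.aemeasurable
  -- Enlarging the constants is legitimate because the integral and the measure they multiply are
  -- nonnegative.
  have hmono : ∀ {c₁ c₂ I V l : ℝ}, c₁ ≤ C₁ → c₂ ≤ C₂ → 0 ≤ I → 0 ≤ V →
      l ≤ c₁ / (R - ρ) ^ p * I + c₂ * (1 + |k| ^ p * R ^ (-(gainExp N p q δ β σ ε * N)))
        * V ^ (1 - p / N + gainExp N p q δ β σ ε) →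
      l ≤ C₁ / (R - ρ) ^ p * I + C₂ * (1 + |k| ^ p * R ^ (-(gainExp N p q δ β σ ε * N)))
        * V ^ (1 - p / N + gainExp N p q δ β σ ε) := by
    intro c₁ c₂ I V l hc₁ hc₂ hI hV hl
    refine hl.trans ?_
    gcongr
  obtain ⟨a1, a2, a3⟩ := hle (Sum.inl α)
  obtain ⟨b1, b2, b3⟩ := hle (Sum.inr α)
  refine ⟨hmono a1 a2 (setIntegral_superSet_nonneg hm) measureReal_nonneg
    ((hA α x₀ hx₀).2 ρ R k hρ hρR (hRR₀.trans_le a3)), ?_⟩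
  have hI := setIntegral_superSet_nonneg (k := -k) (p := p) hm.neg
  -- The level becomes `-k`, which changes neither `|k|` nor, after reflection, the sublevel sets of
  -- `u^α` at `k`.
  have hcac := (hB α x₀ hx₀).2 ρ R (-k) hρ hρR (hRR₀.trans_le b3)
  have e : ∀ x, -u x α - -k = k - u x α := fun x => by ring
  simp only [Pi.neg_def, PiLp.neg_apply, norm_neg, abs_neg, superSet_neg, e] at hI hcac
  exact hmono b1 b2 hI measureReal_nonneg hcac
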